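/- **Setting.** Let $N\ge 2$, $k_BT,m,t_0,\varepsilon_0>0$. Let $U_1(\mathbf r,t)$ ($t\in[0,t_0]$ the rescaled time) be differentiable in $\mathbf r$ with $\nabla U_1$ continuous in $t$, let $U_2(\mathbf r,\mathbf r')$ be differentiable in $\mathbf r\neq\mathbf r'$, let $\mathbf Z_1,\mathbf Z_2$ be symmetric $3\times3$-matrix valued and $g$ real valued functions of $(\mathbf r,\mathbf r')\in\mathbb R^3\times\mathbb R^3$, with $g,\mathbf Z_1,\mathbf Z_2,\nabla_{\mathbf r}U_2$ measurable and $g,\,g\mathbf Z_1,\,g\mathbf Z_2,\,g\nabla_{\mathbf r}U_2$ bounded. Assume that the friction tensor with blocks $\boldsymbol\Gamma_{ij}=\delta_{ij}\big(\mathbf 1+\sum_{l\ne i}\mathbf Z_1(\mathbf r_i,\mathbf r_l)\big)+(1-\delta_{ij})\mathbf Z_2(\mathbf r_i,\mathbf r_j)$ satisfies $\sum_{i,j}\mathbf w_i\cdot\boldsymbol\Gamma_{ij}\mathbf w_j\ge\delta\sum_i|\mathbf w_i|^2$ with some $\delta>0$ for all $\mathbf w_1,\dots,\mathbf w_N\in\mathbb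 R^3$ and all configurations of distinct points. Put $V_j=U_j/k_BT$ and $$\begin{aligned}\mathcal L_0 f&=\nabla_{\mathbf p}\cdot(\mathbf p+\nabla_{\mathbf p})f,\qquad \mathcal L_1 f=(-\mathbf p\cdot\nabla_{\mathbf r}+\nabla_{\mathbf r}V_1\cdot\nabla_{\mathbf p})f,\\ \mathcal N_0(f,\tilde f)&=\nabla_{\mathbf p}\cdot\int g(\mathbf r,\mathbf r')f(\mathbf r',\mathbf p')\mathbf Z_1(\mathbf r,\mathbf r')(\mathbf p+\nabla_{\mathbf p})\tilde f(\mathbf r,\mathbf p)\,d\mathbf r'd\mathbf p'\\&\quad+\nabla_{\mathbf p}\cdot\Big[\tilde f(\mathbf r,\mathbf p)\int g(\mathbf r,\mathbf r')\mathbf Z_2(\mathbf r,\mathbf r')(\mathbf p'+\nabla_{\mathbf p'})f(\mathbf r',\mathbf p')\,d\mathbf r'd\mathbf p'\Big],\\ \mathcal N_1(f,\tilde f)&=\int f(\mathbf r',\mathbf p')g(\mathbf r,\mathbf r')\nabla_{\mathbf r}V_2(\mathbf r,\mathbf r')\,d\mathbf r'd\mathbf p'\cdot\nabla_{\mathbf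 p}\tilde f(\mathbf r,\mathbf p).\end{aligned}$$ Write $M(\mathbf p)=(2\pi)^{-3/2}e^{-|\mathbf p|^2/2}$. Let $\|h\|_t$ be the supremum over $\mathbf r,\mathbf p$ of $(1+|\mathbf r|)^4(1+|\mathbf p|)^6\big(|h|+|\partial_th|+|\nabla_{\mathbf r}h|+|\nabla_{\mathbf p}h|+|\nabla^2_{\mathbf p}h|\big)$ at time $t$. Call $h(\mathbf r,\mathbf p,t)$ *regular* if it is differentiable in $t$ and $\mathbf r$ and twice differentiable in $\mathbf p$, these derivatives and $h$ are continuous on $[0,t_0]\times\mathbb R^6$, and $\sup_{t\in[0,t_0]}\|h\|_t<\infty$ (at the end points of $[0,t_0]$, and of the time interval below, time derivatives are one-sided). **Hypotheses.** For every $\varepsilon\in(0,\varepsilon_0)$ let $f^{(1)}_\varepsilon>0$ be a regular solution on $[0,t_0]$ of $$\partial_tf^{(1)}=\tfrac1\varepsilon\big[\mathcal L_1f^{(1)}+\mathcal N_1(f^{(1)},f^{(1)})\big]+\tfrac1{\varepsilon^2}\big[\mathcal L_0f^{(1)}+\mathcal N_0(f^{(1)},f^{(1)})\big]$$ such that at each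 $t\in[0,t_0]$ it is the one-body reduced distribution of a symmetric $N$-body probability density whose two-body reduced distribution is a.e. $f^{(1)}(\mathbf r_1,\mathbf p_1,t)f^{(1)}(\mathbf r_2,\mathbf p_2,t)g(\mathbf r_1,\mathbf r_2)$ (the $n$-body reduced distribution is $N!/(N-n)!$ times the marginal in the first $n$ particles). Let $f_0,f_1,f_2,f_3$ be regular and independent of $\varepsilon$, and assume the Hilbert expansion: * for each $t\in(0,t_0]$, $\big\|f^{(1)}_\varepsilon-\sum_{n=0}^3\varepsilon^nf_n\big\|_t=O(\varepsilon^4)$ as a bound valid for all $\varepsilon\in(0,\varepsilon_0)$, with no uniformity as $t\to0$ (initial layer); * $\int f^{(1)}_\varepsilon d\mathbf p=\int f_0\,d\mathbf p+\varepsilon\int f_1\,d\mathbf p+O(\varepsilon^2)$, uniformly in $\varepsilon\in(0,\varepsilon_0)$, $\mathbf r\in\mathbb R^3$ and $t\in[0,t_0]$. Assume that $f^{(1)}_\varepsilon(\mathbf r,\mathbf p,0)=f_0(\mathbf r,\mathbf p,0)=M(\mathbf p)\rho_{\rm init}(\mathbf r)$ for all $\varepsilon\in(0,\varepsilon_0)$,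 and that the following equation for $\psi$ is non-negativity preserving. With $\rho_0=\int f_0\,d\mathbf p$ and $\mathbf a=\int\mathbf pf_1\,d\mathbf p$, the equation is $\partial_t\psi=-\nabla_{\mathbf r}\cdot\mathbf a_2$, where $$\begin{aligned}&\mathbf a_2(\mathbf r)+\int g(\mathbf r,\mathbf r')\rho_0(\mathbf r')\mathbf Z_1(\mathbf r,\mathbf r')\,d\mathbf r'\,\mathbf a_2(\mathbf r)+\rho_0(\mathbf r)\int g(\mathbf r,\mathbf r')\mathbf Z_2(\mathbf r,\mathbf r')\mathbf a_2(\mathbf r')\,d\mathbf r'\\ &=-\Big[\nabla\psi+\psi\nabla V_1+\psi\int\rho_0(\mathbf r')g\nabla_{\mathbf r}V_2\,d\mathbf r'+\rho_0\int\psi(\mathbf r')g\nabla_{\mathbf r}V_2\,d\mathbf r'+\int g\psi(\mathbf r')\mathbf Z_1\,d\mathbf r'\,\mathbf a+\psi\int g\mathbf Z_2\mathbf a(\mathbf r')\,d\mathbf r'\Big];\end{aligned}$$ non-negativity preserving means that every classical solution $(\psi,\mathbf a_2)$ on $[0,t_0]$ which, with its first $\mathbf r$-derivatives, is continuous in $(t,\mathbf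 r)$ and $O((1+|\mathbf r|)^{-4})$ uniformly in $t$, and has $\psi(\cdot,0)\ge0$, satisfies $\psi(\cdot,t)\ge0$ for all $t\in[0,t_0]$. **Theorem (Smoluchowski equation).** There are $\rho_0(\mathbf r,t)$, $\mathbf a_0(\mathbf r,t)$, independent of $\varepsilon$, and a constant $C$ such that $f_0=M(\mathbf p)\rho_0(\mathbf r,t)$ on $[0,t_0]$ and the following holds for every $\gamma>0$ with $\varepsilon:=\sqrt{k_BT/m}\,\gamma^{-1}<\varepsilon_0$. In the original time $\tau=\frac{m\gamma}{k_BT}t$ put $\rho(\mathbf r,\tau)=\rho_0(\mathbf r,\tfrac{k_BT}{m\gamma}\tau)$, $\mathbf a(\mathbf r,\tau)=\mathbf a_0(\mathbf r,\tfrac{k_BT}{m\gamma}\tau)$ and write $U_1(\mathbf r,\tau)$ for $U_1$ at rescaled time $\tfrac{k_BT}{m\gamma}\tau$. Then $\rho(\cdot,0)=\rho_{\rm init}$ and, for all $\tau\in[0,\tfrac{m\gamma}{k_BT}t_0]$, $\rho$ and $\mathbf a$ are differentiable and integrable in $\mathbf r$, $$\partial_\tau\rho(\mathbf r,\tau)=-\tfrac{k_BT}{m\gamma}\nabla_{\mathbf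 r}\cdot\mathbf a(\mathbf r,\tau),$$ $\mathbf a(\cdot,\tau)$ is the solution, unique among continuous integrable vector fields, of $$\begin{aligned}&\mathbf a(\mathbf r,\tau)+\int g(\mathbf r,\mathbf r')\rho(\mathbf r',\tau)\mathbf Z_1(\mathbf r,\mathbf r')\,d\mathbf r'\,\mathbf a(\mathbf r,\tau)+\rho(\mathbf r,\tau)\int g(\mathbf r,\mathbf r')\mathbf Z_2(\mathbf r,\mathbf r')\mathbf a(\mathbf r',\tau)\,d\mathbf r'\\&=-\Big[\nabla_{\mathbf r}+\tfrac1{k_BT}\Big(\nabla_{\mathbf r}U_1(\mathbf r,\tau)+\int\rho(\mathbf r',\tau)g(\mathbf r,\mathbf r')\nabla_{\mathbf r}U_2(\mathbf r,\mathbf r')\,d\mathbf r'\Big)\Big]\rho(\mathbf r,\tau),\end{aligned}$$ and the one-body position distribution satisfies, for all $\mathbf r$, $$\Big|\int f^{(1)}_\varepsilon(\mathbf r,\mathbf p,\tfrac{k_BT}{m\gamma}\tau)\,d\mathbf p-\rho(\mathbf r,\tau)\Big|\le C\varepsilon^2.$$ -/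

import Mathlib

open MeasureTheory Set

noncomputable section

namespace Colloid

/-- Physical space (and momentum space) with its Euclidean structure. -/
abbrev R3 : Type := EuclideanSpace ℝ (Fin 3)

/-- One-particle phase space: pairs `(r, p)`. -/
abbrev Phase : Type := R3 × R3

/-- Time-dependent functions of position and momentum, with arguments in the order `t r p`. -/
abbrev PhaseFun : Type := ℝ → R3 → R3 → ℝ

/-- The divergence of a vector field on `ℝ³`. -/
def divg (X : R3 → R3) (x : R3) : ℝ :=
  ∑ i : Fin 3, (fderiv ℝ X x (EuclideanSpace.single i (1 : ℝ))) i

/-- The data of the model: number of particles, temperature (in energy units, `k_B T`), mass,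
external potential `U₁` (as a function of the rescaled time `t` and of position), pair potential
`U₂`, two-body friction tensors `Z₁`, `Z₂` (as linear maps of `ℝ³`) and the pair-distribution
function `g`. -/
structure Model where
  N : ℕ
  kT : ℝ
  m : ℝ
  U₁ : ℝ → R3 → ℝ
  U₂ : R3 → R3 → ℝ
  Z₁ : R3 → R3 → (R3 →L[ℝ] R3)
  Z₂ : R3 → R3 → (R3 →L[ℝ] R3)
  g : R3 → R3 → ℝ

/-! ### Differential operators on phase-space functions -/

/-- Time derivative, one-sided at the end points of `[0, T]`. -/
def dt (T : ℝ) (h : PhaseFun) : PhaseFun := fun t r p =>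
  derivWithin (fun s => h s r p) (Icc 0 T) t

def gradR (h : PhaseFun) (t : ℝ) (r p : R3) : R3 := gradient (fun x => h t x p) r

def gradP (h : PhaseFun) (t : ℝ) (r p : R3) : R3 := gradient (fun q => h t r q) p

def hessP (h : PhaseFun) (t : ℝ) (r p : R3) : R3 →L[ℝ] R3 := fderiv ℝ (fun q => gradP h t r q) p

/-- The vector field `(p + ∇_p) h`. -/
def ouP (h : PhaseFun) (t : ℝ) (r p : R3) : R3 := h t r p • p + gradP h t r p

/-- Zeroth momentum moment `∫ h dp` (the position distribution, if `h` is a distribution). -/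
def density (h : PhaseFun) (t : ℝ) (r : R3) : ℝ := ∫ p : R3, h t r p

/-- First momentum moment `∫ p h dp`. -/
def flux (h : PhaseFun) (t : ℝ) (r : R3) : R3 := ∫ p : R3, h t r p • p

/-- The normalised Maxwellian `(2π)^{-3/2} exp(-|p|²/2)`. -/
def maxwellian (p : R3) : ℝ := ((2 * Real.pi) ^ (3 / 2 : ℝ))⁻¹ * Real.exp (-‖p‖ ^ 2 / 2)

/-- All the quantities `h, ∂ₜh, ∇_r h, ∇_p h, ∇_p² h`, multiplied by a polynomial weight. The
weight makes them integrable in `r`, and integrable in `p` together with two powers of `p`. -/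
def weightedSize (T : ℝ) (h : PhaseFun) (t : ℝ) (r p : R3) : ℝ :=
  (|h t r p| + |dt T h t r p| + ‖gradR h t r p‖ + ‖gradP h t r p‖ + ‖hessP h t r p‖)
    * ((1 + ‖r‖) ^ 4 * (1 + ‖p‖) ^ 6)

/-- Classical regularity on `[0, T]`: continuously differentiable in `t` and `r`, twice
continuously differentiable in `p`, with decay at infinity. -/
structure IsRegular (T : ℝ) (h : PhaseFun) : Prop where
  diff_t : ∀ t ∈ Icc 0 T, ∀ r p, DifferentiableWithinAt ℝ (fun s => h s r p) (Icc 0 T) t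
  diff_r : ∀ t ∈ Icc 0 T, ∀ p, Differentiable ℝ (fun r => h t r p)
  diff_p : ∀ t ∈ Icc 0 T, ∀ r, Differentiable ℝ (fun p => h t r p)
  diff_gradP : ∀ t ∈ Icc 0 T, ∀ r, Differentiable ℝ (fun p => gradP h t r p)
  cont : ContinuousOn (fun z : ℝ × R3 × R3 => h z.1 z.2.1 z.2.2) (Icc 0 T ×ˢ univ)
  cont_t : ContinuousOn (fun z : ℝ × R3 × R3 => dt T h z.1 z.2.1 z.2.2) (Icc 0 T ×ˢ univ)
  cont_r : ContinuousOn (fun z : ℝ × R3 × R3 => gradR h z.1 z.2.1 z.2.2) (Icc 0 T ×ˢ univ)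
  cont_p : ContinuousOn (fun z : ℝ × R3 × R3 => gradP h z.1 z.2.1 z.2.2) (Icc 0 T ×ˢ univ)
  cont_pp : ContinuousOn (fun z : ℝ × R3 × R3 => hessP h z.1 z.2.1 z.2.2) (Icc 0 T ×ˢ univ)
  decay : ∃ B : ℝ, ∀ t ∈ Icc 0 T, ∀ r p, weightedSize T h t r p ≤ B

/-- The `n`-body reduced distribution `N!/(N-n)! ∫ f^(N) dr^{N-n} dp^{N-n}`. -/
def reducedDensity {N : ℕ} (n : ℕ) (FN : (Fin N → Phase) → ℝ) (x : Fin n → Phase) : ℝ :=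
  (N.descFactorial n : ℝ) * ∫ y : Fin (N - n) → Phase,
    FN (fun i => if h : (i : ℕ) < n then x ⟨i, h⟩ else y ⟨i - n, by omega⟩)

namespace Model

variable (S : Model)

/-- Potentials in units of the temperature. -/
def V₁ (t : ℝ) (r : R3) : ℝ := S.U₁ t r / S.kT

def V₂ (r r' : R3) : ℝ := S.U₂ r r' / S.kT

/-- The gradient of the pair potential in its first argument. -/
def gradU₂ (r r' : R3) : R3 := gradient (fun x => S.U₂ x r') r

def gradV₂ (r r' : R3) : R3 := gradient (fun x => S.V₂ x r') r

/-- The blocks `Γ_ij` of the pairwise additive friction tensor. -/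
def friction (x : Fin S.N → R3) (i j : Fin S.N) : R3 →L[ℝ] R3 :=
  if i = j then
    ContinuousLinearMap.id ℝ R3 + ∑ l ∈ Finset.univ.erase i, S.Z₁ (x i) (x l)
  else S.Z₂ (x i) (x j)

/-- Standing assumptions on the data for rescaled times in `[0, T]`. Only the products of `g` with
the two-body quantities have to be bounded, so that singularities of the latter inside a region
excluded by `g` are allowed. -/
structure Admissible (T : ℝ) : Prop where
  two_le_N : 2 ≤ S.N
  kT_pos : 0 < S.kT
  m_pos : 0 < S.m
  symm_Z₁ : ∀ r r', IsSelfAdjoint (S.Z₁ r r')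
  symm_Z₂ : ∀ r r', IsSelfAdjoint (S.Z₂ r r')
  /-- The friction tensor is positive definite, uniformly over configurations of distinct
  particles. -/
  friction_pos : ∃ δ > 0, ∀ x : Fin S.N → R3, Function.Injective x → ∀ w : Fin S.N → R3,
    δ * ∑ i, ‖w i‖ ^ 2 ≤ ∑ i, ∑ j, inner ℝ (w i) (S.friction x i j (w j))
  diff_U₁ : ∀ t ∈ Icc 0 T, Differentiable ℝ (S.U₁ t)
  cont_gradU₁ : ∀ r, ContinuousOn (fun t => gradient (S.U₁ t) r) (Icc 0 T)
  diff_U₂ : ∀ r r', r ≠ r' → DifferentiableAt ℝ (fun x => S.U₂ x r') r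
  meas_g : Measurable fun x : R3 × R3 => S.g x.1 x.2
  meas_Z₁ : Measurable fun x : R3 × R3 => S.Z₁ x.1 x.2
  meas_Z₂ : Measurable fun x : R3 × R3 => S.Z₂ x.1 x.2
  meas_gradU₂ : Measurable fun x : R3 × R3 => S.gradU₂ x.1 x.2
  bounded : ∃ K : ℝ, ∀ r r', |S.g r r'| ≤ K ∧ ‖S.g r r' • S.Z₁ r r'‖ ≤ K ∧
    ‖S.g r r' • S.Z₂ r r'‖ ≤ K ∧ ‖S.g r r' • S.gradU₂ r r'‖ ≤ K

/-- `FN` is an `N`-body probability density of identical particles whose one-body reduced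
distribution is `φ` and whose two-body reduced distribution has the Enskog form
`φ(r₁,p₁) φ(r₂,p₂) g(r₁,r₂)`. -/
structure IsEnskog (φ : R3 → R3 → ℝ) (FN : (Fin S.N → Phase) → ℝ) : Prop where
  nonneg : ∀ x, 0 ≤ FN x
  symm : ∀ (σ : Equiv.Perm (Fin S.N)) x, FN (x ∘ σ) = FN x
  integrable : Integrable FN
  integral_eq_one : ∫ x, FN x = 1
  one_body : ∀ᵐ x : Phase, reducedDensity 1 FN ![x] = φ x.1 x.2
  two_body : ∀ᵐ x : Phase × Phase,
    reducedDensity 2 FN ![x.1, x.2] = φ x.1.1 x.1.2 * φ x.2.1 x.2.2 * S.g x.1.1 x.2.1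

/-! ### The one-body kinetic equation -/

def L₀ (h : PhaseFun) : PhaseFun := fun t r p => divg (fun q => ouP h t r q) p

def L₁ (h : PhaseFun) : PhaseFun := fun t r p =>
  - inner ℝ p (gradR h t r p) + inner ℝ (gradient (S.V₁ t) r) (gradP h t r p)

def N₀ (h k : PhaseFun) : PhaseFun := fun t r p =>
  divg (fun q => ∫ x : Phase, (S.g r x.1 * h t x.1 x.2) • S.Z₁ r x.1 (ouP k t r q)) p
  + divg (fun q => k t r q • ∫ x : Phase, S.g r x.1 • S.Z₂ r x.1 (ouP h t x.1 x.2)) p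

def N₁ (h k : PhaseFun) : PhaseFun := fun t r p =>
  inner ℝ (∫ x : Phase, (h t x.1 x.2 * S.g r x.1) • S.gradV₂ r x.1) (gradP k t r p)

/-- `h` solves the rescaled one-body kinetic equation with parameter `ε` on `[0, T]`. -/
def IsKineticSolution (T ε : ℝ) (h : PhaseFun) : Prop :=
  ∀ t ∈ Icc 0 T, ∀ r p, dt T h t r p =
    (1 / ε) * (S.L₁ h t r p + S.N₁ h h t r p)
      + (1 / ε ^ 2) * (L₀ h t r p + S.N₀ h h t r p)

/-! ### Integral equations for the fluxes -/

/-- The Fredholm operator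
`a ↦ a + (∫ g ρ' Z₁ dr') a + ρ ∫ g Z₂ a' dr'`. -/
def fredholm (ρ : R3 → ℝ) (a : R3 → R3) (r : R3) : R3 :=
  a r + (∫ r' : R3, (S.g r r' * ρ r') • S.Z₁ r r' (a r))
    + ρ r • ∫ r' : R3, S.g r r' • S.Z₂ r r' (a r')

/-- The integral equation for the leading-order flux `a`, in terms of the potentials `U₁` (at a
fixed time, called `u`) and `U₂`. -/
def IsFluxSolution (u : R3 → ℝ) (ρ : R3 → ℝ) (a : R3 → R3) : Prop :=
  ∀ r, S.fredholm ρ a r =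
    -(gradient ρ r + (1 / S.kT) •
      (ρ r • (gradient u r + ∫ r' : R3, (ρ r' * S.g r r') • S.gradU₂ r r')))

/-- The source term of the integral equation for the next-order flux (before the minus sign). -/
def psiSource (t : ℝ) (ρ : R3 → ℝ) (a : R3 → R3) (ψ : R3 → ℝ) (r : R3) : R3 :=
  gradient ψ r + ψ r • gradient (S.V₁ t) r
    + ψ r • (∫ r' : R3, (ρ r' * S.g r r') • S.gradV₂ r r')
    + ρ r • (∫ r' : R3, (ψ r' * S.g r r') • S.gradV₂ r r')
    + (∫ r' : R3, (S.g r r' * ψ r') • S.Z₁ r r' (a r))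
    + ψ r • ∫ r' : R3, S.g r r' • S.Z₂ r r' (a r')

/-- `ψ`, together with its flux `a₂`, is a classical decaying solution on `[0, T]` of
`∂ₜψ = -∇·a₂`, where `a₂` solves the integral equation with source `psiSource`. Here `ρ` and `a`
are the given leading-order density and flux. -/
structure IsPsiSolution (T : ℝ) (ρ : ℝ → R3 → ℝ) (a : ℝ → R3 → R3)
    (ψ : ℝ → R3 → ℝ) (a₂ : ℝ → R3 → R3) : Prop where
  diff_psi : ∀ t ∈ Icc 0 T, Differentiable ℝ (ψ t)
  diff_flux : ∀ t ∈ Icc 0 T, Differentiable ℝ (a₂ t)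
  cont_psi : ContinuousOn (fun z : ℝ × R3 => ψ z.1 z.2) (Icc 0 T ×ˢ univ)
  cont_grad : ContinuousOn (fun z : ℝ × R3 => gradient (ψ z.1) z.2) (Icc 0 T ×ˢ univ)
  cont_flux : ContinuousOn (fun z : ℝ × R3 => a₂ z.1 z.2) (Icc 0 T ×ˢ univ)
  cont_dflux : ContinuousOn (fun z : ℝ × R3 => fderiv ℝ (a₂ z.1) z.2) (Icc 0 T ×ˢ univ)
  decay : ∃ B : ℝ, ∀ t ∈ Icc 0 T, ∀ r,
    (|ψ t r| + ‖gradient (ψ t) r‖ + ‖a₂ t r‖ + ‖fderiv ℝ (a₂ t) r‖) * (1 + ‖r‖) ^ 4 ≤ B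
  evolution : ∀ t ∈ Icc 0 T, ∀ r,
    HasDerivWithinAt (fun s => ψ s r) (-divg (a₂ t) r) (Icc 0 T) t
  flux_eq : ∀ t ∈ Icc 0 T, ∀ r,
    S.fredholm (ρ t) (a₂ t) r = -S.psiSource t (ρ t) (a t) (ψ t) r

/-- The evolution equation for `ψ` preserves non-negativity on `[0, T]`. -/
def PsiPreservesNonneg (T : ℝ) (ρ : ℝ → R3 → ℝ) (a : ℝ → R3 → R3) : Prop :=
  ∀ ψ a₂, S.IsPsiSolution T ρ a ψ a₂ → (∀ r, 0 ≤ ψ 0 r) → ∀ t ∈ Icc 0 T, ∀ r, 0 ≤ ψ t r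

end Model

/-- `F ε = f 0 + ε f 1 + ε² f 2 + ε³ f 3 + O(ε⁴)`, with regular coefficients. The expansion of the
phase-space distribution (with its derivatives, in the weighted sense) is required only for
positive times, with no uniformity as `t → 0`, because of the initial layer, in which the momenta
relax. Of the position distribution `∫ F ε dp` the expansion up to `O(ε²)` is required on all of
`[0, T]`. -/
structure HasHilbertExpansion (T ε₀ : ℝ) (F : ℝ → PhaseFun) (f : ℕ → PhaseFun) : Prop where
  regular : ∀ n ≤ 3, IsRegular T (f n)
  outer : ∀ t ∈ Ioc 0 T, ∃ B : ℝ, ∀ ε ∈ Ioo 0 ε₀, ∀ r p,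
    weightedSize T (fun t r p => F ε t r p - ∑ n ∈ Finset.range 4, ε ^ n * f n t r p) t r p
      ≤ B * ε ^ 4
  marginal : ∃ B : ℝ, ∀ ε ∈ Ioo 0 ε₀, ∀ t ∈ Icc 0 T, ∀ r,
    |density (F ε) t r - (density (f 0) t r + ε * density (f 1) t r)| ≤ B * ε ^ 2

end Colloid

end

/-!
The theorem follows from matching powers of `ε` in the moments of the kinetic equation, and from one
coercivity property.

*Coercivity.* The friction tensor is positive definite on configurations of distinct points.
Averaged over the Enskog density `f⁽¹⁾(1) f⁽¹⁾(2) g`, with the velocities of the particles prescribed as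
functions of their positions, this gives two facts about the averaged coefficients that involve the
density `ρ = ∫ f⁽¹⁾ dp` only (`Model.FrictionPositive`): moving a single particle, the matrix
`1 + ∫ g ρ' Z₁ dr'` is positive for almost every `r`; moving all particles with one velocity field
`w`, the quadratic form of the Fredholm operator at `ρ w` is bounded below by `δ ∫ ρ |w|²`. Both
pass to pointwise limits with a common decay, hence to the leading-order density
(`IsExpandedSolution.leading_density`). They make the Fredholm operator injective on continuous
integrable fields (`Model.FrictionPositive.eq_zero_of_fredholm`): the first fact shows that an
element `c` of the kernel is `O(ρ)`, that is `c = ρ w` with `w` bounded, and the second one then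
gives `∫ ρ |w|² = 0`.

*Matching.* Every term of the equation is multilinear in bounded linear functionals of the
distribution (`IsFunctional`) and therefore inherits the Hilbert expansion at positive times
(`IsFunctional.hasExp`). The balance of momentum at order `1` says that the flux of `f 0` lies in
the kernel of the Fredholm operator, so it vanishes. The kinetic equation at order `1` becomes
`∇ₚ · A (p + ∇ₚ) f₀ = 0` with the positive matrix `A = 1 + ∫ g ρ₀' Z₁ dr'`, and an integrable
solution is a multiple of the Maxwellian (`eq_maxwellian_mul`; the equation is tested with a bounded
function, as the weighted norms allow only polynomial weights). Balance of momentum at order `ε` is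
the integral equation for the flux `a` of `f 1`, conservation of mass at order `ε` the evolution
equation of `ρ₀`. The identities are continuous in time, which extends them to `t = 0`.

*The error is of second order.* The kinetic equation at order `ε` gives
`f₁ = M (ρ₁ + p · a)` (`IsRegular.eq_localEquilibrium`), where by parity the second term does not
contribute to the stress. The next order of the two balance laws is then the linear equation for
`ψ = ρ₁`, with the flux of `f 2` as `a₂`. As `f⁽¹⁾ = f₀` initially for every `ε`, the expansion of
the position distribution forces `ρ₁ = 0` at `t = 0`. So `ρ₁` and `-ρ₁` are both solutions with
non-negative initial values, both stay non-negative, and `ρ₁ = 0` for all times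
(`IsExpandedSolution.density_one`).
-/

noncomputable section

namespace Colloid

open Filter Topology Asymptotics

/-! ### Integration by parts on `ℝ³` -/

/-- The trace of a linear map of `ℝ³`, as a continuous linear functional. -/
def trace3 : (R3 →L[ℝ] R3) →L[ℝ] ℝ :=
  ∑ i : Fin 3, (EuclideanSpace.proj i : R3 →L[ℝ] ℝ) ∘L
    (ContinuousLinearMap.apply ℝ R3 (EuclideanSpace.single i (1 : ℝ)))

lemma trace3_apply (A : R3 →L[ℝ] R3) :
    trace3 A = ∑ i : Fin 3, (A (EuclideanSpace.single i (1 : ℝ))) i := by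
  simp [trace3]

lemma divg_eq_trace3 (X : R3 → R3) (x : R3) : divg X x = trace3 (fderiv ℝ X x) := by
  rw [trace3_apply]; rfl

lemma sum_apply_mul_single (L : R3 →L[ℝ] ℝ) (w : R3) :
    ∑ i : Fin 3, L (EuclideanSpace.single i (1 : ℝ)) * w i = L w := by
  conv_rhs => rw [← (EuclideanSpace.basisFun (Fin 3) ℝ).sum_repr w, map_sum]
  refine Finset.sum_congr rfl fun i _ => ?_
  simp [mul_comm]

lemma trace3_comp_smulRight (A : R3 →L[ℝ] R3) (L : R3 →L[ℝ] ℝ) (w : R3) :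
    trace3 (A ∘L L.smulRight w) = L (A w) := by
  rw [trace3_apply, ← sum_apply_mul_single]
  simp

lemma trace3_smulRight (L : R3 →L[ℝ] ℝ) (w : R3) : trace3 (L.smulRight w) = L w := by
  simpa using trace3_comp_smulRight (ContinuousLinearMap.id ℝ R3) L w

lemma fderiv_eq_inner_gradient (u : R3 → ℝ) (p v : R3) :
    fderiv ℝ u p v = inner ℝ (gradient u p) v := by
  rw [inner_gradient_left]

lemma fderiv_eq_innerSL (u : R3 → ℝ) (p : R3) :
    fderiv ℝ u p = innerSL ℝ (gradient u p) := by
  ext v; rw [fderiv_eq_inner_gradient]; rfl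

lemma divg_smul {u : R3 → ℝ} {X : R3 → R3} {p : R3} (hu : DifferentiableAt ℝ u p)
    (hX : DifferentiableAt ℝ X p) :
    divg (fun q => u q • X q) p = inner ℝ (gradient u p) (X p) + u p * divg X p := by
  rw [divg_eq_trace3, divg_eq_trace3, fderiv_fun_smul hu hX, map_add, trace3_smulRight, map_smul,
    fderiv_eq_inner_gradient, smul_eq_mul, add_comm]

lemma integral_divg_eq_zero {X : R3 → R3} (hX : Differentiable ℝ X) (hi : Integrable X)
    (hd : Integrable (fderiv ℝ X)) : ∫ p, divg X p = 0 := by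
  simp only [divg]
  have hcomp : ∀ i : Fin 3, Integrable fun p =>
      (fderiv ℝ X p (EuclideanSpace.single i (1 : ℝ))) i := fun i =>
    ((EuclideanSpace.proj i : R3 →L[ℝ] ℝ) ∘L (ContinuousLinearMap.apply ℝ R3
      (EuclideanSpace.single i (1 : ℝ)))).integrable_comp hd
  rw [integral_finsetSum _ fun i _ => hcomp i]
  refine Finset.sum_eq_zero fun i _ => ?_
  have hi' : Integrable fun p => X p i := (EuclideanSpace.proj i : R3 →L[ℝ] ℝ).integrable_comp hi
  have hd' : ∀ p, fderiv ℝ (fun p => X p i) p =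
      (EuclideanSpace.proj i : R3 →L[ℝ] ℝ) ∘L fderiv ℝ X p := fun p =>
    ((EuclideanSpace.proj i : R3 →L[ℝ] ℝ).hasFDerivAt.comp p (hX p).hasFDerivAt).fderiv
  have key := integral_mul_fderiv_eq_neg_fderiv_mul_of_integrable (μ := (volume : Measure R3))
    (f := fun _ : R3 => (1 : ℝ)) (g := fun p => X p i) (v := EuclideanSpace.single i (1 : ℝ))
    (by simp) (by simpa [hd'] using hcomp i) (by simpa using hi')
    (by intro x _; fun_prop) (by
      intro x _
      exact ((EuclideanSpace.proj i : R3 →L[ℝ] ℝ).hasFDerivAt.comp x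
        (hX x).hasFDerivAt).differentiableAt)
  simpa [hd'] using key

/-- Integration by parts against the components of `p`. -/
lemma integral_divg_smul_id {X : R3 → R3} (hX : Differentiable ℝ X)
    (hi : Integrable fun p => (1 + ‖p‖) * ‖X p‖)
    (hd : Integrable fun p => (1 + ‖p‖) * ‖fderiv ℝ X p‖)
    (hdm : AEStronglyMeasurable (fderiv ℝ X) volume) :
    ∫ p, divg X p • p = -∫ p, X p := by
  have hiX : Integrable X := hi.mono hX.continuous.aestronglyMeasurable <| ae_of_all _ fun p => by
    rw [Real.norm_eq_abs, abs_of_nonneg (by positivity)]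
    nlinarith [norm_nonneg p, norm_nonneg (X p), mul_nonneg (norm_nonneg p) (norm_nonneg (X p))]
  have hdivm : AEStronglyMeasurable (fun p => divg X p) (volume : Measure R3) := by
    simp only [divg_eq_trace3]
    exact trace3.continuous.comp_aestronglyMeasurable hdm
  have hdiv : Integrable fun p => divg X p • p := by
    refine (hd.const_mul ‖trace3‖).mono (hdivm.smul aestronglyMeasurable_id) <|
      ae_of_all _ fun p => ?_
    rw [norm_smul, divg_eq_trace3, Real.norm_eq_abs (‖trace3‖ * _), abs_of_nonneg (by positivity)]
    have := trace3.le_opNorm (fderiv ℝ X p)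
    calc _ ≤ (‖trace3‖ * ‖fderiv ℝ X p‖) * (1 + ‖p‖) := by gcongr; linarith [norm_nonneg p]
      _ = _ := by ring
  refine ext_inner_left ℝ fun b => ?_
  rw [inner_neg_right, ← integral_inner hdiv, ← integral_inner hiX]
  have hb : ∀ p : R3, HasFDerivAt (fun q : R3 => inner ℝ b q) (innerSL ℝ b) p := fun p =>
    (innerSL ℝ b).hasFDerivAt
  have hbX : ∀ p, HasFDerivAt (fun q : R3 => inner ℝ b q • X q)
      ((inner ℝ b p : ℝ) • fderiv ℝ X p + (innerSL ℝ b).smulRight (X p)) p := fun p =>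
    (hb p).smul (hX p).hasFDerivAt
  have h1 : Integrable fun p : R3 => inner ℝ b p • X p := by
    refine (hi.const_mul ‖b‖).mono ((by fun_prop : Continuous fun p : R3 =>
      (inner ℝ b p : ℝ)).aestronglyMeasurable.smul hX.continuous.aestronglyMeasurable) <|
      ae_of_all _ fun p => ?_
    rw [norm_smul, Real.norm_eq_abs (‖b‖ * _), abs_of_nonneg (by positivity)]
    calc _ ≤ (‖b‖ * ‖p‖) * ‖X p‖ := by gcongr; exact norm_inner_le_norm b p
      _ ≤ _ := by
        rw [mul_assoc]; gcongr; linarith [norm_nonneg p]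
  have h2 : Integrable (fderiv ℝ fun q : R3 => inner ℝ b q • X q) := by
    rw [show (fderiv ℝ fun q : R3 => inner ℝ b q • X q) = fun p => (inner ℝ b p : ℝ) • fderiv ℝ X p
      + (innerSL ℝ b).smulRight (X p) from funext fun p => (hbX p).fderiv]
    refine Integrable.add (f := fun p => (inner ℝ b p : ℝ) • fderiv ℝ X p)
      (g := fun p => (innerSL ℝ b).smulRight (X p)) ?_ ?_
    · refine (hd.const_mul ‖b‖).mono ((by fun_prop : Continuous fun p : R3 =>
        (inner ℝ b p : ℝ)).aestronglyMeasurable.smul hdm) <| ae_of_all _ fun p => ?_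
      rw [norm_smul, Real.norm_eq_abs (‖b‖ * _), abs_of_nonneg (by positivity)]
      calc _ ≤ (‖b‖ * ‖p‖) * ‖fderiv ℝ X p‖ := by gcongr; exact norm_inner_le_norm b p
        _ ≤ _ := by
          rw [mul_assoc]; gcongr; linarith [norm_nonneg p]
    · have hL : Continuous fun x : R3 => (innerSL ℝ b).smulRight x :=
        (ContinuousLinearMap.smulRightL ℝ R3 R3 (innerSL ℝ b)).continuous
      refine (hiX.norm.const_mul ‖b‖).mono
        (hL.comp_aestronglyMeasurable hiX.aestronglyMeasurable) (ae_of_all _ fun p => ?_)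
      simp [ContinuousLinearMap.norm_smulRight_apply]
  have h0 := integral_divg_eq_zero (fun p => (hbX p).differentiableAt) h1 h2
  have h3 : ∀ p, divg (fun q : R3 => inner ℝ b q • X q) p
      = inner ℝ b (divg X p • p) + inner ℝ b (X p) := fun p => by
    rw [divg_eq_trace3, (hbX p).fderiv, map_add, map_smul, trace3_smulRight, ← divg_eq_trace3,
      inner_smul_right, smul_eq_mul, innerSL_apply_apply]
    ring
  simp only [h3] at h0
  rw [integral_add (hdiv.const_inner b) (hiX.const_inner b)] at h0
  linarith

/-! ### The kernel of the momentum relaxation operator -/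

/-- Smooth cutoffs that are `1` on the ball of radius `R` and whose gradient is `O(1 / R)`. -/
lemma exists_cutoff : ∃ C : ℝ, ∀ R : ℝ, 0 < R → ∃ χ : R3 → ℝ, ContDiff ℝ 1 χ ∧
    HasCompactSupport χ ∧ (∀ p, 0 ≤ χ p) ∧ (∀ p, ‖p‖ ≤ R → χ p = 1) ∧
    ∀ p, ‖fderiv ℝ χ p‖ ≤ C / R := by
  let φ : ContDiffBump (0 : R3) := ⟨1, 2, one_pos, one_lt_two⟩
  have hφ : ContDiff ℝ 1 φ := φ.contDiff
  have hφ' : Continuous (fderiv ℝ φ) := hφ.continuous_fderiv one_ne_zero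
  obtain ⟨C, hC⟩ := hφ'.bounded_above_of_compact_support (φ.hasCompactSupport.fderiv ℝ)
  refine ⟨C, fun R hR => ⟨fun p => φ (R⁻¹ • p), ?_, ?_, fun p => φ.nonneg, ?_, ?_⟩⟩
  · exact hφ.comp (contDiff_const_smul _)
  · exact φ.hasCompactSupport.comp_smul (inv_ne_zero hR.ne')
  · intro p hp
    apply φ.one_of_mem_closedBall
    simp only [Metric.mem_closedBall, dist_zero_right, norm_smul, norm_inv, Real.norm_eq_abs,
      abs_of_pos hR]
    change _ ≤ (1 : ℝ)
    rw [inv_mul_le_iff₀ hR]; linarith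
  · intro p
    have h1 : HasFDerivAt (fun p => φ (R⁻¹ • p))
        ((fderiv ℝ φ (R⁻¹ • p)) ∘L (R⁻¹ • ContinuousLinearMap.id ℝ R3)) p :=
      ((hφ.differentiable one_ne_zero _).hasFDerivAt).comp p
        ((hasFDerivAt_id p).const_smul R⁻¹)
    rw [h1.fderiv]
    calc _ ≤ ‖fderiv ℝ φ (R⁻¹ • p)‖ * ‖R⁻¹ • ContinuousLinearMap.id ℝ R3‖ :=
          ContinuousLinearMap.opNorm_comp_le _ _
      _ ≤ C * R⁻¹ := by
        gcongr
        · exact (norm_nonneg _).trans (hC 0)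
        · exact hC _
        · rw [norm_smul, norm_inv, Real.norm_eq_abs, abs_of_pos hR]
          exact mul_le_of_le_one_right (by positivity) ContinuousLinearMap.norm_id_le
      _ = C / R := by rw [div_eq_mul_inv]

/-- An integrable flow `(p + ∇ₚ) k` with `∇ₚ · A (p + ∇ₚ) k = 0` and positive `A` vanishes. With
`h = k exp(|p|²/2)` the equation is tested against `arctan h` times a cutoff, which needs no decay
of `k` relative to the Maxwellian. -/
lemma smul_id_add_gradient_eq_zero {k : R3 → ℝ} (hk : Differentiable ℝ k)
    (hY : ContDiff ℝ 1 fun p => k p • p + gradient k p)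
    {A : R3 →L[ℝ] R3} {δ : ℝ} (hδ : 0 < δ) (hA : ∀ v, δ * ‖v‖ ^ 2 ≤ inner ℝ v (A v))
    (hint : Integrable fun p => k p • p + gradient k p)
    (hdiv : ∀ p, divg (fun q => A (k q • q + gradient k q)) p = 0) (p : R3) :
    k p • p + gradient k p = 0 := by
  set Y : R3 → R3 := fun p => k p • p + gradient k p with hYdef
  set e : R3 → ℝ := fun p => Real.exp (‖p‖ ^ 2 / 2) with he
  have hed : ∀ p, HasFDerivAt e (e p • innerSL ℝ p) p := fun p => by
    have h1 : HasFDerivAt (fun q : R3 => ‖q‖ ^ 2) (2 • innerSL ℝ p) p :=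
      (hasStrictFDerivAt_norm_sq p).hasFDerivAt
    have h2 := (h1.mul_const (1 / 2 : ℝ)).exp
    have h3 : e = fun q => Real.exp (‖q‖ ^ 2 * (1 / 2)) := by
      funext q; simp [he, div_eq_mul_inv]
    rw [h3]
    refine h2.congr_fderiv ?_
    ext v; simp
  set θ : R3 → ℝ := fun p => Real.arctan (k p * e p) with hθ
  have hθd : ∀ p, HasFDerivAt θ ((e p / (1 + (k p * e p) ^ 2)) • innerSL ℝ (Y p)) p := fun p => by
    have h1 := ((hk p).hasFDerivAt.mul (hed p)).arctan
    refine h1.congr_fderiv ?_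
    ext v
    simp only [hYdef, smul_apply, add_apply, Pi.mul_apply,
      innerSL_apply_apply, inner_add_left, inner_gradient_left, real_inner_smul_left, smul_eq_mul]
    ring
  have hYc : Continuous Y := hY.continuous
  have hkc : Continuous k := hk.continuous
  have hec : Continuous e := by fun_prop
  have hden : ∀ p, (1 + (k p * e p) ^ 2) ≠ 0 := fun p => by positivity
  have hθ' : Continuous fun p => (e p / (1 + (k p * e p) ^ 2)) • innerSL ℝ (Y p) := by
    refine Continuous.smul (hec.div (by fun_prop) hden) ?_
    exact (innerSL ℝ).continuous.comp hYc
  have hθc : ContDiff ℝ 1 θ := contDiff_one_iff_hasFDerivAt.2 ⟨_, hθ', hθd⟩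
  have hAY : ContDiff ℝ 1 fun q => A (Y q) := A.contDiff.comp hY
  set q : R3 → ℝ := fun p => e p / (1 + (k p * e p) ^ 2) * inner ℝ (Y p) (A (Y p)) with hq
  have hqc : Continuous q := by
    refine (hec.div (by fun_prop) hden).mul ?_
    exact hYc.inner (A.continuous.comp hYc)
  have hq0 : ∀ p, 0 ≤ q p := fun p =>
    mul_nonneg (by positivity) (le_trans (by positivity) (hA _))
  obtain ⟨C, hC⟩ := exists_cutoff
  by_contra hne
  -- if `Y p ≠ 0`, the dissipation density `q` has a positive integral `η` near `p`
  have hqp : 0 < q p := by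
    refine mul_pos (by positivity) (lt_of_lt_of_le ?_ (hA _))
    have : 0 < ‖Y p‖ := norm_pos_iff.2 hne
    positivity
  have hη : 0 < ∫ x in Metric.closedBall p 1, q x := by
    rw [integral_pos_iff_support_of_nonneg (fun x => hq0 x)
      (hqc.continuousOn.integrableOn_compact (isCompact_closedBall _ _))]
    rw [Measure.restrict_apply hqc.isOpen_support.measurableSet]
    refine lt_of_lt_of_le ?_ (measure_mono (t := Function.support q ∩ Metric.closedBall p 1)
      (s := Function.support q ∩ Metric.ball p 1) ?_)
    · exact (hqc.isOpen_support.inter Metric.isOpen_ball).measure_pos _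
        ⟨p, hqp.ne', Metric.mem_ball_self one_pos⟩
    · exact inter_subset_inter_right _ Metric.ball_subset_closedBall
  set η := ∫ x in Metric.closedBall p 1, q x with hηdef
  have hAYi : Integrable fun x => A (Y x) := A.integrable_comp hint
  -- testing with `arctan h` times the cutoff at radius `R`
  have main : ∀ R : ℝ, ‖p‖ + 1 ≤ R → η ≤ (Real.pi / 2 * C * ∫ x, ‖A (Y x)‖) / R := by
    intro R hR
    have hR0 : 0 < R := by linarith [norm_nonneg p]
    obtain ⟨χ, hχ, hχs, hχ0, hχ1, hχ'⟩ := hC R hR0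
    have hu : ContDiff ℝ 1 fun x => χ x * θ x := hχ.mul hθc
    have hZ : ContDiff ℝ 1 fun x => (χ x * θ x) • A (Y x) := hu.smul hAY
    have hZs : HasCompactSupport fun x => (χ x * θ x) • A (Y x) :=
      hχs.mono fun x hx h => hx (by simp only [h, zero_mul, zero_smul])
    have h0 := integral_divg_eq_zero (hZ.differentiable one_ne_zero)
      (hZ.continuous.integrable_of_hasCompactSupport hZs)
      ((hZ.continuous_fderiv one_ne_zero).integrable_of_hasCompactSupport (hZs.fderiv ℝ))
    have h1 : ∀ x, divg (fun x => (χ x * θ x) • A (Y x)) x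
        = χ x * q x + θ x * fderiv ℝ χ x (A (Y x)) := fun x => by
      rw [divg_smul (hu.differentiable one_ne_zero x) (hAY.differentiable one_ne_zero x), hdiv,
        ← fderiv_eq_inner_gradient,
        fderiv_fun_mul (hχ.differentiable one_ne_zero x) (hθd x).differentiableAt, (hθd x).fderiv]
      simp [hq]
    simp only [h1] at h0
    have hi1 : Integrable fun x => χ x * q x :=
      (hχ.continuous.mul hqc).integrable_of_hasCompactSupport
        (hχs.mono fun x hx h => hx (by change χ x * q x = 0; rw [h, zero_mul]))
    have hi2 : Integrable fun x => θ x * fderiv ℝ χ x (A (Y x)) := by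
      refine Continuous.integrable_of_hasCompactSupport ?_ ?_
      · exact hθc.continuous.mul ((hχ.continuous_fderiv one_ne_zero).clm_apply hAY.continuous)
      · refine (hχs.fderiv ℝ).mono ?_
        intro x hx
        simp only [Function.mem_support, ne_eq, mul_eq_zero, not_or] at hx ⊢
        intro h; exact hx.2 (by rw [h]; rfl)
    rw [integral_add hi1 hi2] at h0
    have h2 : η ≤ ∫ x, χ x * q x := by
      calc η = ∫ x in Metric.closedBall p 1, χ x * q x := by
            refine setIntegral_congr_fun Metric.isClosed_closedBall.measurableSet fun x hx => ?_
            have : χ x = 1 := hχ1 x (by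
              have := norm_le_norm_add_norm_sub' x p
              rw [mem_closedBall_iff_norm] at hx; linarith)
            simp [this]
        _ ≤ _ := setIntegral_le_integral hi1 (ae_of_all _ fun x => mul_nonneg (hχ0 x) (hq0 x))
    have h3 : |∫ x, (θ x * fderiv ℝ χ x (A (Y x)))| ≤ ∫ x, Real.pi / 2 * (C / R) * ‖A (Y x)‖ := by
      rw [← Real.norm_eq_abs]
      refine norm_integral_le_of_norm_le (hAYi.norm.const_mul _) (ae_of_all _ fun x => ?_)
      rw [norm_mul, mul_assoc]
      gcongr
      · rw [Real.norm_eq_abs, abs_le]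
        exact ⟨(Real.neg_pi_div_two_lt_arctan _).le, (Real.arctan_lt_pi_div_two _).le⟩
      · exact (ContinuousLinearMap.le_opNorm _ _).trans (by gcongr; exact hχ' x)
    rw [integral_const_mul] at h3
    have h4 := abs_le.1 h3
    have h5 : Real.pi / 2 * (C / R) * ∫ x, ‖A (Y x)‖ = (Real.pi / 2 * C * ∫ x, ‖A (Y x)‖) / R := by
      ring
    linarith [h4.1]
  have hlim : Tendsto (fun R : ℝ => (Real.pi / 2 * C * ∫ x, ‖A (Y x)‖) / R) atTop (𝓝 0) :=
    tendsto_const_nhds.div_atTop tendsto_id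
  have := ge_of_tendsto hlim ((eventually_ge_atTop (‖p‖ + 1)).mono main)
  linarith

/-! ### The polynomial weight and the Maxwellian -/

/-- The integrable weight `(1 + |q|)⁻⁴`. -/
def decay4 (q : R3) : ℝ := ((1 + ‖q‖) ^ 4)⁻¹

lemma decay4_pos (q : R3) : 0 < decay4 q := by unfold decay4; positivity

lemma decay4_le_one (q : R3) : decay4 q ≤ 1 := by
  unfold decay4
  exact inv_le_one_of_one_le₀ (one_le_pow₀ (by linarith [norm_nonneg q]))

lemma integrable_decay4 : Integrable decay4 := by
  have h := integrable_one_add_norm (E := R3) (μ := volume) (r := 4) (by simp; norm_num)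
  refine h.congr (ae_of_all _ fun q => ?_)
  change (1 + ‖q‖) ^ (-(4 : ℝ)) = ((1 + ‖q‖) ^ 4)⁻¹
  rw [Real.rpow_neg (by positivity)]
  norm_cast

/-- The total mass of the weight `decay4`. -/
def decay4Mass : ℝ := ∫ q : R3, decay4 q

lemma decay4Mass_nonneg : 0 ≤ decay4Mass := integral_nonneg fun q => (decay4_pos q).le

lemma maxwellian_pos (p : R3) : 0 < maxwellian p := by unfold maxwellian; positivity

lemma maxwellian_neg (p : R3) : maxwellian (-p) = maxwellian p := by simp [maxwellian]

lemma hasFDerivAt_maxwellian (p : R3) :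
    HasFDerivAt maxwellian (-(maxwellian p) • innerSL ℝ p) p := by
  have h1 : HasFDerivAt (fun q : R3 => ‖q‖ ^ 2) (2 • innerSL ℝ p) p :=
    (hasStrictFDerivAt_norm_sq p).hasFDerivAt
  have h2 := (h1.mul_const (-(1 / 2) : ℝ)).exp.const_mul (((2 * Real.pi) ^ (3 / 2 : ℝ))⁻¹)
  have h3 : maxwellian = fun q => ((2 * Real.pi) ^ (3 / 2 : ℝ))⁻¹ *
      Real.exp (‖q‖ ^ 2 * (-(1 / 2))) := by
    funext q; unfold maxwellian; congr 2; ring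
  rw [h3]
  refine h2.congr_fderiv ?_
  ext v; simp [mul_assoc]

lemma contDiff_maxwellian : ContDiff ℝ 1 maxwellian := by
  refine contDiff_one_iff_hasFDerivAt.2 ⟨_, ?_, hasFDerivAt_maxwellian⟩
  have : Continuous maxwellian :=
    continuous_iff_continuousAt.2 fun p => (hasFDerivAt_maxwellian p).continuousAt
  fun_prop

lemma continuous_maxwellian : Continuous maxwellian := contDiff_maxwellian.continuous

lemma maxwellian_mul_pow_le (n : ℕ) :
    ∃ C : ℝ, 0 ≤ C ∧ ∀ p : R3, maxwellian p * (1 + ‖p‖) ^ n ≤ C := by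
  refine ⟨((2 * Real.pi) ^ (3 / 2 : ℝ))⁻¹ * (n.factorial * Real.exp (3 / 2)), by positivity,
    fun p => ?_⟩
  have h1 : (1 + ‖p‖) ^ n ≤ n.factorial * Real.exp (1 + ‖p‖) := by
    have := Real.pow_div_factorial_le_exp (1 + ‖p‖) (by positivity) n
    rwa [div_le_iff₀ (by positivity), mul_comm] at this
  unfold maxwellian
  rw [mul_assoc]
  refine mul_le_mul_of_nonneg_left ?_ (by positivity)
  calc Real.exp (-‖p‖ ^ 2 / 2) * (1 + ‖p‖) ^ n
      ≤ Real.exp (-‖p‖ ^ 2 / 2) * (n.factorial * Real.exp (1 + ‖p‖)) := by gcongr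
    _ = n.factorial * Real.exp (-‖p‖ ^ 2 / 2 + (1 + ‖p‖)) := by
      rw [Real.exp_add (-‖p‖ ^ 2 / 2)]; ring
    _ ≤ _ := by gcongr; nlinarith [sq_nonneg (‖p‖ - 1)]

/-- Polynomially growing functions are integrable against the Maxwellian. -/
lemma integrable_maxwellian_smul {E : Type*} [NormedAddCommGroup E] [NormedSpace ℝ E]
    {u : R3 → E} (hu : Continuous u) {C : ℝ} {n : ℕ} (hC : ∀ p, ‖u p‖ ≤ C * (1 + ‖p‖) ^ n) :
    Integrable fun p => maxwellian p • u p := by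
  obtain ⟨D, hD, hM⟩ := maxwellian_mul_pow_le (n + 4)
  have hC0 : 0 ≤ C := by simpa using (norm_nonneg _).trans (hC 0)
  refine (integrable_decay4.const_mul (C * D)).mono'
    (continuous_maxwellian.smul hu).aestronglyMeasurable (ae_of_all _ fun p => ?_)
  rw [norm_smul, Real.norm_eq_abs, abs_of_pos (maxwellian_pos p)]
  have h1 := hM p
  have h2 : maxwellian p * (1 + ‖p‖) ^ n ≤ D * decay4 p := by
    unfold decay4
    rw [← div_eq_mul_inv, le_div_iff₀ (by positivity), mul_assoc, ← pow_add]
    exact h1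
  calc maxwellian p * ‖u p‖ ≤ maxwellian p * (C * (1 + ‖p‖) ^ n) := by
        gcongr; exacts [(maxwellian_pos p).le, hC p]
    _ = C * (maxwellian p * (1 + ‖p‖) ^ n) := by ring
    _ ≤ C * (D * decay4 p) := by gcongr
    _ = _ := by ring

lemma integrable_maxwellian : Integrable maxwellian := by
  simpa using integrable_maxwellian_smul (u := fun _ : R3 => (1 : ℝ)) continuous_const
    (C := 1) (n := 0) (by simp)

lemma integral_maxwellian : ∫ p, maxwellian p = 1 := by
  have h := GaussianFourier.integral_rexp_neg_mul_sq_norm (V := R3) (b := 1 / 2) (by norm_num)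
  have h2 : ∀ p : R3, maxwellian p =
      ((2 * Real.pi) ^ (3 / 2 : ℝ))⁻¹ * Real.exp (-(1 / 2) * ‖p‖ ^ 2) := fun p => by
    unfold maxwellian; congr 2; ring
  simp only [h2]
  rw [integral_const_mul, h]
  have : Real.pi / (1 / 2) = 2 * Real.pi := by ring
  rw [this]
  simp only [finrank_euclideanSpace, Fintype.card_fin, Nat.cast_ofNat]
  exact inv_mul_cancel₀ (by positivity)

lemma integral_eq_zero_of_odd {E : Type*} [NormedAddCommGroup E] [NormedSpace ℝ E]
    {u : R3 → E} (hu : ∀ p, u (-p) = -u p) : ∫ p, u p = 0 := by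
  have h := integral_neg_eq_self u (volume : Measure R3)
  simp only [hu, integral_neg] at h
  have h2 : (2 : ℝ) • ∫ p, u p = 0 := by
    rw [two_smul]; nth_rewrite 1 [← h]; exact neg_add_cancel _
  simpa using h2

lemma integral_maxwellian_inner_smul (v : R3) :
    ∫ p, (maxwellian p * inner ℝ p v) • p = v := by
  have hX : ∀ p, HasFDerivAt (fun q => maxwellian q • v)
      ((-(maxwellian p) • innerSL ℝ p).smulRight v) p := fun p =>
    (hasFDerivAt_maxwellian p).smul_const v
  have hdiv : ∀ p, divg (fun q => maxwellian q • v) p = -(maxwellian p * inner ℝ p v) := fun p => by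
    rw [divg_eq_trace3, (hX p).fderiv, trace3_smulRight]; simp
  have hb : ∀ p : R3, (1 + ‖p‖) * ‖maxwellian p • v‖ = maxwellian p • ((1 + ‖p‖) * ‖v‖) := by
    intro p
    rw [norm_smul, Real.norm_eq_abs, abs_of_pos (maxwellian_pos p), smul_eq_mul]; ring
  have hb' : ∀ p : R3, (1 + ‖p‖) * ‖(-(maxwellian p) • innerSL ℝ p).smulRight v‖
      = maxwellian p • ((1 + ‖p‖) * (‖p‖ * ‖v‖)) := by
    intro p
    rw [ContinuousLinearMap.norm_smulRight_apply, norm_smul, norm_neg, Real.norm_eq_abs,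
      abs_of_pos (maxwellian_pos p), smul_eq_mul, innerSL_apply_norm]; ring
  have h := integral_divg_smul_id (X := fun q => maxwellian q • v)
    (fun p => (hX p).differentiableAt) ?_ ?_ ?_
  · simp only [hdiv, neg_smul, integral_neg, neg_inj] at h
    rw [h, integral_smul_const, integral_maxwellian, one_smul]
  · simp only [hb]
    refine integrable_maxwellian_smul (by fun_prop) (C := ‖v‖) (n := 1) fun p => ?_
    rw [Real.norm_eq_abs, abs_of_nonneg (by positivity)]; linarith
  · simp only [(hX _).fderiv, hb']
    refine integrable_maxwellian_smul (by fun_prop) (C := ‖v‖) (n := 2) fun p => ?_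
    rw [Real.norm_eq_abs, abs_of_nonneg (by positivity)]
    nlinarith [mul_nonneg (norm_nonneg v) (norm_nonneg p), norm_nonneg v]
  · rw [show (fderiv ℝ fun q => maxwellian q • v) = _ from funext fun p => (hX p).fderiv]
    refine Continuous.aestronglyMeasurable ?_
    have hL : Continuous fun p : R3 => -(maxwellian p) • innerSL ℝ p :=
      continuous_maxwellian.neg.smul (innerSL ℝ).continuous
    exact ((ContinuousLinearMap.smulRightL ℝ R3 R3).flip v).continuous.comp hL

/-- Integrable solutions of the stationary equation `∇ₚ · A (p + ∇ₚ) k = 0` are multiples of the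
Maxwellian. -/
lemma eq_maxwellian_mul {k : R3 → ℝ} (hk : Differentiable ℝ k)
    (hY : ContDiff ℝ 1 fun p => k p • p + gradient k p)
    {A : R3 →L[ℝ] R3} {δ : ℝ} (hδ : 0 < δ) (hA : ∀ v, δ * ‖v‖ ^ 2 ≤ inner ℝ v (A v))
    (hint : Integrable fun p => k p • p + gradient k p)
    (hdiv : ∀ p, divg (fun q => A (k q • q + gradient k q)) p = 0) (p : R3) :
    k p = maxwellian p * ∫ q, k q := by
  have h0 := smul_id_add_gradient_eq_zero hk hY hδ hA hint hdiv
  have hd : ∀ p, HasFDerivAt (fun q => (maxwellian q)⁻¹ * k q) (0 : R3 →L[ℝ] ℝ) p := fun p => by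
    have hM := (maxwellian_pos p).ne'
    have h1 := ((hasDerivAt_inv hM).comp_hasFDerivAt p (hasFDerivAt_maxwellian p)).mul
      (hk p).hasFDerivAt
    refine h1.congr_fderiv ?_
    ext v
    have h2 : inner ℝ (k p • p + gradient k p) v = 0 := by rw [h0 p, inner_zero_left]
    rw [inner_add_left, inner_gradient_left, real_inner_smul_left] at h2
    simp only [Function.comp_apply, smul_apply, add_apply, innerSL_apply_apply, smul_eq_mul,
      zero_apply]
    field_simp
    linarith
  have hc : ∀ p, (maxwellian p)⁻¹ * k p = (maxwellian 0)⁻¹ * k 0 := fun p =>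
    is_const_of_fderiv_eq_zero (𝕜 := ℝ) (fun p => (hd p).differentiableAt)
      (fun p => (hd p).fderiv) p 0
  have hkp : ∀ p, k p = maxwellian p * ((maxwellian 0)⁻¹ * k 0) := fun p => by
    rw [← hc p]; have hM := (maxwellian_pos p).ne'; field_simp
  have : ∫ q, k q = (maxwellian 0)⁻¹ * k 0 := by
    rw [integral_congr_ae (ae_of_all _ hkp), integral_mul_const, integral_maxwellian, one_mul]
  rw [this]; exact hkp p

/-! ### The space of regular functions -/

/-- All the quantities controlled by `weightedSize`, with two powers of `p` to spare. -/
lemma size_mul_sq_le {T : ℝ} {h : PhaseFun} {t B : ℝ}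
    (hB : ∀ r p, weightedSize T h t r p ≤ B) (r p : R3) :
    (|h t r p| + |dt T h t r p| + ‖gradR h t r p‖ + ‖gradP h t r p‖ + ‖hessP h t r p‖)
      * (1 + ‖p‖) ^ 2 ≤ B * (decay4 r * decay4 p) := by
  have h1 := hB r p
  unfold weightedSize at h1
  unfold decay4
  rw [← mul_inv, ← div_eq_mul_inv, le_div_iff₀ (by positivity)]
  calc _ = _ := by ring
    _ ≤ B := h1

lemma continuous_slice {T : ℝ} {E : Type*} [TopologicalSpace E] {u : ℝ → R3 → R3 → E}
    (hu : ContinuousOn (fun z : ℝ × R3 × R3 => u z.1 z.2.1 z.2.2) (Icc 0 T ×ˢ univ))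
    {t : ℝ} (ht : t ∈ Icc 0 T) : Continuous fun x : R3 × R3 => u t x.1 x.2 :=
  hu.comp_continuous (f := fun x : R3 × R3 => (t, x)) (by fun_prop) fun _ => ⟨ht, trivial⟩

lemma continuous_slice' {T : ℝ} {E : Type*} [TopologicalSpace E] {u : ℝ → R3 → R3 → E}
    (hu : ContinuousOn (fun z : ℝ × R3 × R3 => u z.1 z.2.1 z.2.2) (Icc 0 T ×ˢ univ))
    {t : ℝ} (ht : t ∈ Icc 0 T) (r : R3) : Continuous fun p : R3 => u t r p :=
  (continuous_slice hu ht).comp (by fun_prop : Continuous fun p : R3 => (r, p))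

namespace IsRegular

variable {T : ℝ} {h k : PhaseFun}

lemma hasDerivWithinAt (hh : IsRegular T h) {t : ℝ} (ht : t ∈ Icc 0 T) (r p : R3) :
    HasDerivWithinAt (fun s => h s r p) (dt T h t r p) (Icc 0 T) t :=
  (hh.diff_t t ht r p).hasDerivWithinAt

lemma dt_add (hh : IsRegular T h) (hk : IsRegular T k) {t : ℝ} (ht : t ∈ Icc 0 T) (r p : R3) :
    dt T (h + k) t r p = dt T h t r p + dt T k t r p :=
  derivWithin_fun_add (hh.diff_t t ht r p) (hk.diff_t t ht r p)

lemma gradR_add (hh : IsRegular T h) (hk : IsRegular T k) {t : ℝ} (ht : t ∈ Icc 0 T) (r p : R3) :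
    gradR (h + k) t r p = gradR h t r p + gradR k t r p := by
  unfold gradR gradient
  rw [← map_add, ← fderiv_fun_add (hh.diff_r t ht p r) (hk.diff_r t ht p r)]; rfl

lemma gradP_add (hh : IsRegular T h) (hk : IsRegular T k) {t : ℝ} (ht : t ∈ Icc 0 T) (r p : R3) :
    gradP (h + k) t r p = gradP h t r p + gradP k t r p := by
  unfold gradP gradient
  rw [← map_add, ← fderiv_fun_add (hh.diff_p t ht r p) (hk.diff_p t ht r p)]; rfl

lemma hessP_add (hh : IsRegular T h) (hk : IsRegular T k) {t : ℝ} (ht : t ∈ Icc 0 T) (r p : R3) :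
    hessP (h + k) t r p = hessP h t r p + hessP k t r p := by
  unfold hessP
  rw [← fderiv_fun_add (hh.diff_gradP t ht r p) (hk.diff_gradP t ht r p)]
  congr 1; funext q; exact gradP_add hh hk ht r q

lemma dt_smul (c : ℝ) (h : PhaseFun) (t : ℝ) (r p : R3) :
    dt T (c • h) t r p = c * dt T h t r p :=
  derivWithin_const_mul_field c

lemma gradR_smul (hh : IsRegular T h) (c : ℝ) {t : ℝ} (ht : t ∈ Icc 0 T) (r p : R3) :
    gradR (c • h) t r p = c • gradR h t r p := by
  unfold gradR gradient
  rw [← map_smul, ← fderiv_fun_const_smul (hh.diff_r t ht p r)]; rfl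

lemma gradP_smul (hh : IsRegular T h) (c : ℝ) {t : ℝ} (ht : t ∈ Icc 0 T) (r p : R3) :
    gradP (c • h) t r p = c • gradP h t r p := by
  unfold gradP gradient
  rw [← map_smul, ← fderiv_fun_const_smul (hh.diff_p t ht r p)]; rfl

lemma hessP_smul (hh : IsRegular T h) (c : ℝ) {t : ℝ} (ht : t ∈ Icc 0 T) (r p : R3) :
    hessP (c • h) t r p = c • hessP h t r p := by
  unfold hessP
  rw [← fderiv_fun_const_smul (hh.diff_gradP t ht r p)]
  congr 1; funext q; exact gradP_smul hh c ht r q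

lemma add (hh : IsRegular T h) (hk : IsRegular T k) : IsRegular T (h + k) where
  diff_t t ht r p := (hh.diff_t t ht r p).add (hk.diff_t t ht r p)
  diff_r t ht p := (hh.diff_r t ht p).add (hk.diff_r t ht p)
  diff_p t ht r := (hh.diff_p t ht r).add (hk.diff_p t ht r)
  diff_gradP t ht r := by
    rw [show (fun p => gradP (h + k) t r p) = fun p => gradP h t r p + gradP k t r p from
      funext fun p => gradP_add hh hk ht r p]
    exact (hh.diff_gradP t ht r).add (hk.diff_gradP t ht r)
  cont := hh.cont.add hk.cont
  cont_t := (hh.cont_t.add hk.cont_t).congr fun z hz => dt_add hh hk hz.1 _ _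
  cont_r := (hh.cont_r.add hk.cont_r).congr fun z hz => gradR_add hh hk hz.1 _ _
  cont_p := (hh.cont_p.add hk.cont_p).congr fun z hz => gradP_add hh hk hz.1 _ _
  cont_pp := (hh.cont_pp.add hk.cont_pp).congr fun z hz => hessP_add hh hk hz.1 _ _
  decay := by
    obtain ⟨B, hB⟩ := hh.decay
    obtain ⟨D, hD⟩ := hk.decay
    refine ⟨B + D, fun t ht r p => le_trans ?_ (add_le_add (hB t ht r p) (hD t ht r p))⟩
    unfold weightedSize
    rw [dt_add hh hk ht, gradR_add hh hk ht, gradP_add hh hk ht, hessP_add hh hk ht, ← add_mul]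
    refine mul_le_mul_of_nonneg_right ?_ (by positivity)
    have h1 := abs_add_le (h t r p) (k t r p)
    have h2 := abs_add_le (dt T h t r p) (dt T k t r p)
    have h3 := norm_add_le (gradR h t r p) (gradR k t r p)
    have h4 := norm_add_le (gradP h t r p) (gradP k t r p)
    have h5 := norm_add_le (hessP h t r p) (hessP k t r p)
    change |h t r p + k t r p| + _ + _ + _ + _ ≤ _
    linarith

lemma smul (hh : IsRegular T h) (c : ℝ) : IsRegular T (c • h) where
  diff_t t ht r p := (hh.diff_t t ht r p).const_smul c
  diff_r t ht p := (hh.diff_r t ht p).const_smul c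
  diff_p t ht r := (hh.diff_p t ht r).const_smul c
  diff_gradP t ht r := by
    rw [show (fun p => gradP (c • h) t r p) = fun p => c • gradP h t r p from
      funext fun p => gradP_smul hh c ht r p]
    exact (hh.diff_gradP t ht r).const_smul c
  cont := hh.cont.const_smul c
  cont_t := (hh.cont_t.const_smul c).congr fun z hz => dt_smul c h _ _ _
  cont_r := (hh.cont_r.const_smul c).congr fun z hz => gradR_smul hh c hz.1 _ _
  cont_p := (hh.cont_p.const_smul c).congr fun z hz => gradP_smul hh c hz.1 _ _
  cont_pp := (hh.cont_pp.const_smul c).congr fun z hz => hessP_smul hh c hz.1 _ _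
  decay := by
    obtain ⟨B, hB⟩ := hh.decay
    refine ⟨|c| * B, fun t ht r p => le_trans (le_of_eq ?_)
      (mul_le_mul_of_nonneg_left (hB t ht r p) (abs_nonneg c))⟩
    unfold weightedSize
    rw [dt_smul, gradR_smul hh c ht, gradP_smul hh c ht, hessP_smul hh c ht,
      norm_smul, norm_smul, norm_smul, abs_mul, Real.norm_eq_abs]
    change (|c * h t r p| + _ + _ + _ + _) * _ = _
    rw [abs_mul]; ring

end IsRegular

/-! ### Bounded linear functionals of regular functions -/

section functionals

variable {E F G : Type*} [NormedAddCommGroup E] [NormedSpace ℝ E] [NormedAddCommGroup F]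
  [NormedSpace ℝ F] [NormedAddCommGroup G] [NormedSpace ℝ G]

/-- `Λ` is linear on regular functions and bounded by the weighted norm at time `t`. -/
structure IsFunctional (T t : ℝ) (Λ : PhaseFun → E) : Prop where
  add : ∀ h k, IsRegular T h → IsRegular T k → Λ (h + k) = Λ h + Λ k
  smul : ∀ (c : ℝ) h, IsRegular T h → Λ (c • h) = c • Λ h
  bound : ∃ C : ℝ, 0 ≤ C ∧ ∀ h, IsRegular T h → ∀ B, (∀ r p, weightedSize T h t r p ≤ B) →
    ‖Λ h‖ ≤ C * B

/-- A pointwise linear operation on regular functions, with values jointly continuous on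
`[0, T] × ℝ⁶` and bounded by the weighted norm with two powers of `p` to spare. -/
structure IsLocalOp (T : ℝ) (u : PhaseFun → ℝ → R3 → R3 → E) : Prop where
  add : ∀ h k, IsRegular T h → IsRegular T k → ∀ t ∈ Icc 0 T, ∀ r p,
    u (h + k) t r p = u h t r p + u k t r p
  smul : ∀ (c : ℝ) h, IsRegular T h → ∀ t ∈ Icc 0 T, ∀ r p, u (c • h) t r p = c • u h t r p
  cont : ∀ h, IsRegular T h →
    ContinuousOn (fun z : ℝ × R3 × R3 => u h z.1 z.2.1 z.2.2) (Icc 0 T ×ˢ univ)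
  bound : ∀ h, IsRegular T h → ∀ t ∈ Icc 0 T, ∀ B, (∀ r p, weightedSize T h t r p ≤ B) →
    ∀ r p, ‖u h t r p‖ * (1 + ‖p‖) ^ 2 ≤ B * (decay4 r * decay4 p)

/-- A linear operation producing from a regular function of `t, r, p` a continuous function of
`t, r` that decays like `(1 + |r|)⁻⁴`. -/
structure IsField (T : ℝ) (v : PhaseFun → ℝ → R3 → E) : Prop where
  add : ∀ h k, IsRegular T h → IsRegular T k → ∀ t ∈ Icc 0 T, ∀ r,
    v (h + k) t r = v h t r + v k t r
  smul : ∀ (c : ℝ) h, IsRegular T h → ∀ t ∈ Icc 0 T, ∀ r, v (c • h) t r = c • v h t r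
  cont : ∀ h, IsRegular T h →
    ContinuousOn (fun z : ℝ × R3 => v h z.1 z.2) (Icc 0 T ×ˢ univ)
  bound : ∃ C : ℝ, 0 ≤ C ∧ ∀ h, IsRegular T h → ∀ t ∈ Icc 0 T, ∀ B,
    (∀ r p, weightedSize T h t r p ≤ B) → ∀ r, ‖v h t r‖ ≤ C * B * decay4 r

variable {T : ℝ}

lemma isLocalOp_val : IsLocalOp T (fun h t r p => h t r p) where
  add _ _ _ _ _ _ _ _ := rfl
  smul _ _ _ _ _ _ _ := rfl
  cont _ hh := hh.cont
  bound h _ t _ B hB r p := by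
    refine le_trans ?_ (size_mul_sq_le hB r p)
    gcongr
    rw [Real.norm_eq_abs]
    linarith [abs_nonneg (dt T h t r p), norm_nonneg (gradR h t r p), norm_nonneg (gradP h t r p),
      norm_nonneg (hessP h t r p)]

lemma isLocalOp_dt : IsLocalOp T (fun h t r p => dt T h t r p) where
  add _ _ hh hk _ ht r p := hh.dt_add hk ht r p
  smul c h _ t _ r p := IsRegular.dt_smul c h t r p
  cont _ hh := hh.cont_t
  bound h _ t _ B hB r p := by
    refine le_trans ?_ (size_mul_sq_le hB r p)
    gcongr
    rw [Real.norm_eq_abs]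
    linarith [abs_nonneg (h t r p), norm_nonneg (gradR h t r p), norm_nonneg (gradP h t r p),
      norm_nonneg (hessP h t r p)]

lemma isLocalOp_gradR : IsLocalOp T gradR where
  add _ _ hh hk _ ht r p := hh.gradR_add hk ht r p
  smul c _ hh _ ht r p := hh.gradR_smul c ht r p
  cont _ hh := hh.cont_r
  bound h _ t _ B hB r p := by
    refine le_trans ?_ (size_mul_sq_le hB r p)
    gcongr
    linarith [abs_nonneg (h t r p), abs_nonneg (dt T h t r p), norm_nonneg (gradP h t r p),
      norm_nonneg (hessP h t r p)]

lemma isLocalOp_gradP : IsLocalOp T gradP where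
  add _ _ hh hk _ ht r p := hh.gradP_add hk ht r p
  smul c _ hh _ ht r p := hh.gradP_smul c ht r p
  cont _ hh := hh.cont_p
  bound h _ t _ B hB r p := by
    refine le_trans ?_ (size_mul_sq_le hB r p)
    gcongr
    linarith [abs_nonneg (h t r p), abs_nonneg (dt T h t r p), norm_nonneg (gradR h t r p),
      norm_nonneg (hessP h t r p)]

lemma isLocalOp_hessP : IsLocalOp T hessP where
  add _ _ hh hk _ ht r p := hh.hessP_add hk ht r p
  smul c _ hh _ ht r p := hh.hessP_smul c ht r p
  cont _ hh := hh.cont_pp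
  bound h _ t _ B hB r p := by
    refine le_trans ?_ (size_mul_sq_le hB r p)
    gcongr
    linarith [abs_nonneg (h t r p), abs_nonneg (dt T h t r p), norm_nonneg (gradR h t r p),
      norm_nonneg (gradP h t r p)]

namespace IsLocalOp

variable {u : PhaseFun → ℝ → R3 → R3 → E} {h : PhaseFun} {t : ℝ}

lemma functional (hu : IsLocalOp T u) (ht : t ∈ Icc 0 T) (r p : R3) :
    IsFunctional T t fun h => u h t r p where
  add h k hh hk := hu.add h k hh hk t ht r p
  smul c h hh := hu.smul c h hh t ht r p
  bound := by
    refine ⟨decay4 r * decay4 p, (mul_pos (decay4_pos r) (decay4_pos p)).le, fun h hh B hB => ?_⟩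
    have h1 := hu.bound h hh t ht B hB r p
    have h2 : 1 ≤ (1 + ‖p‖) ^ 2 := one_le_pow₀ (by linarith [norm_nonneg p])
    nlinarith [norm_nonneg (u h t r p)]

lemma norm_clm_le {M : R3 → E →L[ℝ] F} (hMb : ∀ p, ‖M p‖ ≤ (1 + ‖p‖) ^ 2)
    (hu : IsLocalOp T u) (hh : IsRegular T h) (ht : t ∈ Icc 0 T) {B : ℝ}
    (hB : ∀ r p, weightedSize T h t r p ≤ B) (r p : R3) :
    ‖M p (u h t r p)‖ ≤ B * (decay4 r * decay4 p) := by
  refine le_trans ?_ (hu.bound h hh t ht B hB r p)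
  rw [mul_comm]
  exact (ContinuousLinearMap.le_opNorm _ _).trans (by gcongr; exact hMb p)

lemma integrable_clm {M : R3 → E →L[ℝ] F} (hM : Continuous M) (hMb : ∀ p, ‖M p‖ ≤ (1 + ‖p‖) ^ 2)
    (hu : IsLocalOp T u) (hh : IsRegular T h) (ht : t ∈ Icc 0 T) (r : R3) :
    Integrable fun p => M p (u h t r p) := by
  obtain ⟨B, hB⟩ := hh.decay
  refine (integrable_decay4.const_mul (B * decay4 r)).mono' ?_ (ae_of_all _ fun p => ?_)
  · exact (hM.clm_apply (continuous_slice' (hu.cont h hh) ht r)).aestronglyMeasurable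
  · rw [mul_assoc]
    exact norm_clm_le hMb hu hh ht (hB t ht) r p

/-- Momentum moments of order at most two of a local operation. -/
lemma moment {M : R3 → E →L[ℝ] F} (hM : Continuous M) (hMb : ∀ p, ‖M p‖ ≤ (1 + ‖p‖) ^ 2)
    (hu : IsLocalOp T u) : IsField T fun h t r => ∫ p, M p (u h t r p) where
  add h k hh hk t ht r := by
    rw [← integral_add (hu.integrable_clm hM hMb hh ht r) (hu.integrable_clm hM hMb hk ht r)]
    simp only [hu.add h k hh hk t ht, map_add]
  smul c h hh t ht r := by
    rw [← integral_smul]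
    simp only [hu.smul c h hh t ht, map_smul]
  cont h hh := by
    obtain ⟨B, hB⟩ := hh.decay
    have hB0 : 0 ≤ |B| := abs_nonneg B
    refine continuousOn_of_dominated (bound := fun p => |B| * decay4 p) ?_ ?_ ?_ ?_
    · intro z hz
      exact (hu.integrable_clm hM hMb hh hz.1 z.2).aestronglyMeasurable
    · intro z hz
      refine ae_of_all _ fun p => (norm_clm_le hMb hu hh hz.1 (hB z.1 hz.1) z.2 p).trans ?_
      have h1 := decay4_le_one z.2
      have h2 := (decay4_pos z.2).le
      have h3 := (decay4_pos p).le
      calc B * (decay4 z.2 * decay4 p) ≤ |B| * (1 * decay4 p) := by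
            gcongr; exact le_abs_self B
        _ = _ := by ring
    · exact integrable_decay4.const_mul _
    · refine ae_of_all _ fun p => ?_
      refine continuousOn_const.clm_apply ((hu.cont h hh).comp (f := fun z : ℝ × R3 => (z.1, z.2, p))
        (by fun_prop) fun z hz => ⟨hz.1, trivial⟩)
  bound := by
    refine ⟨decay4Mass, decay4Mass_nonneg, fun h hh t ht B hB r => ?_⟩
    refine (norm_integral_le_of_norm_le ((integrable_decay4.const_mul (B * decay4 r)))
      (ae_of_all _ fun p => ?_)).trans (le_of_eq ?_)
    · exact (norm_clm_le hMb hu hh ht hB r p).trans (le_of_eq (by ring))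
    · rw [integral_const_mul, ← decay4Mass]; ring

end IsLocalOp

namespace IsField

variable {v : PhaseFun → ℝ → R3 → E} {h : PhaseFun} {t : ℝ}

lemma continuous (hv : IsField T v) (hh : IsRegular T h) (ht : t ∈ Icc 0 T) :
    Continuous (v h t) :=
  (hv.cont h hh).comp_continuous (f := fun r : R3 => (t, r)) (by fun_prop) fun _ => ⟨ht, trivial⟩

lemma continuousOn_time (hv : IsField T v) (hh : IsRegular T h) (r : R3) :
    ContinuousOn (fun t => v h t r) (Icc 0 T) :=
  (hv.cont h hh).comp (f := fun t : ℝ => (t, r)) (by fun_prop) fun _ ht => ⟨ht, trivial⟩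

lemma exists_bound (hv : IsField T v) (hh : IsRegular T h) :
    ∃ C, 0 ≤ C ∧ ∀ t ∈ Icc 0 T, ∀ r, ‖v h t r‖ ≤ C * decay4 r := by
  obtain ⟨C, hC, hb⟩ := hv.bound
  obtain ⟨B, hB⟩ := hh.decay
  refine ⟨C * |B|, by positivity, fun t ht r => (hb h hh t ht B (hB t ht) r).trans ?_⟩
  have := (decay4_pos r).le
  gcongr; exact le_abs_self B

lemma integrable (hv : IsField T v) (hh : IsRegular T h) (ht : t ∈ Icc 0 T) :
    Integrable (v h t) := by
  obtain ⟨C, _, hb⟩ := hv.exists_bound hh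
  exact (integrable_decay4.const_mul C).mono' (hv.continuous hh ht).aestronglyMeasurable
    (ae_of_all _ fun r => hb t ht r)

lemma functional (hv : IsField T v) (ht : t ∈ Icc 0 T) (r : R3) :
    IsFunctional T t fun h => v h t r where
  add h k hh hk := hv.add h k hh hk t ht r
  smul c h hh := hv.smul c h hh t ht r
  bound := by
    obtain ⟨C, hC, hb⟩ := hv.bound
    refine ⟨C * decay4 r, mul_nonneg hC (decay4_pos r).le, fun h hh B hB => ?_⟩
    exact (hb h hh t ht B hB r).trans (le_of_eq (by ring))

section kernel

variable {K : R3 → F} {D : ℝ}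

lemma integrable_kernel (hv : IsField T v) (L : E →L[ℝ] F →L[ℝ] G)
    (hK : AEStronglyMeasurable K volume) (hKb : ∀ r, ‖K r‖ ≤ D) (hh : IsRegular T h)
    (ht : t ∈ Icc 0 T) : Integrable fun r => L (v h t r) (K r) := by
  refine ((hv.integrable hh ht).norm.const_mul (‖L‖ * D)).mono' ?_ (ae_of_all _ fun r => ?_)
  · exact L.aestronglyMeasurable_comp₂ (hv.continuous hh ht).aestronglyMeasurable hK
  · calc _ ≤ ‖L‖ * ‖v h t r‖ * ‖K r‖ := L.le_opNorm₂ _ _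
      _ ≤ ‖L‖ * ‖v h t r‖ * D := by gcongr; exact hKb r
      _ = _ := by ring

/-- Integrals of a field against a bounded kernel. -/
lemma functional_kernel (hv : IsField T v) (L : E →L[ℝ] F →L[ℝ] G)
    (hK : AEStronglyMeasurable K volume) (hKb : ∀ r, ‖K r‖ ≤ D) (ht : t ∈ Icc 0 T) :
    IsFunctional T t fun h => ∫ r, L (v h t r) (K r) where
  add h k hh hk := by
    rw [← integral_add (hv.integrable_kernel L hK hKb hh ht)
      (hv.integrable_kernel L hK hKb hk ht)]
    simp only [hv.add h k hh hk t ht, map_add, add_apply]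
  smul c h hh := by
    rw [← integral_smul]
    simp only [hv.smul c h hh t ht, map_smul, smul_apply]
  bound := by
    obtain ⟨C, hC, hb⟩ := hv.bound
    have hD : 0 ≤ D := (norm_nonneg _).trans (hKb 0)
    refine ⟨‖L‖ * D * C * decay4Mass, mul_nonneg (by positivity) decay4Mass_nonneg,
      fun h hh B hB => ?_⟩
    refine (norm_integral_le_of_norm_le (integrable_decay4.const_mul (‖L‖ * D * (C * B)))
      (ae_of_all _ fun r => ?_)).trans (le_of_eq ?_)
    · calc _ ≤ ‖L‖ * ‖v h t r‖ * ‖K r‖ := L.le_opNorm₂ _ _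
        _ ≤ ‖L‖ * (C * B * decay4 r) * D := by
          have h1 := hb h hh t ht B hB r
          have h2 : 0 ≤ C * B * decay4 r := (norm_nonneg _).trans h1
          gcongr; exact hKb r
        _ = _ := by ring
    · rw [integral_const_mul, ← decay4Mass]; ring

lemma continuousOn_kernel (hv : IsField T v) (L : E →L[ℝ] F →L[ℝ] G)
    (hK : AEStronglyMeasurable K volume) (hKb : ∀ r, ‖K r‖ ≤ D) (hh : IsRegular T h) :
    ContinuousOn (fun t => ∫ r, L (v h t r) (K r)) (Icc 0 T) := by
  obtain ⟨C, hC, hb⟩ := hv.exists_bound hh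
  have hD : 0 ≤ D := (norm_nonneg _).trans (hKb 0)
  refine continuousOn_of_dominated (bound := fun r => ‖L‖ * D * C * decay4 r) ?_ ?_ ?_ ?_
  · intro t ht; exact (hv.integrable_kernel L hK hKb hh ht).aestronglyMeasurable
  · intro t ht
    refine ae_of_all _ fun r => ?_
    calc _ ≤ ‖L‖ * ‖v h t r‖ * ‖K r‖ := L.le_opNorm₂ _ _
      _ ≤ ‖L‖ * (C * decay4 r) * D := by
        have := (decay4_pos r).le
        gcongr
        exacts [hb t ht r, hKb r]
      _ = _ := by ring
  · exact integrable_decay4.const_mul _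
  · refine ae_of_all _ fun r => ?_
    exact (L.continuous.comp_continuousOn (hv.continuousOn_time hh r)).clm_apply continuousOn_const

end kernel

end IsField

/-! ### Moments of the momentum distribution -/

lemma norm_pow_le_sq (p : R3) : (1 : ℝ) ≤ (1 + ‖p‖) ^ 2 ∧ ‖p‖ ≤ (1 + ‖p‖) ^ 2 ∧
    ‖p‖ * ‖p‖ ≤ (1 + ‖p‖) ^ 2 := by
  have := norm_nonneg p
  refine ⟨by nlinarith, by nlinarith, by nlinarith⟩

lemma isField_integral {u : PhaseFun → ℝ → R3 → R3 → E} (hu : IsLocalOp T u) :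
    IsField T fun h t r => ∫ p, u h t r p :=
  hu.moment (M := fun _ => ContinuousLinearMap.id ℝ E) continuous_const fun p =>
    ContinuousLinearMap.norm_id_le.trans (norm_pow_le_sq p).1

lemma isField_integral_smul {u : PhaseFun → ℝ → R3 → R3 → ℝ} (hu : IsLocalOp T u) :
    IsField T fun h t r => ∫ p, u h t r p • p :=
  hu.moment (M := fun p => (ContinuousLinearMap.id ℝ ℝ).smulRight p)
    ((ContinuousLinearMap.smulRightL ℝ ℝ R3 (ContinuousLinearMap.id ℝ ℝ)).continuous) fun p => by
      rw [ContinuousLinearMap.norm_smulRight_apply]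
      refine (mul_le_of_le_one_left (norm_nonneg p) ContinuousLinearMap.norm_id_le).trans
        (norm_pow_le_sq p).2.1

lemma isField_integral_inner {u : PhaseFun → ℝ → R3 → R3 → R3} (hu : IsLocalOp T u) :
    IsField T fun h t r => ∫ p, inner ℝ p (u h t r p) :=
  hu.moment (M := fun p => innerSL ℝ p) (innerSL ℝ).continuous fun p => by
    rw [innerSL_apply_norm]; exact (norm_pow_le_sq p).2.1

lemma isField_integral_inner_smul {u : PhaseFun → ℝ → R3 → R3 → R3} (hu : IsLocalOp T u) :
    IsField T fun h t r => ∫ p, inner ℝ p (u h t r p) • p :=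
  hu.moment (M := fun p => (innerSL ℝ p).smulRight p) (by
    have h1 : Continuous fun p : R3 => ContinuousLinearMap.smulRightL ℝ R3 R3 (innerSL ℝ p) :=
      (ContinuousLinearMap.smulRightL ℝ R3 R3).continuous.comp (innerSL ℝ).continuous
    exact h1.clm_apply continuous_id) fun p => by
    rw [ContinuousLinearMap.norm_smulRight_apply, innerSL_apply_norm]; exact (norm_pow_le_sq p).2.2

lemma isField_density : IsField T density := isField_integral isLocalOp_val

lemma isField_flux : IsField T flux := isField_integral_smul isLocalOp_val

end functionals

/-! ### Derivatives of momentum moments -/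

namespace IsRegular

variable {T : ℝ} {h : PhaseFun} {t : ℝ}

lemma continuous_val (hh : IsRegular T h) (ht : t ∈ Icc 0 T) (r : R3) :
    Continuous fun p => h t r p := continuous_slice' hh.cont ht r

lemma exists_norm_bound (hh : IsRegular T h) : ∃ B, 0 ≤ B ∧ ∀ t ∈ Icc 0 T, ∀ r p,
    (|h t r p| + |dt T h t r p| + ‖gradR h t r p‖ + ‖gradP h t r p‖ + ‖hessP h t r p‖)
      * (1 + ‖p‖) ^ 2 ≤ B * (decay4 r * decay4 p) := by
  obtain ⟨B, hB⟩ := hh.decay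
  refine ⟨|B|, abs_nonneg B, fun t ht r p => (size_mul_sq_le (hB t ht) r p).trans ?_⟩
  have := (decay4_pos r).le
  have := (decay4_pos p).le
  gcongr; exact le_abs_self B

lemma exists_bound (hh : IsRegular T h) : ∃ B, 0 ≤ B ∧ ∀ t ∈ Icc 0 T, ∀ r p,
    |h t r p| * (1 + ‖p‖) ^ 2 ≤ B * (decay4 r * decay4 p) ∧
    |dt T h t r p| * (1 + ‖p‖) ^ 2 ≤ B * (decay4 r * decay4 p) ∧
    ‖gradR h t r p‖ * (1 + ‖p‖) ^ 2 ≤ B * (decay4 r * decay4 p) ∧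
    ‖gradP h t r p‖ * (1 + ‖p‖) ^ 2 ≤ B * (decay4 r * decay4 p) ∧
    ‖hessP h t r p‖ * (1 + ‖p‖) ^ 2 ≤ B * (decay4 r * decay4 p) := by
  obtain ⟨B, hB0, hB⟩ := hh.exists_norm_bound
  refine ⟨B, hB0, fun t ht r p => ?_⟩
  have h1 := hB t ht r p
  have e1 := abs_nonneg (h t r p)
  have e2 := abs_nonneg (dt T h t r p)
  have e3 := norm_nonneg (gradR h t r p)
  have e4 := norm_nonneg (gradP h t r p)
  have e5 := norm_nonneg (hessP h t r p)
  refine ⟨?_, ?_, ?_, ?_, ?_⟩ <;> refine le_trans ?_ h1 <;> gcongr <;> linarith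

lemma decay4_mul_le (r p : R3) {B : ℝ} (hB : 0 ≤ B) :
    B * (decay4 r * decay4 p) ≤ B * decay4 p := by
  have h1 := decay4_le_one r
  have h2 := (decay4_pos p).le
  gcongr; nlinarith

variable {F : Type*} [NormedAddCommGroup F] [NormedSpace ℝ F]

lemma hasFDerivAt_moment (hh : IsRegular T h) (ht : t ∈ Icc 0 T) {m : R3 → F}
    (hm : Continuous m) (hmb : ∀ p, ‖m p‖ ≤ (1 + ‖p‖) ^ 2) (r : R3) :
    HasFDerivAt (fun r => ∫ p, h t r p • m p)
      (∫ p, (innerSL ℝ (gradR h t r p)).smulRight (m p)) r := by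
  obtain ⟨B, hB0, hB⟩ := hh.exists_bound
  have hc : ∀ r, Continuous fun p => h t r p • m p := fun r => (hh.continuous_val ht r).smul hm
  have hbd : ∀ r p, ‖h t r p • m p‖ ≤ B * decay4 p := fun r p => by
    refine le_trans ?_ (((hB t ht r p).1).trans (decay4_mul_le r p hB0))
    rw [norm_smul, Real.norm_eq_abs]; gcongr; exact hmb p
  refine hasFDerivAt_integral_of_dominated_of_fderiv_le (s := univ)
    (bound := fun p => B * decay4 p)
    (F' := fun r p => (innerSL ℝ (gradR h t r p)).smulRight (m p)) univ_mem ?_ ?_ ?_ ?_ ?_ ?_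
  · exact Eventually.of_forall fun r => (hc r).aestronglyMeasurable
  · exact (integrable_decay4.const_mul B).mono' (hc r).aestronglyMeasurable
      (ae_of_all _ fun p => hbd r p)
  · have h1 : Continuous fun p => ContinuousLinearMap.smulRightL ℝ R3 F
        (innerSL ℝ (gradR h t r p)) :=
      (ContinuousLinearMap.smulRightL ℝ R3 F).continuous.comp
        ((innerSL ℝ).continuous.comp (continuous_slice' hh.cont_r ht r))
    exact (h1.clm_apply hm).aestronglyMeasurable
  · refine ae_of_all _ fun p r _ => ?_
    rw [ContinuousLinearMap.norm_smulRight_apply, innerSL_apply_norm]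
    refine le_trans ?_ (((hB t ht r p).2.2.1).trans (decay4_mul_le r p hB0))
    gcongr; exact hmb p
  · exact integrable_decay4.const_mul B
  · refine ae_of_all _ fun p r _ => ?_
    have := (hh.diff_r t ht p r).hasFDerivAt
    rw [fderiv_eq_innerSL] at this
    exact this.smul_const (m p)

/-- Momentum moments may be differentiated in time, one-sidedly at the end points. -/
lemma hasDerivWithinAt_moment (hh : IsRegular T h) (ht : t ∈ Icc 0 T) {m : R3 → F}
    (hm : Continuous m) (hmb : ∀ p, ‖m p‖ ≤ (1 + ‖p‖) ^ 2) (r : R3) :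
    HasDerivWithinAt (fun s => ∫ p, h s r p • m p) (∫ p, dt T h t r p • m p) (Icc 0 T) t := by
  obtain ⟨B, hB0, hB⟩ := hh.exists_bound
  have hc : ∀ s ∈ Icc 0 T, Continuous fun p => h s r p • m p :=
    fun s hs => (hh.continuous_val hs r).smul hm
  have hi : ∀ s ∈ Icc 0 T, Integrable fun p => h s r p • m p := fun s hs => by
    refine (integrable_decay4.const_mul B).mono' (hc s hs).aestronglyMeasurable
      (ae_of_all _ fun p => ?_)
    refine le_trans ?_ (((hB s hs r p).1).trans (decay4_mul_le r p hB0))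
    rw [norm_smul, Real.norm_eq_abs]; gcongr; exact hmb p
  rw [hasDerivWithinAt_iff_tendsto_slope]
  have hmem : ∀ᶠ s in 𝓝[Icc 0 T \ {t}] t, s ∈ Icc 0 T \ {t} := self_mem_nhdsWithin
  have key : Tendsto (fun s => ∫ p, slope (fun s => h s r p) t s • m p)
      (𝓝[Icc 0 T \ {t}] t) (𝓝 (∫ p, dt T h t r p • m p)) := by
    refine tendsto_integral_filter_of_dominated_convergence (fun p => B * decay4 p) ?_ ?_ ?_ ?_
    · filter_upwards [hmem] with s hs
      refine Continuous.aestronglyMeasurable ?_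
      simp only [slope_def_module]
      have c1 := hh.continuous_val hs.1 r
      have c2 := hh.continuous_val ht r
      fun_prop
    · filter_upwards [hmem] with s hs
      refine ae_of_all _ fun p => ?_
      rw [norm_smul]
      -- the mean value inequality bounds the difference quotients
      have hmv := (convex_Icc (0 : ℝ) T).norm_image_sub_le_of_norm_hasDerivWithin_le
        (f := fun s => h s r p) (f' := fun s => dt T h s r p)
        (C := B * (decay4 r * decay4 p) / (1 + ‖p‖) ^ 2)
        (fun x hx => hh.hasDerivWithinAt hx r p)
        (fun x hx => by
          rw [le_div_iff₀ (by positivity)]; exact (hB x hx r p).2.1) ht hs.1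
      have hne : 0 < ‖s - t‖ := norm_pos_iff.2 (sub_ne_zero.2 hs.2)
      have h1 : ‖slope (fun s => h s r p) t s‖ ≤ B * (decay4 r * decay4 p) / (1 + ‖p‖) ^ 2 := by
        rw [slope_def_module, norm_smul, norm_inv, inv_mul_le_iff₀ hne, mul_comm]
        exact hmv
      calc _ ≤ B * (decay4 r * decay4 p) / (1 + ‖p‖) ^ 2 * (1 + ‖p‖) ^ 2 := by
            gcongr
            exacts [(norm_nonneg _).trans h1, hmb p]
        _ = B * (decay4 r * decay4 p) := div_mul_cancel₀ _ (by positivity)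
        _ ≤ _ := decay4_mul_le r p hB0
    · exact integrable_decay4.const_mul B
    · refine ae_of_all _ fun p => Tendsto.smul_const ?_ _
      exact hasDerivWithinAt_iff_tendsto_slope.1 (hh.hasDerivWithinAt ht r p)
  refine key.congr' ?_
  filter_upwards [hmem] with s hs
  rw [slope_def_module, ← integral_sub (hi s hs.1) (hi t ht), ← integral_smul]
  congr 1; funext p
  rw [slope_def_module, ← sub_smul, smul_smul]; rfl

lemma integrable_val (hh : IsRegular T h) (ht : t ∈ Icc 0 T) (r : R3) :
    Integrable fun p => h t r p :=
  isLocalOp_val.integrable_clm (M := fun _ => ContinuousLinearMap.id ℝ ℝ) continuous_const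
    (fun p => ContinuousLinearMap.norm_id_le.trans (norm_pow_le_sq p).1) hh ht r

lemma integrable_gradR_clm {M : R3 → R3 →L[ℝ] F} (hM : Continuous M)
    (hMb : ∀ p, ‖M p‖ ≤ (1 + ‖p‖) ^ 2) (hh : IsRegular T h) (ht : t ∈ Icc 0 T) (r : R3) :
    Integrable fun p => M p (gradR h t r p) :=
  isLocalOp_gradR.integrable_clm hM hMb hh ht r

lemma integrable_gradR (hh : IsRegular T h) (ht : t ∈ Icc 0 T) (r : R3) :
    Integrable fun p => gradR h t r p :=
  hh.integrable_gradR_clm (M := fun _ => ContinuousLinearMap.id ℝ R3) continuous_const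
    (fun p => ContinuousLinearMap.norm_id_le.trans (norm_pow_le_sq p).1) ht r

lemma hasFDerivAt_density (hh : IsRegular T h) (ht : t ∈ Icc 0 T) (r : R3) :
    HasFDerivAt (density h t) (innerSL ℝ (∫ p, gradR h t r p)) r := by
  have h1 := hh.hasFDerivAt_moment ht (m := fun _ => (1 : ℝ)) continuous_const
    (fun p => by simpa using (norm_pow_le_sq p).1) r
  simp only [smul_eq_mul, mul_one] at h1
  refine h1.congr_fderiv ?_
  rw [← ContinuousLinearMap.integral_comp_comm _ (hh.integrable_gradR ht r)]
  congr 1; funext p; ext v; simp; rfl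

lemma gradient_density (hh : IsRegular T h) (ht : t ∈ Icc 0 T) (r : R3) :
    gradient (density h t) r = ∫ p, gradR h t r p := by
  refine ext_inner_right ℝ fun v => ?_
  rw [inner_gradient_left, (hh.hasFDerivAt_density ht r).fderiv]; rfl

lemma differentiable_density (hh : IsRegular T h) (ht : t ∈ Icc 0 T) :
    Differentiable ℝ (density h t) := fun r => (hh.hasFDerivAt_density ht r).differentiableAt

lemma hasFDerivAt_flux (hh : IsRegular T h) (ht : t ∈ Icc 0 T) (r : R3) :
    HasFDerivAt (flux h t) (∫ p, (innerSL ℝ (gradR h t r p)).smulRight p) r :=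
  hh.hasFDerivAt_moment ht continuous_id (fun p => (norm_pow_le_sq p).2.1) r

lemma differentiable_flux (hh : IsRegular T h) (ht : t ∈ Icc 0 T) :
    Differentiable ℝ (flux h t) := fun r => (hh.hasFDerivAt_flux ht r).differentiableAt

lemma hasDerivWithinAt_density (hh : IsRegular T h) (ht : t ∈ Icc 0 T) (r : R3) :
    HasDerivWithinAt (fun s => density h s r) (∫ p, dt T h t r p) (Icc 0 T) t := by
  have h1 := hh.hasDerivWithinAt_moment ht (m := fun _ => (1 : ℝ)) continuous_const
    (fun p => by simpa using (norm_pow_le_sq p).1) r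
  simp only [smul_eq_mul, mul_one] at h1
  exact h1

lemma hasDerivWithinAt_flux (hh : IsRegular T h) (ht : t ∈ Icc 0 T) (r : R3) :
    HasDerivWithinAt (fun s => flux h s r) (∫ p, dt T h t r p • p) (Icc 0 T) t :=
  hh.hasDerivWithinAt_moment ht continuous_id (fun p => (norm_pow_le_sq p).2.1) r

end IsRegular

/-- `p ↦ (v ↦ ⟪v, ·⟫ p)`, the operation that turns `∇_r h` into the `r`-derivative of `h p`. -/
def tensorP (p : R3) : R3 →L[ℝ] (R3 →L[ℝ] R3) :=
  ((ContinuousLinearMap.smulRightL ℝ R3 R3).flip p) ∘L (innerSL ℝ : R3 →L[ℝ] (R3 →L[ℝ] ℝ))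

lemma tensorP_apply (p v : R3) : tensorP p v = (innerSL ℝ v).smulRight p := rfl

lemma continuous_tensorP : Continuous tensorP :=
  (ContinuousLinearMap.smulRightL ℝ R3 R3).flip.continuous.clm_comp continuous_const

lemma norm_tensorP_le (p : R3) : ‖tensorP p‖ ≤ (1 + ‖p‖) ^ 2 := by
  refine (ContinuousLinearMap.opNorm_le_bound _ (norm_nonneg p) fun v => ?_).trans
    (norm_pow_le_sq p).2.1
  rw [tensorP_apply, ContinuousLinearMap.norm_smulRight_apply, innerSL_apply_norm, mul_comm]

lemma isField_fderiv_flux {T : ℝ} :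
    IsField T fun h t r => ∫ p, (innerSL ℝ (gradR h t r p)).smulRight p :=
  isLocalOp_gradR.moment continuous_tensorP norm_tensorP_le

lemma IsRegular.divg_flux {T : ℝ} {h : PhaseFun} {t : ℝ} (hh : IsRegular T h)
    (ht : t ∈ Icc 0 T) (r : R3) : divg (flux h t) r = ∫ p, inner ℝ p (gradR h t r p) := by
  rw [divg_eq_trace3, (hh.hasFDerivAt_flux ht r).fderiv]
  refine (ContinuousLinearMap.integral_comp_comm trace3
    (hh.integrable_gradR_clm continuous_tensorP norm_tensorP_le ht r)).symm.trans ?_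
  congr 1; funext p
  rw [tensorP_apply, trace3_smulRight, innerSL_apply_apply, real_inner_comm]

/-! ### The Ornstein–Uhlenbeck field `(p + ∇ₚ) h` -/

/-- The momentum derivative of `(p + ∇ₚ) h`. -/
def derivOuP (h : PhaseFun) (t : ℝ) (r p : R3) : R3 →L[ℝ] R3 :=
  h t r p • ContinuousLinearMap.id ℝ R3 + (innerSL ℝ (gradP h t r p)).smulRight p + hessP h t r p

namespace IsRegular

variable {T : ℝ} {h : PhaseFun} {t : ℝ}

lemma hasFDerivAt_ouP (hh : IsRegular T h) (ht : t ∈ Icc 0 T) (r p : R3) :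
    HasFDerivAt (fun q => ouP h t r q) (derivOuP h t r p) p := by
  have h1 : HasFDerivAt (fun q => h t r q) (innerSL ℝ (gradP h t r p)) p := by
    have := (hh.diff_p t ht r p).hasFDerivAt
    rwa [fderiv_eq_innerSL] at this
  exact (h1.smul (hasFDerivAt_id p)).add (hh.diff_gradP t ht r p).hasFDerivAt

lemma continuous_derivOuP (hh : IsRegular T h) (ht : t ∈ Icc 0 T) (r : R3) :
    Continuous fun p => derivOuP h t r p := by
  unfold derivOuP
  refine (((hh.continuous_val ht r).smul continuous_const).add ?_).add
    (continuous_slice' hh.cont_pp ht r)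
  have h1 : Continuous fun p => ContinuousLinearMap.smulRightL ℝ R3 R3
      (innerSL ℝ (gradP h t r p)) :=
    (ContinuousLinearMap.smulRightL ℝ R3 R3).continuous.comp
      ((innerSL ℝ).continuous.comp (continuous_slice' hh.cont_p ht r))
  exact h1.clm_apply continuous_id

lemma contDiff_ouP (hh : IsRegular T h) (ht : t ∈ Icc 0 T) (r : R3) :
    ContDiff ℝ 1 fun q => ouP h t r q :=
  contDiff_one_iff_hasFDerivAt.2 ⟨_, hh.continuous_derivOuP ht r, hh.hasFDerivAt_ouP ht r⟩

lemma continuous_ouP (hh : IsRegular T h) (ht : t ∈ Icc 0 T) (r : R3) :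
    Continuous fun q => ouP h t r q := (hh.contDiff_ouP ht r).continuous

lemma exists_bound_ouP (hh : IsRegular T h) : ∃ B, 0 ≤ B ∧ ∀ t ∈ Icc 0 T, ∀ r p,
    (1 + ‖p‖) * ‖ouP h t r p‖ ≤ B * (decay4 r * decay4 p) ∧
    (1 + ‖p‖) * ‖derivOuP h t r p‖ ≤ B * (decay4 r * decay4 p) := by
  obtain ⟨B, hB0, hB⟩ := hh.exists_norm_bound
  refine ⟨B, hB0, fun t ht r p => ?_⟩
  have h1 := hB t ht r p
  have e0 := norm_nonneg p
  have e1 := abs_nonneg (h t r p)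
  have e2 := abs_nonneg (dt T h t r p)
  have e3 := norm_nonneg (gradR h t r p)
  have e4 := norm_nonneg (gradP h t r p)
  have e5 := norm_nonneg (hessP h t r p)
  constructor
  · have : ‖ouP h t r p‖ ≤ |h t r p| * ‖p‖ + ‖gradP h t r p‖ := by
      refine (norm_add_le _ _).trans (le_of_eq ?_)
      rw [norm_smul, Real.norm_eq_abs]
    calc _ ≤ (1 + ‖p‖) * (|h t r p| * ‖p‖ + ‖gradP h t r p‖) := by gcongr
      _ ≤ (1 + ‖p‖) * ((|h t r p| + |dt T h t r p| + ‖gradR h t r p‖ + ‖gradP h t r p‖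
          + ‖hessP h t r p‖) * (1 + ‖p‖)) := by gcongr; nlinarith
      _ ≤ _ := by linarith
  · have : ‖derivOuP h t r p‖ ≤ |h t r p| + ‖gradP h t r p‖ * ‖p‖ + ‖hessP h t r p‖ := by
      refine (norm_add_le _ _).trans (add_le_add_left ((norm_add_le _ _).trans ?_) _)
      rw [ContinuousLinearMap.norm_smulRight_apply, innerSL_apply_norm, norm_smul,
        Real.norm_eq_abs]
      exact add_le_add_left (mul_le_of_le_one_right e1 ContinuousLinearMap.norm_id_le) _
    calc _ ≤ (1 + ‖p‖) * (|h t r p| + ‖gradP h t r p‖ * ‖p‖ + ‖hessP h t r p‖) := by gcongr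
      _ ≤ (1 + ‖p‖) * ((|h t r p| + |dt T h t r p| + ‖gradR h t r p‖ + ‖gradP h t r p‖
          + ‖hessP h t r p‖) * (1 + ‖p‖)) := by gcongr; nlinarith
      _ ≤ _ := by linarith

lemma integrable_one_add_mul {E : Type*} [NormedAddCommGroup E] {X : R3 → E}
    (hX : Continuous X) {B : ℝ} (hB : ∀ p, (1 + ‖p‖) * ‖X p‖ ≤ B * decay4 p) :
    Integrable (fun p => (1 + ‖p‖) * ‖X p‖) ∧ Integrable X := by
  constructor
  · refine (integrable_decay4.const_mul B).mono' (by fun_prop) (ae_of_all _ fun p => ?_)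
    rw [Real.norm_eq_abs, abs_of_nonneg (by positivity)]; exact hB p
  · refine (integrable_decay4.const_mul B).mono' (by fun_prop) (ae_of_all _ fun p => ?_)
    refine le_trans ?_ (hB p)
    exact le_mul_of_one_le_left (norm_nonneg _) (by linarith [norm_nonneg p])

lemma integrable_ouP (hh : IsRegular T h) (ht : t ∈ Icc 0 T) (r : R3) :
    Integrable fun p => ouP h t r p := by
  obtain ⟨B, hB0, hB⟩ := hh.exists_bound_ouP
  exact (integrable_one_add_mul (hh.continuous_ouP ht r) fun p =>
    (hB t ht r p).1.trans (decay4_mul_le r p hB0)).2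

lemma integrable_gradP (hh : IsRegular T h) (ht : t ∈ Icc 0 T) (r : R3) :
    Integrable fun p => gradP h t r p :=
  isLocalOp_gradP.integrable_clm (M := fun _ => ContinuousLinearMap.id ℝ R3) continuous_const
    (fun p => ContinuousLinearMap.norm_id_le.trans (norm_pow_le_sq p).1) hh ht r

lemma integrable_flux_integrand (hh : IsRegular T h) (ht : t ∈ Icc 0 T) (r : R3) :
    Integrable fun p => h t r p • p :=
  isLocalOp_val.integrable_clm (M := fun p => (ContinuousLinearMap.id ℝ ℝ).smulRight p)
    ((ContinuousLinearMap.smulRightL ℝ ℝ R3 (ContinuousLinearMap.id ℝ ℝ)).continuous) (fun p => by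
      rw [ContinuousLinearMap.norm_smulRight_apply]
      exact (mul_le_of_le_one_left (norm_nonneg p) ContinuousLinearMap.norm_id_le).trans
        (norm_pow_le_sq p).2.1) hh ht r

/-- Moments of `b · ∇ₚ h`. -/
lemma integral_inner_gradP (hh : IsRegular T h) (ht : t ∈ Icc 0 T) (r b : R3) :
    (∫ p, inner ℝ b (gradP h t r p) = 0) ∧
    (∫ p, inner ℝ b (gradP h t r p) • p = -(density h t r • b)) := by
  obtain ⟨B, hB0, hB⟩ := hh.exists_bound
  have hX : ∀ p, HasFDerivAt (fun q => h t r q • b) ((innerSL ℝ (gradP h t r p)).smulRight b) p := by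
    intro p
    have := (hh.diff_p t ht r p).hasFDerivAt
    rw [fderiv_eq_innerSL] at this
    exact this.smul_const b
  have hf : (fderiv ℝ fun q => h t r q • b) = fun p => (innerSL ℝ (gradP h t r p)).smulRight b :=
    funext fun p => (hX p).fderiv
  have hdiv : ∀ p, divg (fun q => h t r q • b) p = inner ℝ b (gradP h t r p) := fun p => by
    rw [divg_eq_trace3, hf, trace3_smulRight, innerSL_apply_apply, real_inner_comm]
  have hd : Differentiable ℝ fun q => h t r q • b := fun p => (hX p).differentiableAt
  have hfc : Continuous (fderiv ℝ fun q => h t r q • b) := by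
    rw [hf]
    exact ((ContinuousLinearMap.smulRightL ℝ R3 R3).flip b).continuous.comp
      ((innerSL ℝ).continuous.comp (continuous_slice' hh.cont_p ht r))
  have h1 := integrable_one_add_mul hd.continuous (B := B * ‖b‖) fun p => by
    have h2 := (hB t ht r p).1.trans (decay4_mul_le r p hB0)
    rw [norm_smul, Real.norm_eq_abs]
    calc _ ≤ (|h t r p| * (1 + ‖p‖) ^ 2) * ‖b‖ := by
          have : (1 + ‖p‖) ≤ (1 + ‖p‖) ^ 2 := by nlinarith [norm_nonneg p]
          calc _ = (|h t r p| * (1 + ‖p‖)) * ‖b‖ := by ring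
            _ ≤ _ := by gcongr
      _ ≤ (B * decay4 p) * ‖b‖ := by gcongr
      _ = _ := by ring
  have h2 := integrable_one_add_mul hfc (B := B * ‖b‖) fun p => by
    have h2 := (hB t ht r p).2.2.2.1.trans (decay4_mul_le r p hB0)
    rw [hf, ContinuousLinearMap.norm_smulRight_apply, innerSL_apply_norm]
    calc _ ≤ (‖gradP h t r p‖ * (1 + ‖p‖) ^ 2) * ‖b‖ := by
          have : (1 + ‖p‖) ≤ (1 + ‖p‖) ^ 2 := by nlinarith [norm_nonneg p]
          calc _ = (‖gradP h t r p‖ * (1 + ‖p‖)) * ‖b‖ := by ring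
            _ ≤ _ := by gcongr
      _ ≤ (B * decay4 p) * ‖b‖ := by gcongr
      _ = _ := by ring
  constructor
  · simpa only [hdiv] using integral_divg_eq_zero hd h1.2 h2.2
  · have := integral_divg_smul_id hd h1.1 h2.1 hfc.aestronglyMeasurable
    simp only [hdiv] at this
    rw [this, integral_smul_const]; rfl

lemma integral_gradP (hh : IsRegular T h) (ht : t ∈ Icc 0 T) (r : R3) :
    ∫ p, gradP h t r p = 0 := by
  refine ext_inner_left ℝ fun b => ?_
  rw [← integral_inner (hh.integrable_gradP ht r), (hh.integral_inner_gradP ht r b).1,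
    inner_zero_right]

lemma integral_ouP (hh : IsRegular T h) (ht : t ∈ Icc 0 T) (r : R3) :
    ∫ p, ouP h t r p = flux h t r := by
  unfold ouP
  rw [integral_add (hh.integrable_flux_integrand ht r) (hh.integrable_gradP ht r),
    hh.integral_gradP ht r, add_zero]; rfl

/-- Moments of `∇ₚ · A (p + ∇ₚ) h`. -/
lemma integral_trace_derivOuP (hh : IsRegular T h) (ht : t ∈ Icc 0 T) (r : R3)
    (A : R3 →L[ℝ] R3) :
    (∫ p, trace3 (A ∘L derivOuP h t r p) = 0) ∧
    (∫ p, trace3 (A ∘L derivOuP h t r p) • p = -(A (flux h t r))) := by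
  obtain ⟨B, hB0, hB⟩ := hh.exists_bound_ouP
  have hX : ∀ p, HasFDerivAt (fun q => A (ouP h t r q)) (A ∘L derivOuP h t r p) p := fun p =>
    A.hasFDerivAt.comp p (hh.hasFDerivAt_ouP ht r p)
  have hf : (fderiv ℝ fun q => A (ouP h t r q)) = fun p => A ∘L derivOuP h t r p :=
    funext fun p => (hX p).fderiv
  have hd : Differentiable ℝ fun q => A (ouP h t r q) := fun p => (hX p).differentiableAt
  have hfc : Continuous (fderiv ℝ fun q => A (ouP h t r q)) := by
    rw [hf]; exact continuous_const.clm_comp (hh.continuous_derivOuP ht r)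
  have hdiv : ∀ p, divg (fun q => A (ouP h t r q)) p = trace3 (A ∘L derivOuP h t r p) := fun p => by
    rw [divg_eq_trace3, hf]
  have h1 := integrable_one_add_mul hd.continuous (B := ‖A‖ * B) fun p => by
    calc _ ≤ (1 + ‖p‖) * (‖A‖ * ‖ouP h t r p‖) := by gcongr; exact A.le_opNorm _
      _ = ‖A‖ * ((1 + ‖p‖) * ‖ouP h t r p‖) := by ring
      _ ≤ ‖A‖ * (B * decay4 p) := by
        refine mul_le_mul_of_nonneg_left ?_ (norm_nonneg A)
        exact (hB t ht r p).1.trans (decay4_mul_le r p hB0)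
      _ = _ := by ring
  have h2 := integrable_one_add_mul hfc (B := ‖A‖ * B) fun p => by
    rw [hf]
    calc _ ≤ (1 + ‖p‖) * (‖A‖ * ‖derivOuP h t r p‖) := by
          gcongr; exact ContinuousLinearMap.opNorm_comp_le _ _
      _ = ‖A‖ * ((1 + ‖p‖) * ‖derivOuP h t r p‖) := by ring
      _ ≤ ‖A‖ * (B * decay4 p) := by
        refine mul_le_mul_of_nonneg_left ?_ (norm_nonneg A)
        exact (hB t ht r p).2.trans (decay4_mul_le r p hB0)
      _ = _ := by ring
  constructor
  · simpa only [hdiv] using integral_divg_eq_zero hd h1.2 h2.2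
  · have := integral_divg_smul_id hd h1.1 h2.1 hfc.aestronglyMeasurable
    simp only [hdiv] at this
    rw [this, ContinuousLinearMap.integral_comp_comm _ (hh.integrable_ouP ht r),
      hh.integral_ouP ht r]

end IsRegular

set_option synthInstance.maxSize 1000

/-! ### Marginals of the `N`-body density -/

/-- The configuration of `N` particles made of the first `n` and the remaining `N - n` ones. -/
def glue {N : ℕ} (n : ℕ) (z : (Fin n → Phase) × (Fin (N - n) → Phase)) (i : Fin N) : Phase :=
  if h : (i : ℕ) < n then z.1 ⟨i, h⟩ else z.2 ⟨i - n, by omega⟩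

lemma exists_glue_equiv {N n : ℕ} (hn : n ≤ N) :
    ∃ e : ((Fin n → Phase) × (Fin (N - n) → Phase)) ≃ᵐ (Fin N → Phase),
      MeasurePreserving e ((volume : Measure (Fin n → Phase)).prod volume) volume ∧
      ∀ z, e z = glue n z := by
  let f : Fin n ⊕ Fin (N - n) ≃ Fin N := finSumFinEquiv.trans (finCongr (by omega))
  let e1 := (MeasurableEquiv.sumPiEquivProdPi (fun _ : Fin n ⊕ Fin (N - n) => Phase)).symm
  let e2 := MeasurableEquiv.piCongrLeft (fun _ : Fin N => Phase) f
  refine ⟨e1.trans e2, (volume_measurePreserving_sumPiEquivProdPi_symm _).trans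
    (volume_measurePreserving_piCongrLeft _ f), fun z => ?_⟩
  funext i
  obtain ⟨j, rfl⟩ := f.surjective i
  have h1 : (e1.trans e2) z (f j) = e1 z j :=
    MeasurableEquiv.piCongrLeft_apply_apply f (β := fun _ : Fin N => Phase) (e1 z) j
  rw [h1]
  rcases j with j | j
  · have h2 : ((f (Sum.inl j) : Fin N) : ℕ) = j := by simp [f]
    have h3 : ((f (Sum.inl j) : Fin N) : ℕ) < n := by omega
    simp only [glue, h3, dite_true]
    change z.1 j = _
    exact congrArg z.1 (Fin.ext h2.symm)
  · have h2 : ((f (Sum.inr j) : Fin N) : ℕ) = n + j := by simp [f]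
    have h3 : ¬ ((f (Sum.inr j) : Fin N) : ℕ) < n := by omega
    simp only [glue, h3, dite_false]
    change z.2 j = _
    exact congrArg z.2 (Fin.ext (by change (j : ℕ) = _ - n; omega))

/-- Observables of the first `n` particles are averaged with the `n`-body reduced density. -/
lemma integral_observable {N n : ℕ} (hn : n ≤ N) {FN : (Fin N → Phase) → ℝ}
    (h0 : ∀ x, 0 ≤ FN x) (hi : Integrable FN) {G : (Fin n → Phase) → ℝ} (hG : Measurable G)
    (hGi : Integrable fun x => G x * reducedDensity n FN x) :
    Integrable (fun x : Fin N → Phase => G (fun i => x (Fin.castLE hn i)) * FN x) ∧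
    (N.descFactorial n : ℝ) * ∫ x : Fin N → Phase, G (fun i => x (Fin.castLE hn i)) * FN x
      = ∫ x, G x * reducedDensity n FN x := by
  obtain ⟨e, he, hez⟩ := exists_glue_equiv hn
  have hfac : (N.descFactorial n : ℝ) ≠ 0 := by
    exact_mod_cast (Nat.descFactorial_pos.2 hn).ne'
  have hFi : Integrable (fun z => FN (e z))
      ((volume : Measure (Fin n → Phase)).prod volume) := he.integrable_comp_of_integrable hi
  have hfst : ∀ z, (fun i => e z (Fin.castLE hn i)) = z.1 := fun z => by
    funext i; rw [hez]; simp [glue]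
  have hred : ∀ x, reducedDensity n FN x = (N.descFactorial n : ℝ) * ∫ y, FN (e (x, y)) := by
    intro x; unfold reducedDensity; congr 2; funext y; rw [hez]; rfl
  have hGP : Integrable fun x => G x * ∫ y, FN (e (x, y)) := by
    refine (hGi.const_mul (N.descFactorial n : ℝ)⁻¹).congr (ae_of_all _ fun x => ?_)
    simp only [hred]; field_simp
  have hprod : Integrable (fun z : (Fin n → Phase) × (Fin (N - n) → Phase) => G z.1 * FN (e z))
      ((volume : Measure (Fin n → Phase)).prod volume) := by
    have hm : AEStronglyMeasurable
        (fun z : (Fin n → Phase) × (Fin (N - n) → Phase) => G z.1 * FN (e z))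
        ((volume : Measure (Fin n → Phase)).prod volume) :=
      (hG.comp measurable_fst).aestronglyMeasurable.mul hFi.aestronglyMeasurable
    refine (integrable_prod_iff hm).2 ⟨?_, ?_⟩
    · filter_upwards [hFi.prod_right_ae] with x hx
      exact hx.const_mul _
    · refine hGP.norm.congr (ae_of_all _ fun x => ?_)
      simp only [norm_mul, Real.norm_eq_abs]
      rw [integral_const_mul, abs_of_nonneg (integral_nonneg fun y => h0 (e (x, y)))]
      congr 2; funext y; rw [abs_of_nonneg (h0 _)]
  have hcomp : (fun z => G z.1 * FN (e z)) =
      (fun x : Fin N → Phase => G (fun i => x (Fin.castLE hn i)) * FN x) ∘ e := by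
    funext z; simp only [Function.comp_apply, hfst]
  constructor
  · rw [hcomp] at hprod
    exact (he.integrable_comp_emb e.measurableEmbedding).1 hprod
  · rw [← he.integral_comp e.measurableEmbedding]
    have : ∀ z, G (fun i => e z (Fin.castLE hn i)) * FN (e z) = G z.1 * FN (e z) := fun z => by
      rw [hfst]
    simp only [this]
    rw [integral_prod _ hprod, ← integral_const_mul]
    congr 1; funext x
    simp only [hred]
    rw [integral_const_mul]; ring

/-- Expectations in a symmetric density are invariant under relabelling of the particles. -/
lemma integral_relabel {N : ℕ} {FN : (Fin N → Phase) → ℝ} (σ : Equiv.Perm (Fin N))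
    (hs : ∀ x, FN (x ∘ σ) = FN x) (H : (Fin N → Phase) → ℝ) :
    (Integrable (fun x => H x * FN x) → Integrable (fun x => H (x ∘ σ) * FN x)) ∧
    ∫ x, H (x ∘ σ) * FN x = ∫ x, H x * FN x := by
  have hmp : MeasurePreserving (MeasurableEquiv.piCongrLeft (fun _ : Fin N => Phase) σ.symm)
    volume volume := volume_measurePreserving_piCongrLeft _ σ.symm
  have hap : ∀ x : Fin N → Phase,
      MeasurableEquiv.piCongrLeft (fun _ : Fin N => Phase) σ.symm x = x ∘ σ := fun x => by
    funext i
    obtain ⟨j, rfl⟩ := σ.symm.surjective i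
    have := MeasurableEquiv.piCongrLeft_apply_apply σ.symm (β := fun _ : Fin N => Phase) x j
    rw [this]; simp
  have hc : (fun x => H (x ∘ σ) * FN x) = (fun x => H x * FN x) ∘
      (MeasurableEquiv.piCongrLeft (fun _ : Fin N => Phase) σ.symm) := by
    funext x; simp only [Function.comp_apply, hap, hs]
  rw [hc]
  exact ⟨fun hi => hmp.integrable_comp_of_integrable hi,
    hmp.integral_comp (MeasurableEquiv.measurableEmbedding _) fun x => H x * FN x⟩

/-! ### Integrals over one-particle phase space -/

lemma integral_phase {E : Type*} [NormedAddCommGroup E] [NormedSpace ℝ E]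
    [CompleteSpace E] {φ : R3 → R3 → ℝ} (hφ : Integrable fun x : Phase => φ x.1 x.2) {K : R3 → E}
    (hK : AEStronglyMeasurable K volume) {D : ℝ} (hD : ∀ r, ‖K r‖ ≤ D) :
    Integrable (fun x : Phase => φ x.1 x.2 • K x.1) ∧
    ∫ x : Phase, φ x.1 x.2 • K x.1 = ∫ r, (∫ p, φ r p) • K r := by
  have hi : Integrable (fun x : Phase => φ x.1 x.2 • K x.1) := by
    refine (hφ.norm.mul_const D).mono' ?_ (ae_of_all _ fun x => ?_)
    · refine hφ.aestronglyMeasurable.smul ?_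
      rw [Measure.volume_eq_prod]; exact hK.comp_fst
    · rw [norm_smul]; gcongr; exact hD _
  refine ⟨hi, ?_⟩
  rw [Measure.volume_eq_prod, integral_prod _ (by rwa [← Measure.volume_eq_prod])]
  congr 1; funext r
  exact integral_smul_const (fun p => φ r p) (K r)

/-- Continuity and decay of a one-body density, as for regular functions at a fixed time. -/
structure IsDecaying (φ : R3 → R3 → ℝ) : Prop where
  continuous : Continuous fun x : R3 × R3 => φ x.1 x.2
  bound : ∃ B, ∀ r p, ‖φ r p‖ ≤ B * (decay4 r * decay4 p)

lemma IsDecaying.integrable {φ : R3 → R3 → ℝ} (h : IsDecaying φ) :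
    Integrable fun x : Phase => φ x.1 x.2 := by
  obtain ⟨B, hB⟩ := h.bound
  exact ((integrable_decay4.mul_prod integrable_decay4).const_mul B).mono'
    h.continuous.aestronglyMeasurable (ae_of_all _ fun x => hB x.1 x.2)

lemma IsDecaying.integrable_density {φ : R3 → R3 → ℝ} (h : IsDecaying φ) :
    Integrable fun r => ∫ p, φ r p := h.integrable.integral_prod_left

/-- Integrals of a bounded kernel against the product of two one-body densities. -/
lemma integral_phase_prod {φ : R3 → R3 → ℝ} (hφ : IsDecaying φ) {G : R3 × R3 → ℝ}
    (hG : Measurable G) {D : ℝ} (hD : ∀ z, ‖G z‖ ≤ D) :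
    Integrable (fun x : Phase × Phase => G (x.1.1, x.2.1) * (φ x.1.1 x.1.2 * φ x.2.1 x.2.2)) ∧
    Integrable (fun z : R3 × R3 => G z * ((∫ p, φ z.1 p) * ∫ p, φ z.2 p)) ∧
    ∫ x : Phase × Phase, G (x.1.1, x.2.1) * (φ x.1.1 x.1.2 * φ x.2.1 x.2.2) =
      ∫ z : R3 × R3, G z * ((∫ p, φ z.1 p) * ∫ p, φ z.2 p) := by
  have hi1 : Integrable
      (fun x : Phase × Phase => G (x.1.1, x.2.1) * (φ x.1.1 x.1.2 * φ x.2.1 x.2.2)) := by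
    refine (hφ.integrable.mul_prod hφ.integrable).bdd_mul ?_
      (ae_of_all _ fun x => hD _)
    exact (hG.comp (by fun_prop)).aestronglyMeasurable
  have hi2 : Integrable (fun z : R3 × R3 => G z * ((∫ p, φ z.1 p) * ∫ p, φ z.2 p)) :=
    (hφ.integrable_density.mul_prod hφ.integrable_density).bdd_mul
      hG.aestronglyMeasurable (ae_of_all _ fun x => hD _)
  refine ⟨hi1, hi2, ?_⟩
  rw [Measure.volume_eq_prod, integral_prod _ (by rwa [← Measure.volume_eq_prod])]
  have hin : ∀ x : Phase, ∫ y : Phase, G (x.1, y.1) * (φ x.1 x.2 * φ y.1 y.2)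
      = φ x.1 x.2 • ∫ r, (∫ p, φ r p) • G (x.1, r) := fun x => by
    rw [← (integral_phase hφ.integrable (K := fun r => G (x.1, r))
      (hG.comp (by fun_prop)).aestronglyMeasurable (fun r => hD _)).2, ← integral_smul]
    congr 1; funext y; simp only [smul_eq_mul]; ring
  simp only [hin]
  have hGm : Measurable fun z : R3 × R3 => (∫ p, φ z.2 p) • G z := by
    refine Measurable.mul ?_ hG
    exact (hφ.continuous.stronglyMeasurable.integral_prod_right).measurable.comp measurable_snd
  have hKm : AEStronglyMeasurable (fun r : R3 => ∫ r', (∫ p, φ r' p) • G (r, r')) volume :=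
    (hGm.stronglyMeasurable.integral_prod_right (ν := volume)).aestronglyMeasurable
  rw [(integral_phase hφ.integrable hKm (D := D * ∫ r, ‖∫ p, φ r p‖) fun r => ?_).2]
  · rw [Measure.volume_eq_prod, integral_prod _ (by rwa [← Measure.volume_eq_prod])]
    congr 1; funext r
    rw [← integral_smul]
    congr 1; funext r'
    simp only [smul_eq_mul]; ring
  · rw [← integral_const_mul]
    refine norm_integral_le_of_norm_le (hφ.integrable_density.norm.const_mul D)
      (ae_of_all _ fun r' => ?_)
    rw [norm_smul, mul_comm]; gcongr; exact hD _

/-! ### Averages over an Enskog density -/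

namespace Model.IsEnskog

variable {S : Model} {φ : R3 → R3 → ℝ} {FN : (Fin S.N → Phase) → ℝ}

/-- Averages of functions of the position of one particle. -/
lemma single (hE : S.IsEnskog φ FN) (hφ : IsDecaying φ) (hN : 2 ≤ S.N) {G : R3 → ℝ}
    (hG : Measurable G) {D : ℝ} (hD : ∀ r, ‖G r‖ ≤ D) (i : Fin S.N) :
    Integrable (fun x : Fin S.N → Phase => G (x i).1 * FN x) ∧
    (S.N : ℝ) * ∫ x : Fin S.N → Phase, G (x i).1 * FN x = ∫ r, (∫ p, φ r p) * G r := by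
  have h1N : 1 ≤ S.N := by omega
  have hmp := volume_preserving_funUnique (Fin 1) Phase
  have hone : ∀ᵐ x : Fin 1 → Phase, reducedDensity 1 FN x = φ (x 0).1 (x 0).2 := by
    filter_upwards [hmp.quasiMeasurePreserving.ae hE.one_body] with x hx
    have : ![(MeasurableEquiv.funUnique (Fin 1) Phase) x] = x := by
      funext k; rw [Fin.eq_zero k]; rfl
    rw [this] at hx; exact hx
  have hph := integral_phase hφ.integrable hG.aestronglyMeasurable hD
  have hcomp : (fun x : Fin 1 → Phase => φ (x 0).1 (x 0).2 • G (x 0).1) =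
      (fun x : Phase => φ x.1 x.2 • G x.1) ∘ (MeasurableEquiv.funUnique (Fin 1) Phase) := rfl
  have hae : (fun x : Fin 1 → Phase => φ (x 0).1 (x 0).2 • G (x 0).1) =ᵐ[volume]
      fun x => G (x 0).1 * reducedDensity 1 FN x := by
    filter_upwards [hone] with x hx
    rw [hx, smul_eq_mul, mul_comm]
  have hint : Integrable fun x : Fin 1 → Phase => G (x 0).1 * reducedDensity 1 FN x := by
    refine Integrable.congr ?_ hae
    rw [hcomp]; exact hmp.integrable_comp_of_integrable hph.1
  have hval : ∫ x : Fin 1 → Phase, G (x 0).1 * reducedDensity 1 FN x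
      = ∫ r, (∫ p, φ r p) * G r := by
    rw [← integral_congr_ae hae, hcomp]
    refine (hmp.integral_comp (MeasurableEquiv.measurableEmbedding _)
      fun x : Phase => φ x.1 x.2 • G x.1).trans hph.2
  have hobs := integral_observable h1N hE.nonneg hE.integrable
    (G := fun x : Fin 1 → Phase => G (x 0).1) (hG.comp (by fun_prop)) hint
  have hrel := integral_relabel (Equiv.swap (Fin.castLE h1N 0) i) (hE.symm _)
    (fun x => G (x (Fin.castLE h1N 0)).1)
  simp only [Function.comp_apply, Equiv.swap_apply_left] at hrel
  refine ⟨hrel.1 hobs.1, ?_⟩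
  rw [hrel.2, ← hval, ← hobs.2]
  simp

lemma exists_perm_pair {α : Type*} [DecidableEq α] {a b i j : α} (hab : a ≠ b) (hij : i ≠ j) :
    ∃ σ : Equiv.Perm α, σ a = i ∧ σ b = j := by
  refine ⟨Equiv.swap (Equiv.swap a i b) j * Equiv.swap a i, ?_, ?_⟩
  · rw [Equiv.Perm.mul_apply, Equiv.swap_apply_left, Equiv.swap_apply_of_ne_of_ne ?_ hij]
    intro h
    have : Equiv.swap a i a = Equiv.swap a i b := by rw [Equiv.swap_apply_left]; exact h
    exact hab ((Equiv.swap a i).injective this)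
  · rw [Equiv.Perm.mul_apply, Equiv.swap_apply_left]

/-- Averages of functions of the positions of two particles. The bound is needed only in the product
with `g`, so that `G` may be singular where `g` vanishes. -/
lemma pair (hE : S.IsEnskog φ FN) (hφ : IsDecaying φ) (hN : 2 ≤ S.N)
    (hg : Measurable fun x : R3 × R3 => S.g x.1 x.2) {G : R3 × R3 → ℝ}
    (hG : Measurable G) {D : ℝ} (hD : ∀ z, ‖G z * S.g z.1 z.2‖ ≤ D) {i j : Fin S.N} (hij : i ≠ j) :
    Integrable (fun x : Fin S.N → Phase => G ((x i).1, (x j).1) * FN x) ∧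
    ((S.N : ℝ) * (S.N - 1)) * ∫ x : Fin S.N → Phase, G ((x i).1, (x j).1) * FN x
      = ∫ z : R3 × R3, (G z * S.g z.1 z.2) * ((∫ p, φ z.1 p) * ∫ p, φ z.2 p) := by
  have hmp := volume_preserving_finTwoArrow Phase
  have htwo : ∀ᵐ x : Fin 2 → Phase, reducedDensity 2 FN x =
      φ (x 0).1 (x 0).2 * φ (x 1).1 (x 1).2 * S.g (x 0).1 (x 1).1 := by
    filter_upwards [hmp.quasiMeasurePreserving.ae hE.two_body] with x hx
    have : ![(MeasurableEquiv.finTwoArrow x).1, (MeasurableEquiv.finTwoArrow x).2] = x := by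
      funext k; fin_cases k <;> rfl
    rw [this] at hx; exact hx
  have hph := integral_phase_prod hφ (G := fun z => G z * S.g z.1 z.2) (hG.mul hg) hD
  set Ψ : Phase × Phase → ℝ := fun x =>
    (G (x.1.1, x.2.1) * S.g x.1.1 x.2.1) * (φ x.1.1 x.1.2 * φ x.2.1 x.2.2) with hΨ
  have hcomp : (fun x : Fin 2 → Phase => Ψ (x 0, x 1)) = Ψ ∘ MeasurableEquiv.finTwoArrow := rfl
  have hae : (fun x : Fin 2 → Phase => Ψ (x 0, x 1)) =ᵐ[volume]
      fun x => G ((x 0).1, (x 1).1) * reducedDensity 2 FN x := by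
    filter_upwards [htwo] with x hx
    rw [hx, hΨ]; ring
  have hint : Integrable fun x : Fin 2 → Phase => G ((x 0).1, (x 1).1) * reducedDensity 2 FN x := by
    refine Integrable.congr ?_ hae
    rw [hcomp]; exact hmp.integrable_comp_of_integrable hph.1
  have hval : ∫ x : Fin 2 → Phase, G ((x 0).1, (x 1).1) * reducedDensity 2 FN x
      = ∫ z : R3 × R3, (G z * S.g z.1 z.2) * ((∫ p, φ z.1 p) * ∫ p, φ z.2 p) := by
    rw [← integral_congr_ae hae, hcomp]
    exact (hmp.integral_comp (MeasurableEquiv.measurableEmbedding _) Ψ).trans hph.2.2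
  have hobs := integral_observable hN hE.nonneg hE.integrable
    (G := fun x : Fin 2 → Phase => G ((x 0).1, (x 1).1)) (hG.comp (by fun_prop)) hint
  have hne : Fin.castLE hN 0 ≠ Fin.castLE hN 1 := by
    intro h; exact absurd (Fin.castLE_injective hN h) (by decide)
  obtain ⟨σ, hσ0, hσ1⟩ := exists_perm_pair hne hij
  have hrel := integral_relabel σ (hE.symm _)
    (fun x => G ((x (Fin.castLE hN 0)).1, (x (Fin.castLE hN 1)).1))
  simp only [Function.comp_apply, hσ0, hσ1] at hrel
  refine ⟨hrel.1 hobs.1, ?_⟩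
  rw [hrel.2, ← hval, ← hobs.2]
  congr 1
  rw [Nat.descFactorial_succ, Nat.descFactorial_one, Nat.cast_mul, Nat.cast_sub (by omega)]
  push_cast; ring

end Model.IsEnskog

/-- Almost every configuration consists of distinct points. -/
lemma ae_injective_positions (N : ℕ) :
    ∀ᵐ x : Fin N → Phase, Function.Injective fun i => (x i).1 := by
  have h : ∀ i j : Fin N, i ≠ j → ∀ᵐ x : Fin N → Phase, (x i).1 ≠ (x j).1 := by
    intro i j hij
    let L : (Fin N → Phase) →ₗ[ℝ] R3 :=
      (LinearMap.fst ℝ R3 R3) ∘ₗ ((LinearMap.proj i : (Fin N → Phase) →ₗ[ℝ] Phase) - LinearMap.proj j)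
    have hL : LinearMap.ker L ≠ ⊤ := by
      intro htop
      have : L (Pi.single i (EuclideanSpace.single 0 1, 0)) = 0 := by
        rw [← LinearMap.mem_ker, htop]; trivial
      simp [L, hij.symm] at this
    have : (volume : Measure Phase).IsAddHaarMeasure := by
      rw [Measure.volume_eq_prod]; infer_instance
    have : (volume : Measure (Fin N → Phase)).IsAddHaarMeasure := by
      rw [volume_pi]; infer_instance
    have h0 := Measure.addHaar_submodule (volume : Measure (Fin N → Phase)) (LinearMap.ker L) hL
    rw [ae_iff]
    refine measure_mono_null ?_ h0
    intro x hx
    simp only [ne_eq, not_not, mem_ofPred_eq] at hx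
    simp [L, hx]
  have h2 : ∀ᵐ x : Fin N → Phase, ∀ i j : Fin N, i ≠ j → (x i).1 ≠ (x j).1 := by
    simp only [ae_all_iff]
    exact fun i j hij => h i j hij
  filter_upwards [h2] with x hx i j hij
  by_contra hne
  exact hx i j hne hij

namespace Model

variable {S : Model}

/-- The pair contribution to the dissipated power for velocity fields `u` of the first and `w` of
the second particle. -/
def pairPower (S : Model) (u w : R3 → R3) (z : R3 × R3) : ℝ :=
  inner ℝ (u z.1) (S.Z₁ z.1 z.2 (u z.1)) + inner ℝ (u z.1) (S.Z₂ z.1 z.2 (w z.2))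

lemma sum_friction (x : Fin S.N → R3) (w : Fin S.N → R3) (i : Fin S.N) :
    ∑ j, inner ℝ (w i) (S.friction x i j (w j)) = ‖w i‖ ^ 2 +
      ∑ j ∈ Finset.univ.erase i, (inner ℝ (w i) (S.Z₁ (x i) (x j) (w i)) +
        inner ℝ (w i) (S.Z₂ (x i) (x j) (w j))) := by
  rw [← Finset.add_sum_erase _ _ (Finset.mem_univ i)]
  have h1 : inner ℝ (w i) (S.friction x i i (w i)) = ‖w i‖ ^ 2 +
      ∑ j ∈ Finset.univ.erase i, inner ℝ (w i) (S.Z₁ (x i) (x j) (w i)) := by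
    simp only [friction, if_true, add_apply, sum_apply, inner_add_right, inner_sum,
      ContinuousLinearMap.id_apply, real_inner_self_eq_norm_sq]
  have h2 : ∑ j ∈ Finset.univ.erase i, inner ℝ (w i) (S.friction x i j (w j)) =
      ∑ j ∈ Finset.univ.erase i, inner ℝ (w i) (S.Z₂ (x i) (x j) (w j)) := by
    refine Finset.sum_congr rfl fun j hj => ?_
    rw [friction, if_neg (Finset.ne_of_mem_erase hj).symm]
  rw [h1, h2, Finset.sum_add_distrib]; ring

lemma measurable_pairPower {T : ℝ} (hS : S.Admissible T) {u w : R3 → R3} (hu : Measurable u)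
    (hw : Measurable w) : Measurable (S.pairPower u w) := by
  have hu1 : Measurable fun z : R3 × R3 => u z.1 := hu.comp measurable_fst
  have hw2 : Measurable fun z : R3 × R3 => w z.2 := hw.comp measurable_snd
  have hap : Measurable fun q : (R3 →L[ℝ] R3) × R3 => q.1 q.2 :=
    (isBoundedBilinearMap_apply (𝕜 := ℝ) (E := R3) (F := R3)).continuous.measurable
  refine Measurable.add ?_ ?_
  · exact hu1.inner (hap.comp (hS.meas_Z₁.prodMk hu1))
  · exact hu1.inner (hap.comp (hS.meas_Z₂.prodMk hw2))

lemma pairPower_bound {T : ℝ} (hS : S.Admissible T) {u w : R3 → R3} {D : ℝ}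
    (hu : ∀ r, ‖u r‖ ≤ D) (hw : ∀ r, ‖w r‖ ≤ D) :
    ∃ K, ∀ z : R3 × R3, ‖S.pairPower u w z * S.g z.1 z.2‖ ≤ K := by
  obtain ⟨K, hK⟩ := hS.bounded
  have hD : 0 ≤ D := (norm_nonneg _).trans (hu 0)
  refine ⟨D * (K * D) + D * (K * D), fun z => ?_⟩
  obtain ⟨_, h1, h2, _⟩ := hK z.1 z.2
  have e : S.pairPower u w z * S.g z.1 z.2 =
      inner ℝ (u z.1) ((S.g z.1 z.2 • S.Z₁ z.1 z.2) (u z.1)) +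
      inner ℝ (u z.1) ((S.g z.1 z.2 • S.Z₂ z.1 z.2) (w z.2)) := by
    simp only [pairPower, smul_apply, real_inner_smul_right]; ring
  rw [e]
  have hK0 : 0 ≤ K := (norm_nonneg _).trans h1
  refine (norm_add_le _ _).trans (add_le_add ?_ ?_)
  · refine (norm_inner_le_norm _ _).trans ?_
    gcongr
    · exact hu _
    · exact (ContinuousLinearMap.le_opNorm _ _).trans (by gcongr; exact hu _)
  · refine (norm_inner_le_norm _ _).trans ?_
    gcongr
    · exact hu _
    · exact (ContinuousLinearMap.le_opNorm _ _).trans (by gcongr; exact hw _)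

/-- The average over an Enskog density of the positivity of the friction tensor, for velocities
`W i (rᵢ)`. -/
lemma friction_average {T δ : ℝ} (hS : S.Admissible T)
    (hδ : ∀ x : Fin S.N → R3, Function.Injective x → ∀ w : Fin S.N → R3,
      δ * ∑ i, ‖w i‖ ^ 2 ≤ ∑ i, ∑ j, inner ℝ (w i) (S.friction x i j (w j)))
    {φ : R3 → R3 → ℝ} {FN : (Fin S.N → Phase) → ℝ} (hE : S.IsEnskog φ FN) (hφ : IsDecaying φ)
    {W : Fin S.N → R3 → R3} (hW : ∀ i, Measurable (W i)) {D : ℝ} (hD : ∀ i r, ‖W i r‖ ≤ D) :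
    δ * ∑ i, ∫ r, (∫ p, φ r p) * ‖W i r‖ ^ 2 ≤
      ∑ i, ((∫ r, (∫ p, φ r p) * ‖W i r‖ ^ 2) +
        ((S.N : ℝ) - 1)⁻¹ * ∑ j ∈ Finset.univ.erase i,
          ∫ z : R3 × R3, (S.pairPower (W i) (W j) z * S.g z.1 z.2) *
            ((∫ p, φ z.1 p) * ∫ p, φ z.2 p)) := by
  have hN := hS.two_le_N
  have hN0 : (0 : ℝ) < S.N := by exact_mod_cast (by omega : 0 < S.N)
  have hN1 : (0 : ℝ) < (S.N : ℝ) - 1 := by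
    have : (2 : ℝ) ≤ S.N := by exact_mod_cast hN
    linarith
  have hsq : ∀ i r, ‖(‖W i r‖ ^ 2 : ℝ)‖ ≤ D ^ 2 := fun i r => by
    rw [norm_pow, norm_norm]; gcongr; exact hD i r
  have h1 : ∀ i, _ := fun i => hE.single hφ hN (G := fun r => ‖W i r‖ ^ 2)
    ((hW i).norm.pow_const 2) (hsq i) i
  have h2 : ∀ i j, i ≠ j → _ := fun i j hij =>
    hE.pair hφ hN hS.meas_g (measurable_pairPower hS (hW i) (hW j))
      (pairPower_bound hS (hD i) (hD j)).choose_spec hij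
  have hpt : ∀ᵐ x : Fin S.N → Phase, δ * ∑ i, ‖W i (x i).1‖ ^ 2 * FN x ≤
      ∑ i, (‖W i (x i).1‖ ^ 2 * FN x + ∑ j ∈ Finset.univ.erase i,
        S.pairPower (W i) (W j) ((x i).1, (x j).1) * FN x) := by
    filter_upwards [ae_injective_positions S.N] with x hx
    have h3 := hδ (fun i => (x i).1) hx (fun i => W i (x i).1)
    rw [Finset.sum_congr rfl fun i _ =>
      sum_friction (fun i => (x i).1) (fun i => W i (x i).1) i] at h3
    have h4 := mul_le_mul_of_nonneg_right h3 (hE.nonneg x)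
    rw [mul_assoc, Finset.sum_mul, Finset.sum_mul] at h4
    refine h4.trans (le_of_eq (Finset.sum_congr rfl fun i _ => ?_))
    rw [add_mul, Finset.sum_mul]; rfl
  have hI1 : Integrable fun x : Fin S.N → Phase => δ * ∑ i, ‖W i (x i).1‖ ^ 2 * FN x :=
    (integrable_finsetSum _ fun i _ => (h1 i).1).const_mul δ
  have hI2 : ∀ i, Integrable fun x : Fin S.N → Phase => ∑ j ∈ Finset.univ.erase i,
      S.pairPower (W i) (W j) ((x i).1, (x j).1) * FN x := fun i =>
    integrable_finsetSum _ fun j hj => (h2 i j (Finset.ne_of_mem_erase hj).symm).1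
  have hI3 := integrable_finsetSum Finset.univ fun i _ => (h1 i).1.add (hI2 i)
  have key := integral_mono_ae hI1 hI3 hpt
  rw [integral_const_mul, integral_finsetSum _ fun i _ => (h1 i).1,
    integral_finsetSum _ fun i _ => (h1 i).1.add (hI2 i)] at key
  have h5 : ∀ i, ∫ x : Fin S.N → Phase, ‖W i (x i).1‖ ^ 2 * FN x =
      (S.N : ℝ)⁻¹ * ∫ r, (∫ p, φ r p) * ‖W i r‖ ^ 2 := fun i => by
    rw [← (h1 i).2]; field_simp
  have h6 : ∀ i, ∫ x : Fin S.N → Phase, (‖W i (x i).1‖ ^ 2 * FN x + ∑ j ∈ Finset.univ.erase i,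
        S.pairPower (W i) (W j) ((x i).1, (x j).1) * FN x) =
      (S.N : ℝ)⁻¹ * ((∫ r, (∫ p, φ r p) * ‖W i r‖ ^ 2) +
        ((S.N : ℝ) - 1)⁻¹ * ∑ j ∈ Finset.univ.erase i,
          ∫ z : R3 × R3, (S.pairPower (W i) (W j) z * S.g z.1 z.2) *
            ((∫ p, φ z.1 p) * ∫ p, φ z.2 p)) := fun i => by
    rw [integral_add (h1 i).1 (hI2 i), h5, integral_finsetSum _ fun j hj =>
      (h2 i j (Finset.ne_of_mem_erase hj).symm).1, mul_add, ← mul_assoc, ← mul_inv,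
      Finset.mul_sum _ _ (((S.N : ℝ) * ((S.N : ℝ) - 1))⁻¹)]
    congr 1
    refine Finset.sum_congr rfl fun j hj => ?_
    rw [← (h2 i j (Finset.ne_of_mem_erase hj).symm).2]
    field_simp
  have h7 : ∀ i, ∫ x : Fin S.N → Phase, ((fun x => ‖W i (x i).1‖ ^ 2 * FN x) + fun x =>
      ∑ j ∈ Finset.univ.erase i, S.pairPower (W i) (W j) ((x i).1, (x j).1) * FN x) x = _ := h6
  simp only [h5] at key
  rw [Finset.sum_congr rfl fun i _ => h7 i, ← Finset.mul_sum, ← Finset.mul_sum] at key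
  rw [mul_left_comm] at key
  exact le_of_mul_le_mul_left key (by positivity)

end Model

namespace Model

variable {S : Model}

/-! ### The averaged two-body coefficients -/

/-- The average `∫ g(r, r') ρ(r') Z₁(r, r') dr'`. -/
def meanZ₁ (S : Model) (ρ : R3 → ℝ) (r : R3) : R3 →L[ℝ] R3 :=
  ∫ r' : R3, (S.g r r' * ρ r') • S.Z₁ r r'

/-- The average `∫ g(r, r') Z₂(r, r') j(r') dr'`. -/
def meanZ₂ (S : Model) (j : R3 → R3) (r : R3) : R3 :=
  ∫ r' : R3, S.g r r' • S.Z₂ r r' (j r')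

/-- The average `∫ ρ(r') g(r, r') ∇V₂(r, r') dr'`. -/
def meanForce (S : Model) (ρ : R3 → ℝ) (r : R3) : R3 :=
  ∫ r' : R3, (ρ r' * S.g r r') • S.gradV₂ r r'

lemma gradV₂_eq (S : Model) (r r' : R3) :
    S.gradV₂ r r' = S.kT⁻¹ • S.gradU₂ r r' := by
  refine ext_inner_right ℝ fun v => ?_
  unfold gradV₂ gradU₂ V₂
  have h : (fun x => S.U₂ x r' / S.kT) = S.kT⁻¹ • fun x => S.U₂ x r' := by
    funext x; rw [div_eq_inv_mul]; rfl
  rw [h, real_inner_smul_left, inner_gradient_left, inner_gradient_left, fderiv_const_smul_field]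
  rfl

lemma gradient_V₁ {T : ℝ} (hS : S.Admissible T) {t : ℝ} (ht : t ∈ Icc 0 T) (r : R3) :
    gradient (S.V₁ t) r = S.kT⁻¹ • gradient (S.U₁ t) r := by
  refine ext_inner_right ℝ fun v => ?_
  have h : S.V₁ t = fun x => S.kT⁻¹ * S.U₁ t x := by
    funext x; rw [V₁, div_eq_inv_mul]
  rw [h, real_inner_smul_left, inner_gradient_left, inner_gradient_left,
    fderiv_const_mul (hS.diff_U₁ t ht r)]
  rfl

lemma exists_kernel_bound {T : ℝ} (hS : S.Admissible T) :
    ∃ K, 0 ≤ K ∧ ∀ r r', ‖S.g r r' • S.Z₁ r r'‖ ≤ K ∧ ‖S.g r r' • S.Z₂ r r'‖ ≤ K ∧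
      ‖S.g r r' • S.gradV₂ r r'‖ ≤ K := by
  obtain ⟨K, hK⟩ := hS.bounded
  have hK0 : 0 ≤ K := (norm_nonneg _).trans (hK 0 0).2.1
  have hk := hS.kT_pos
  refine ⟨max K (S.kT⁻¹ * K), le_max_of_le_left hK0, fun r r' => ?_⟩
  obtain ⟨_, h1, h2, h3⟩ := hK r r'
  refine ⟨le_max_of_le_left h1, le_max_of_le_left h2, le_max_of_le_right ?_⟩
  rw [gradV₂_eq S, smul_comm, norm_smul, norm_inv, Real.norm_eq_abs, abs_of_pos hk]
  gcongr

lemma measurable_slice {E : Type*} [MeasurableSpace E] {u : R3 → R3 → E}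
    (hu : Measurable fun x : R3 × R3 => u x.1 x.2) (r : R3) : Measurable fun r' => u r r' :=
  hu.comp (by fun_prop : Measurable fun r' : R3 => (r, r'))

lemma measurable_kernel_Z₁ {T : ℝ} (hS : S.Admissible T) (r : R3) :
    AEStronglyMeasurable (fun r' => S.g r r' • S.Z₁ r r') volume :=
  ((measurable_slice hS.meas_g r).smul (measurable_slice hS.meas_Z₁ r)).aestronglyMeasurable

lemma measurable_kernel_Z₂ {T : ℝ} (hS : S.Admissible T) (r : R3) :
    AEStronglyMeasurable (fun r' => S.g r r' • S.Z₂ r r') volume :=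
  ((measurable_slice hS.meas_g r).smul (measurable_slice hS.meas_Z₂ r)).aestronglyMeasurable

lemma measurable_kernel_force {T : ℝ} (hS : S.Admissible T) (r : R3) :
    AEStronglyMeasurable (fun r' => S.g r r' • S.gradV₂ r r') volume := by
  simp only [gradV₂_eq S]
  exact ((measurable_slice hS.meas_g r).smul
    ((measurable_slice hS.meas_gradU₂ r).const_smul S.kT⁻¹)).aestronglyMeasurable

lemma integrable_meanZ₁ {T : ℝ} (hS : S.Admissible T) {ρ : R3 → ℝ} (hρ : Integrable ρ) (r : R3) :
    Integrable fun r' => (S.g r r' * ρ r') • S.Z₁ r r' := by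
  obtain ⟨K, hK0, hK⟩ := exists_kernel_bound hS
  have h : (fun r' => (S.g r r' * ρ r') • S.Z₁ r r') = fun r' => ρ r' • (S.g r r' • S.Z₁ r r') := by
    funext r'; rw [smul_smul, mul_comm]
  rw [h]
  refine (hρ.norm.mul_const K).mono' (hρ.aestronglyMeasurable.smul (measurable_kernel_Z₁ hS r))
    (ae_of_all _ fun r' => ?_)
  rw [norm_smul]; gcongr; exact (hK r r').1

lemma integrable_meanZ₂ {T : ℝ} (hS : S.Admissible T) {j : R3 → R3} (hj : Integrable j) (r : R3) :
    Integrable fun r' => S.g r r' • S.Z₂ r r' (j r') := by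
  obtain ⟨K, hK0, hK⟩ := exists_kernel_bound hS
  refine (hj.norm.const_mul K).mono' ?_ (ae_of_all _ fun r' => ?_)
  · exact (ContinuousLinearMap.id ℝ (R3 →L[ℝ] R3)).aestronglyMeasurable_comp₂
      (measurable_kernel_Z₂ hS r) hj.aestronglyMeasurable
  · rw [← smul_apply]
    exact (ContinuousLinearMap.le_opNorm _ _).trans (by gcongr; exact (hK r r').2.1)

lemma norm_meanZ₂_le {T : ℝ} (hS : S.Admissible T) {j : R3 → R3} (hj : Integrable j) :
    ∃ K, 0 ≤ K ∧ ∀ r, ‖S.meanZ₂ j r‖ ≤ K := by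
  obtain ⟨K, hK0, hK⟩ := exists_kernel_bound hS
  refine ⟨∫ r', K * ‖j r'‖, integral_nonneg fun r' => by positivity, fun r => ?_⟩
  refine norm_integral_le_of_norm_le (hj.norm.const_mul K) (ae_of_all _ fun r' => ?_)
  rw [← smul_apply]
  exact (ContinuousLinearMap.le_opNorm _ _).trans (by gcongr; exact (hK r r').2.1)

lemma meanZ₁_apply {T : ℝ} (hS : S.Admissible T) {ρ : R3 → ℝ} (hρ : Integrable ρ) (r v : R3) :
    S.meanZ₁ ρ r v = ∫ r' : R3, (S.g r r' * ρ r') • S.Z₁ r r' v := by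
  rw [meanZ₁, ContinuousLinearMap.integral_apply (integrable_meanZ₁ hS hρ r)]; rfl

lemma fredholm_eq {T : ℝ} (hS : S.Admissible T) {ρ : R3 → ℝ} (hρ : Integrable ρ) (a : R3 → R3)
    (r : R3) : S.fredholm ρ a r = a r + S.meanZ₁ ρ r (a r) + ρ r • S.meanZ₂ a r := by
  rw [fredholm, meanZ₁_apply hS hρ]; rfl

/-! ### Positivity of the averaged friction -/

/-- The positivity of the friction tensor, averaged over the two-body distribution
`ρ(r) ρ(r') g(r, r')`: `diag` is the bound for the motion of a single particle, `form` the one for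
a common velocity field of all particles. -/
structure FrictionPositive (S : Model) (δ : ℝ) (ρ : R3 → ℝ) : Prop where
  diag : ∀ᵐ r, ∀ v, δ * ‖v‖ ^ 2 ≤ ‖v‖ ^ 2 + inner ℝ v (S.meanZ₁ ρ r v)
  form : ∀ w : R3 → R3, Measurable w → (∃ D, ∀ r, ‖w r‖ ≤ D) →
    δ * ∫ r, ρ r * ‖w r‖ ^ 2 ≤ (∫ r, ρ r * ‖w r‖ ^ 2) +
      ∫ z : R3 × R3, (S.pairPower w w z * S.g z.1 z.2) * (ρ z.1 * ρ z.2)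

lemma integrable_pair {T : ℝ} (hS : S.Admissible T) {ρ : R3 → ℝ} (hρ : Integrable ρ)
    {u w : R3 → R3} (hu : Measurable u) (hw : Measurable w) {D : ℝ}
    (hub : ∀ r, ‖u r‖ ≤ D) (hwb : ∀ r, ‖w r‖ ≤ D) :
    Integrable fun z : R3 × R3 => (S.pairPower u w z * S.g z.1 z.2) * (ρ z.1 * ρ z.2) := by
  obtain ⟨K, hK⟩ := pairPower_bound hS hub hwb
  exact (hρ.mul_prod hρ).bdd_mul
    ((measurable_pairPower hS hu hw).mul hS.meas_g).aestronglyMeasurable (ae_of_all _ hK)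

/-- The pair power in terms of the averaged coefficients. -/
lemma integral_pair {T : ℝ} (hS : S.Admissible T) {ρ : R3 → ℝ} (hρ : Integrable ρ)
    {u w : R3 → R3} (hu : Measurable u) (hw : Measurable w) {D : ℝ}
    (hub : ∀ r, ‖u r‖ ≤ D) (hwb : ∀ r, ‖w r‖ ≤ D) :
    Integrable (fun r => ρ r * (inner ℝ (u r) (S.meanZ₁ ρ r (u r)) +
        inner ℝ (u r) (S.meanZ₂ (fun r' => ρ r' • w r') r))) ∧
    ∫ z : R3 × R3, (S.pairPower u w z * S.g z.1 z.2) * (ρ z.1 * ρ z.2) =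
      ∫ r, ρ r * (inner ℝ (u r) (S.meanZ₁ ρ r (u r)) +
        inner ℝ (u r) (S.meanZ₂ (fun r' => ρ r' • w r') r)) := by
  have hi := integrable_pair hS hρ hu hw hub hwb
  have hj : Integrable fun r' => ρ r' • w r' :=
    (hρ.norm.mul_const D).mono' (hρ.aestronglyMeasurable.smul hw.aestronglyMeasurable)
      (ae_of_all _ fun r => by rw [norm_smul]; gcongr; exact hwb r)
  have hin : ∀ r, ∫ r', (S.pairPower u w (r, r') * S.g r r') * (ρ r * ρ r') =
      ρ r * (inner ℝ (u r) (S.meanZ₁ ρ r (u r)) +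
        inner ℝ (u r) (S.meanZ₂ (fun r' => ρ r' • w r') r)) := by
    intro r
    have h1 : Integrable fun r' => (S.g r r' * ρ r') • S.Z₁ r r' (u r) :=
      (integrable_meanZ₁ hS hρ r).apply_continuousLinearMap (u r)
    have h2 := integrable_meanZ₂ hS hj r
    rw [meanZ₁_apply hS hρ, meanZ₂, ← integral_inner h1, ← integral_inner h2,
      ← integral_add (h1.const_inner _) (h2.const_inner _), ← integral_const_mul]
    congr 1; funext r'
    simp only [pairPower, map_smul, real_inner_smul_right]; ring
  refine ⟨?_, ?_⟩
  · have := hi.integral_prod_left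
    refine this.congr (ae_of_all _ fun r => hin r)
  · rw [Measure.volume_eq_prod, integral_prod _ (by rwa [← Measure.volume_eq_prod])]
    congr 1; funext r; exact hin r

/-- Pointwise limits of densities with a common decay inherit the positivity of the averaged
friction. -/
lemma FrictionPositive.of_tendsto {T δ : ℝ} (hS : S.Admissible T) {ρn : ℕ → R3 → ℝ} {ρ : R3 → ℝ}
    {B : ℝ} (hB : ∀ n r, ‖ρn n r‖ ≤ B * decay4 r) (hm : ∀ n, AEStronglyMeasurable (ρn n) volume)
    (hlim : ∀ r, Tendsto (fun n => ρn n r) atTop (𝓝 (ρ r)))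
    (hpos : ∀ n, S.FrictionPositive δ (ρn n)) : S.FrictionPositive δ ρ where
  diag := by
    obtain ⟨K, hK0, hK⟩ := exists_kernel_bound hS
    have hall : ∀ᵐ r, ∀ n v, δ * ‖v‖ ^ 2 ≤ ‖v‖ ^ 2 + inner ℝ v (S.meanZ₁ (ρn n) r v) :=
      ae_all_iff.2 fun n => (hpos n).diag
    filter_upwards [hall] with r hr v
    have h1 : Tendsto (fun n => S.meanZ₁ (ρn n) r) atTop (𝓝 (S.meanZ₁ ρ r)) := by
      have e : ∀ (u : R3 → ℝ) r', (S.g r r' * u r') • S.Z₁ r r' = u r' • (S.g r r' • S.Z₁ r r') :=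
        fun u r' => by rw [smul_smul, mul_comm]
      simp only [meanZ₁, e]
      refine tendsto_integral_of_dominated_convergence (fun r' => B * decay4 r' * K) ?_ ?_ ?_ ?_
      · intro n; exact (hm n).smul (measurable_kernel_Z₁ hS r)
      · exact (integrable_decay4.const_mul B).mul_const K
      · intro n; refine ae_of_all _ fun r' => ?_
        rw [norm_smul]
        exact mul_le_mul (hB n r') (hK r r').1 (norm_nonneg _) ((norm_nonneg _).trans (hB n r'))
      · exact ae_of_all _ fun r' => (hlim r').smul_const _
    have h2 : Tendsto (fun n => ‖v‖ ^ 2 + inner ℝ v (S.meanZ₁ (ρn n) r v)) atTop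
        (𝓝 (‖v‖ ^ 2 + inner ℝ v (S.meanZ₁ ρ r v))) :=
      tendsto_const_nhds.add (tendsto_const_nhds.inner
        (((ContinuousLinearMap.apply ℝ R3 v).continuous.tendsto _).comp h1))
    exact ge_of_tendsto' h2 fun n => hr n v
  form w hw hD := by
    obtain ⟨D, hD⟩ := hD
    obtain ⟨K, hK⟩ := pairPower_bound hS hD hD
    have h1 : Tendsto (fun n => ∫ r, ρn n r * ‖w r‖ ^ 2) atTop (𝓝 (∫ r, ρ r * ‖w r‖ ^ 2)) := by
      refine tendsto_integral_of_dominated_convergence (fun r' => B * decay4 r' * D ^ 2) ?_ ?_ ?_ ?_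
      · intro n; exact (hm n).mul (hw.norm.pow_const 2).aestronglyMeasurable
      · exact (integrable_decay4.const_mul B).mul_const _
      · intro n; refine ae_of_all _ fun r' => ?_
        rw [norm_mul, norm_pow, norm_norm]
        have := (norm_nonneg _).trans (hB n r')
        gcongr
        exacts [hB n r', hD r']
      · exact ae_of_all _ fun r' => (hlim r').mul_const _
    have h2 : Tendsto (fun n => ∫ z : R3 × R3,
        (S.pairPower w w z * S.g z.1 z.2) * (ρn n z.1 * ρn n z.2)) atTop
        (𝓝 (∫ z : R3 × R3, (S.pairPower w w z * S.g z.1 z.2) * (ρ z.1 * ρ z.2))) := by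
      refine tendsto_integral_of_dominated_convergence
        (fun z => K * ((B * decay4 z.1) * (B * decay4 z.2))) ?_ ?_ ?_ ?_
      · intro n
        refine ((measurable_pairPower hS hw hw).mul hS.meas_g).aestronglyMeasurable.mul ?_
        rw [Measure.volume_eq_prod]
        exact (hm n).comp_fst.mul (hm n).comp_snd
      · exact ((integrable_decay4.const_mul B).mul_prod (integrable_decay4.const_mul B)).const_mul K
      · intro n; refine ae_of_all _ fun z => ?_
        rw [norm_mul, norm_mul (ρn n z.1)]
        have h3 := (norm_nonneg _).trans (hB n z.1)
        have h5 := (norm_nonneg _).trans (hK z)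
        exact mul_le_mul (hK z) (mul_le_mul (hB n z.1) (hB n z.2) (norm_nonneg _) h3)
          (by positivity) h5
      · exact ae_of_all _ fun z => tendsto_const_nhds.mul ((hlim z.1).mul (hlim z.2))
    exact le_of_tendsto_of_tendsto' (h1.const_mul δ) (h1.add h2) fun n => (hpos n).form w hw ⟨D, hD⟩

/-- The averaged friction of an Enskog density is positive. For the bound on single particles, one
particle moves with constant velocity while it is in a test set. -/
lemma IsEnskog.frictionPositive {T δ : ℝ} (hS : S.Admissible T)
    (hδ : ∀ x : Fin S.N → R3, Function.Injective x → ∀ w : Fin S.N → R3,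
      δ * ∑ i, ‖w i‖ ^ 2 ≤ ∑ i, ∑ j, inner ℝ (w i) (S.friction x i j (w j)))
    {φ : R3 → R3 → ℝ} {FN : (Fin S.N → Phase) → ℝ} (hE : S.IsEnskog φ FN) (hφ : IsDecaying φ)
    (hpos : ∀ r, 0 < ∫ p, φ r p) : S.FrictionPositive δ fun r => ∫ p, φ r p where
  diag := by
    have hN := hS.two_le_N
    have hN1 : (0 : ℝ) < (S.N : ℝ) - 1 := by
      have : (2 : ℝ) ≤ S.N := by exact_mod_cast hN
      linarith
    set ρ : R3 → ℝ := fun r => ∫ p, φ r p with hρdef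
    have hρ : Integrable ρ := hφ.integrable_density
    have main : ∀ v : R3, ∀ᵐ r, δ * ‖v‖ ^ 2 ≤ ‖v‖ ^ 2 + inner ℝ v (S.meanZ₁ ρ r v) := by
      intro v
      have hvm : Measurable fun _ : R3 => v := measurable_const
      have hZi : Integrable fun r => ρ r * inner ℝ v (S.meanZ₁ ρ r v) := by
        have := (integral_pair hS hρ hvm (measurable_const (a := (0 : R3))) (D := ‖v‖)
          (fun _ => le_rfl) (fun _ => by simp)).1
        simpa [meanZ₂] using this
      have hle : (fun r => ρ r * (δ * ‖v‖ ^ 2)) ≤ᵐ[volume]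
          fun r => ρ r * ‖v‖ ^ 2 + ρ r * inner ℝ v (S.meanZ₁ ρ r v) := by
        refine ae_le_of_forall_setIntegral_le (hρ.mul_const _)
          ((hρ.mul_const _).add hZi) fun s hs _ => ?_
        -- only one particle, found in `s`, moves
        set u : R3 → R3 := s.indicator fun _ => v with hu
        have hum : Measurable u := hvm.indicator hs
        have hub : ∀ r, ‖u r‖ ≤ ‖v‖ := fun r => norm_indicator_le_norm_self _ r
        let i₀ : Fin S.N := ⟨0, by omega⟩
        let W : Fin S.N → R3 → R3 := fun i => if i = i₀ then u else 0
        have hWm : ∀ i, Measurable (W i) := fun i => by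
          by_cases h : i = i₀ <;> simp only [W, h, if_true, if_false]
          exacts [hum, measurable_zero]
        have hWb : ∀ i r, ‖W i r‖ ≤ ‖v‖ := fun i r => by
          by_cases h : i = i₀ <;> simp only [W, h, if_true, if_false]
          exacts [hub r, by simp]
        have h1 := friction_average hS hδ hE hφ hWm hWb
        have hW0 : W i₀ = u := by simp [W]
        have hWn : ∀ i, i ≠ i₀ → W i = 0 := fun i hi => by simp [W, hi]
        rw [Finset.sum_eq_single i₀ (fun i _ hi => by simp [hWn i hi])
          (fun h => absurd (Finset.mem_univ _) h),
          Finset.sum_eq_single i₀ (fun i _ hi => by simp [hWn i hi, pairPower])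
          (fun h => absurd (Finset.mem_univ _) h), hW0] at h1
        have hsum : ∑ j ∈ Finset.univ.erase i₀, ∫ z : R3 × R3,
            (S.pairPower u (W j) z * S.g z.1 z.2) * ((∫ p, φ z.1 p) * ∫ p, φ z.2 p) =
            ((S.N : ℝ) - 1) * ∫ r, ρ r * inner ℝ (u r) (S.meanZ₁ ρ r (u r)) := by
          have : ∀ j ∈ Finset.univ.erase i₀, ∫ z : R3 × R3,
              (S.pairPower u (W j) z * S.g z.1 z.2) * ((∫ p, φ z.1 p) * ∫ p, φ z.2 p) =
              ∫ r, ρ r * inner ℝ (u r) (S.meanZ₁ ρ r (u r)) := fun j hj => by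
            rw [hWn j (Finset.ne_of_mem_erase hj)]
            have := (integral_pair hS hρ hum (measurable_zero (α := R3)) hub
              (fun _ => by simp)).2
            refine this.trans ?_
            simp [meanZ₂]
          rw [Finset.sum_congr rfl this, Finset.sum_const, Finset.card_erase_of_mem
            (Finset.mem_univ _), Finset.card_univ, Fintype.card_fin, nsmul_eq_mul,
            Nat.cast_sub (by omega)]
          simp
        rw [hsum, ← mul_assoc, inv_mul_cancel₀ hN1.ne', one_mul] at h1
        have e1 : ∀ r, ρ r * ‖u r‖ ^ 2 = s.indicator (fun r => ρ r * ‖v‖ ^ 2) r := fun r => by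
          by_cases h : r ∈ s <;> simp [hu, h]
        have e2 : ∀ r, ρ r * inner ℝ (u r) (S.meanZ₁ ρ r (u r)) =
            s.indicator (fun r => ρ r * inner ℝ v (S.meanZ₁ ρ r v)) r := fun r => by
          by_cases h : r ∈ s <;> simp [hu, h]
        have h1' : δ * ∫ r, ρ r * ‖u r‖ ^ 2 ≤ (∫ r, ρ r * ‖u r‖ ^ 2) +
          ∫ r, ρ r * inner ℝ (u r) (S.meanZ₁ ρ r (u r)) := h1
        simp only [e1, e2, integral_indicator hs] at h1'
        rw [integral_add (hρ.mul_const _).integrableOn hZi.integrableOn]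
        refine le_trans (le_of_eq ?_) h1'
        rw [← integral_const_mul]
        congr 1; funext r; ring
      filter_upwards [hle] with r hr
      rw [← mul_add] at hr
      exact le_of_mul_le_mul_left hr (hpos r)
    have hall : ∀ᵐ r, ∀ n : ℕ, δ * ‖TopologicalSpace.denseSeq R3 n‖ ^ 2 ≤
        ‖TopologicalSpace.denseSeq R3 n‖ ^ 2 + inner ℝ (TopologicalSpace.denseSeq R3 n)
          (S.meanZ₁ ρ r (TopologicalSpace.denseSeq R3 n)) := ae_all_iff.2 fun n => main _
    filter_upwards [hall] with r hr v
    have hcl : IsClosed {v : R3 | δ * ‖v‖ ^ 2 ≤ ‖v‖ ^ 2 + inner ℝ v (S.meanZ₁ ρ r v)} :=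
      isClosed_le (by fun_prop) (by fun_prop)
    have := (TopologicalSpace.denseRange_denseSeq R3).induction_on
      (p := fun v => δ * ‖v‖ ^ 2 ≤ ‖v‖ ^ 2 + inner ℝ v (S.meanZ₁ ρ r v)) v hcl hr
    exact this
  form w hw hD := by
    obtain ⟨D, hD⟩ := hD
    have hN := hS.two_le_N
    have hN0 : (0 : ℝ) < S.N := by exact_mod_cast (by omega : 0 < S.N)
    have hN1 : (0 : ℝ) < (S.N : ℝ) - 1 := by
      have : (2 : ℝ) ≤ S.N := by exact_mod_cast hN
      linarith
    have h1 := friction_average hS hδ hE hφ (W := fun _ => w) (fun _ => hw) (fun _ => hD)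
    have hcard : ∀ i : Fin S.N, (((Finset.univ.erase i).card : ℕ) : ℝ) = (S.N : ℝ) - 1 :=
      fun i => by
        rw [Finset.card_erase_of_mem (Finset.mem_univ _), Finset.card_univ, Fintype.card_fin,
          Nat.cast_sub (by omega)]; simp
    simp only [Finset.sum_const, Finset.card_univ, Fintype.card_fin, nsmul_eq_mul, hcard] at h1
    rw [← mul_assoc _ ((S.N : ℝ) - 1), inv_mul_cancel₀ hN1.ne', one_mul, mul_left_comm] at h1
    exact le_of_mul_le_mul_left h1 hN0

/-- Uniqueness for the Fredholm equation: a continuous integrable solution `c` of the homogeneous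
equation is `O(ρ)`, so that `c = ρ w` with bounded `w`, and the dissipated power of the velocity
field `w` vanishes. -/
lemma FrictionPositive.eq_zero_of_fredholm {T δ : ℝ} (hS : S.Admissible T) (hδ : 0 < δ)
    {ρ : R3 → ℝ} (hpos : S.FrictionPositive δ ρ) (hρ : Integrable ρ) (hρm : Measurable ρ)
    (hρ0 : ∀ r, 0 ≤ ρ r) {c : R3 → R3} (hc : Continuous c) (hci : Integrable c)
    (h0 : ∀ r, S.fredholm ρ c r = 0) : c = 0 := by
  obtain ⟨K, hK0, hK⟩ := norm_meanZ₂_le hS hci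
  set L : ℝ := K / δ with hL
  have hle : ∀ᵐ r, ‖c r‖ ≤ L * ρ r := by
    filter_upwards [hpos.diag] with r hr
    have h1 := hr (c r)
    have h2 := h0 r
    rw [fredholm_eq hS hρ] at h2
    have h3 : ‖c r‖ ^ 2 + inner ℝ (c r) (S.meanZ₁ ρ r (c r)) =
        -(ρ r * inner ℝ (c r) (S.meanZ₂ c r)) := by
      have := congrArg (fun v => inner ℝ (c r) v) h2
      simp only [inner_add_right, inner_zero_right, real_inner_smul_right,
        real_inner_self_eq_norm_sq] at this
      linarith
    have h4 : -(ρ r * inner ℝ (c r) (S.meanZ₂ c r)) ≤ ρ r * (‖c r‖ * K) := by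
      have h5 : -inner ℝ (c r) (S.meanZ₂ c r) ≤ ‖c r‖ * K := by
        refine (neg_le_abs _).trans ((abs_real_inner_le_norm _ _).trans ?_)
        gcongr; exact hK r
      have := mul_le_mul_of_nonneg_left h5 (hρ0 r)
      linarith
    rcases (norm_nonneg (c r)).eq_or_lt with h6 | h6
    · rw [← h6]; exact mul_nonneg (by positivity) (hρ0 r)
    · rw [hL, div_mul_eq_mul_div, le_div_iff₀ hδ]
      have : ‖c r‖ * (δ * ‖c r‖) ≤ ‖c r‖ * (K * ρ r) := by nlinarith
      have := le_of_mul_le_mul_left this h6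
      linarith
  have hL0 : 0 ≤ L := by positivity
  set s : Set R3 := {r | ‖c r‖ ≤ L * ρ r} with hs
  have hsm : MeasurableSet s :=
    measurableSet_le hc.norm.measurable (hρm.const_mul L)
  -- the velocity field `c / ρ` on the conull set `s`, on which `ρ = 0` implies `c = 0`
  set w : R3 → R3 := s.indicator fun r => (ρ r)⁻¹ • c r with hw
  have hwm : Measurable w := (hρm.inv.smul hc.measurable).indicator hsm
  have hwb : ∀ r, ‖w r‖ ≤ L := fun r => by
    by_cases h : r ∈ s
    · have h' : ‖c r‖ ≤ L * ρ r := h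
      simp only [hw, indicator_of_mem h, norm_smul, norm_inv, Real.norm_eq_abs, abs_of_nonneg (hρ0 r)]
      rcases (hρ0 r).eq_or_lt with h6 | h6
      · rw [← h6]; simpa using hL0
      · rw [inv_mul_le_iff₀ h6]; linarith
    · simpa [hw, h] using hL0
  have hcw : ∀ᵐ r, ρ r • w r = c r := by
    filter_upwards [hle] with r hr
    have h : r ∈ s := hr
    simp only [hw, indicator_of_mem h, smul_smul]
    rcases (hρ0 r).eq_or_lt with h6 | h6
    · rw [← h6, mul_zero] at hr
      rw [norm_le_zero_iff.1 hr, smul_zero]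
    · rw [mul_inv_cancel₀ h6.ne', one_smul]
  have hmean : ∀ r, S.meanZ₂ (fun r' => ρ r' • w r') r = S.meanZ₂ c r := fun r => by
    refine integral_congr_ae ?_
    filter_upwards [hcw] with r' hr'
    simp only [hr']
  have hform := hpos.form w hwm ⟨L, hwb⟩
  have hpair := integral_pair hS hρ hwm hwm hwb hwb
  rw [hpair.2] at hform
  have hsq : Integrable fun r => ρ r * ‖w r‖ ^ 2 := by
    refine hρ.mul_bdd (c := L ^ 2) (hwm.norm.pow_const 2).aestronglyMeasurable
      (ae_of_all _ fun r => ?_)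
    rw [norm_pow, norm_norm]; gcongr; exact hwb r
  rw [← integral_add hsq hpair.1] at hform
  have hzero : ∫ r, (ρ r * ‖w r‖ ^ 2 + ρ r * (inner ℝ (w r) (S.meanZ₁ ρ r (w r)) +
      inner ℝ (w r) (S.meanZ₂ (fun r' => ρ r' • w r') r))) = 0 := by
    rw [← integral_zero R3 ℝ]
    refine integral_congr_ae ?_
    filter_upwards [hcw] with r hr
    have h2 := h0 r
    rw [fredholm_eq hS hρ] at h2
    have := congrArg (fun v => inner ℝ (w r) v) h2
    simp only [inner_add_right, inner_zero_right, real_inner_smul_right, ← hr, map_smul,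
      real_inner_self_eq_norm_sq] at this
    rw [hmean]
    linarith
  rw [hzero] at hform
  have hint0 : ∫ r, ρ r * ‖w r‖ ^ 2 = 0 := by
    refine le_antisymm ?_ (integral_nonneg fun r => mul_nonneg (hρ0 r) (by positivity))
    by_contra hlt
    push Not at hlt
    nlinarith
  have hae := (integral_eq_zero_iff_of_nonneg
    (fun r => mul_nonneg (hρ0 r) (by positivity)) hsq).1 hint0
  have hc0 : c =ᵐ[volume] 0 := by
    filter_upwards [hae, hcw] with r h1 h2
    rw [← h2]
    simp only [Pi.zero_apply, mul_eq_zero, ne_eq, OfNat.ofNat_ne_zero, not_false_eq_true,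
      pow_eq_zero_iff, norm_eq_zero] at h1
    rcases h1 with h1 | h1 <;> simp [h1]
  exact (hc.ae_eq_iff_eq volume continuous_zero).1 hc0

end Model

/-! ### Moment equations of the kinetic equation -/

lemma IsRegular.isDecaying {T : ℝ} {h : PhaseFun} (hh : IsRegular T h) {t : ℝ}
    (ht : t ∈ Icc 0 T) : IsDecaying (h t) where
  continuous := continuous_slice hh.cont ht
  bound := by
    obtain ⟨B, hB0, hB⟩ := hh.exists_bound
    refine ⟨B, fun r p => le_trans ?_ (hB t ht r p).1⟩
    rw [Real.norm_eq_abs]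
    exact le_mul_of_one_le_right (abs_nonneg _) (norm_pow_le_sq p).1

namespace Model

variable {S : Model} {T : ℝ} {h : PhaseFun} {t : ℝ}

lemma integral_phase_Z₁ (hS : S.Admissible T) (hh : IsRegular T h) (ht : t ∈ Icc 0 T) (r v : R3) :
    ∫ x : Phase, (S.g r x.1 * h t x.1 x.2) • S.Z₁ r x.1 v = S.meanZ₁ (density h t) r v := by
  obtain ⟨K, hK0, hK⟩ := exists_kernel_bound hS
  have hi := (isField_density (T := T)).integrable hh ht
  have h1 := (integral_phase (hh.isDecaying ht).integrable
    (K := fun r' => (S.g r r' • S.Z₁ r r') v) (D := K * ‖v‖)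
    ((ContinuousLinearMap.apply ℝ R3 v).continuous.comp_aestronglyMeasurable
      (measurable_kernel_Z₁ hS r)) fun r' =>
        (ContinuousLinearMap.le_opNorm _ _).trans (by gcongr; exact (hK r r').1)).2
  rw [meanZ₁_apply hS hi]
  simp only [smul_apply, smul_smul] at h1
  simp only [mul_comm (S.g r _)]
  exact h1

lemma integral_phase_force (hS : S.Admissible T) (hh : IsRegular T h) (ht : t ∈ Icc 0 T) (r : R3) :
    ∫ x : Phase, (h t x.1 x.2 * S.g r x.1) • S.gradV₂ r x.1 = S.meanForce (density h t) r := by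
  obtain ⟨K, hK0, hK⟩ := exists_kernel_bound hS
  have h1 := (integral_phase (hh.isDecaying ht).integrable (measurable_kernel_force hS r)
    fun r' => (hK r r').2.2).2
  simp only [smul_smul] at h1
  exact h1

lemma integral_phase_Z₂ (hS : S.Admissible T) (hh : IsRegular T h) (ht : t ∈ Icc 0 T) (r : R3) :
    ∫ x : Phase, S.g r x.1 • S.Z₂ r x.1 (ouP h t x.1 x.2) = S.meanZ₂ (flux h t) r := by
  obtain ⟨K, hK0, hK⟩ := exists_kernel_bound hS
  obtain ⟨B, hB0, hB⟩ := hh.exists_bound_ouP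
  have hc : Continuous fun x : R3 × R3 => ouP h t x.1 x.2 :=
    ((continuous_slice hh.cont ht).smul continuous_snd).add (continuous_slice hh.cont_p ht)
  have hi : Integrable fun x : Phase => S.g r x.1 • S.Z₂ r x.1 (ouP h t x.1 x.2) := by
    refine (((integrable_decay4.mul_prod integrable_decay4).const_mul B).const_mul K).mono' ?_
      (ae_of_all _ fun x => ?_)
    · have h1 : AEStronglyMeasurable (fun x : Phase => S.g r x.1 • S.Z₂ r x.1) volume := by
        rw [Measure.volume_eq_prod]; exact (measurable_kernel_Z₂ hS r).comp_fst
      exact (ContinuousLinearMap.id ℝ (R3 →L[ℝ] R3)).aestronglyMeasurable_comp₂ h1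
        hc.aestronglyMeasurable
    · rw [← smul_apply]
      have h2 : ‖ouP h t x.1 x.2‖ ≤ B * (decay4 x.1 * decay4 x.2) :=
        (le_mul_of_one_le_left (norm_nonneg _) (by linarith [norm_nonneg x.2])).trans
          (hB t ht x.1 x.2).1
      exact (ContinuousLinearMap.le_opNorm _ _).trans
        (mul_le_mul (hK r x.1).2.1 h2 (norm_nonneg _) hK0)
  rw [Measure.volume_eq_prod, integral_prod _ (by rwa [← Measure.volume_eq_prod])]
  congr 1; funext r'
  have h3 := (S.g r r' • S.Z₂ r r').integral_comp_comm (hh.integrable_ouP ht r')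
  rw [hh.integral_ouP ht r'] at h3
  exact h3

/-- Minus the mean force on a particle at `r`, in units of the temperature. -/
def totalForce (S : Model) (t : ℝ) (ρ : R3 → ℝ) (r : R3) : R3 :=
  gradient (S.V₁ t) r + S.meanForce ρ r

/-- The kinetic equation in terms of the averaged coefficients, multiplied by `ε²`. -/
lemma kinetic_pointwise (hS : S.Admissible T) {ε : ℝ} (hε : 0 < ε) (hh : IsRegular T h)
    (hk : S.IsKineticSolution T ε h) (ht : t ∈ Icc 0 T) (r p : R3) :
    ε • ε • dt T h t r p =
      ε • (inner ℝ (S.totalForce t (density h t) r) (gradP h t r p) - inner ℝ p (gradR h t r p))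
      + (trace3 (derivOuP h t r p) + trace3 (S.meanZ₁ (density h t) r ∘L derivOuP h t r p)
      + inner ℝ (S.meanZ₂ (flux h t) r) (gradP h t r p)) := by
  have h1 := hk t ht r p
  have hL0 : L₀ h t r p = trace3 (derivOuP h t r p) := by
    rw [L₀, divg_eq_trace3, (hh.hasFDerivAt_ouP ht r p).fderiv]
  have hN0 : S.N₀ h h t r p = trace3 (S.meanZ₁ (density h t) r ∘L derivOuP h t r p)
      + inner ℝ (S.meanZ₂ (flux h t) r) (gradP h t r p) := by
    unfold N₀
    simp only [integral_phase_Z₁ hS hh ht, integral_phase_Z₂ hS hh ht]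
    congr 1
    · have h2 : HasFDerivAt (fun q => S.meanZ₁ (density h t) r (ouP h t r q)) _ p :=
        (S.meanZ₁ (density h t) r).hasFDerivAt.comp p (hh.hasFDerivAt_ouP ht r p)
      rw [divg_eq_trace3, h2.fderiv]
    · have h2 := (hh.diff_p t ht r p).hasFDerivAt.smul_const (S.meanZ₂ (flux h t) r)
      rw [divg_eq_trace3, h2.fderiv, trace3_smulRight, fderiv_eq_inner_gradient, real_inner_comm]
      rfl
  have hN1 : S.L₁ h t r p + S.N₁ h h t r p =
      inner ℝ (S.totalForce t (density h t) r) (gradP h t r p) - inner ℝ p (gradR h t r p) := by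
    unfold L₁ N₁ totalForce
    rw [integral_phase_force hS hh ht, inner_add_left]; ring
  rw [h1, hN1, hL0, hN0]
  simp only [smul_eq_mul]
  field_simp
  ring

lemma integral_balance {E : Type*} [NormedAddCommGroup E] [NormedSpace ℝ E] {ε : ℝ}
    {u v w x : R3 → E} (hu : Integrable u) (hv : Integrable v) (hw : Integrable w)
    (hx : Integrable x) :
    ∫ p, (ε • ε • u p - (ε • (v p - w p) + x p)) =
      ε • ε • (∫ p, u p) - (ε • ((∫ p, v p) - ∫ p, w p) + ∫ p, x p) := by
  have h1 : Integrable fun p => ε • ε • u p := (hu.smul ε).smul ε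
  have h2 : Integrable fun p => ε • (v p - w p) := (hv.sub hw).smul ε
  have h3 : Integrable fun p => ε • (v p - w p) + x p := h2.add hx
  rw [integral_sub h1 h3, integral_add h2 hx, integral_smul, integral_smul, integral_smul,
    integral_sub hv hw]

/-- Conservation of mass. -/
lemma mass_equation (hS : S.Admissible T) {ε : ℝ} (hε : 0 < ε) (hh : IsRegular T h)
    (hk : S.IsKineticSolution T ε h) (ht : t ∈ Icc 0 T) (r : R3) :
    ε • ∫ p, dt T h t r p = -∫ p, inner ℝ p (gradR h t r p) := by
  have h1 : ∀ p, _ := fun p => kinetic_pointwise hS hε hh hk ht r p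
  set b := S.totalForce t (density h t) r
  set c := S.meanZ₂ (flux h t) r
  set A := S.meanZ₁ (density h t) r
  have hA : ∀ p, trace3 (derivOuP h t r p) + trace3 (A ∘L derivOuP h t r p) =
      trace3 ((ContinuousLinearMap.id ℝ R3 + A) ∘L derivOuP h t r p) := fun p => by
    rw [ContinuousLinearMap.add_comp, map_add, ContinuousLinearMap.id_comp]
  -- the divergence terms are expressed through the integrable ones
  have h2 : ∀ p, trace3 ((ContinuousLinearMap.id ℝ R3 + A) ∘L derivOuP h t r p) =
      ε • ε • dt T h t r p - (ε • (inner ℝ b (gradP h t r p) - inner ℝ p (gradR h t r p))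
        + inner ℝ c (gradP h t r p)) := fun p => by
    rw [← hA, h1]; ring
  have i1 : Integrable fun p => dt T h t r p :=
    isLocalOp_dt.integrable_clm (M := fun _ => ContinuousLinearMap.id ℝ ℝ) continuous_const
      (fun p => ContinuousLinearMap.norm_id_le.trans (norm_pow_le_sq p).1) hh ht r
  have i2 : ∀ v : R3, Integrable fun p => (inner ℝ v (gradP h t r p) : ℝ) := fun v =>
    (hh.integrable_gradP ht r).const_inner v
  have i3 : Integrable fun p => (inner ℝ p (gradR h t r p) : ℝ) :=
    hh.integrable_gradR_clm (M := fun p => innerSL ℝ p) (innerSL ℝ).continuous (fun p => by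
      rw [innerSL_apply_norm]; exact (norm_pow_le_sq p).2.1) ht r
  have h3 := (hh.integral_trace_derivOuP ht r (ContinuousLinearMap.id ℝ R3 + A)).1
  simp only [h2] at h3
  rw [integral_balance i1 (i2 b) i3 (i2 c), (hh.integral_inner_gradP ht r b).1,
    (hh.integral_inner_gradP ht r c).1] at h3
  simp only [smul_eq_mul] at h3 ⊢
  have h4 : ε * (ε * ∫ p, dt T h t r p) = ε * (-∫ p, inner ℝ p (gradR h t r p)) := by linarith
  exact mul_left_cancel₀ hε.ne' h4

/-- Balance of momentum. -/
lemma momentum_equation (hS : S.Admissible T) {ε : ℝ} (hε : 0 < ε) (hh : IsRegular T h)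
    (hk : S.IsKineticSolution T ε h) (ht : t ∈ Icc 0 T) (r : R3) :
    ε • ε • ∫ p, dt T h t r p • p =
      -(ε • ((∫ p, inner ℝ p (gradR h t r p) • p)
        + density h t r • S.totalForce t (density h t) r))
      - (flux h t r + S.meanZ₁ (density h t) r (flux h t r)
        + density h t r • S.meanZ₂ (flux h t) r) := by
  have h1 : ∀ p, _ := fun p => kinetic_pointwise hS hε hh hk ht r p
  set b := S.totalForce t (density h t) r
  set c := S.meanZ₂ (flux h t) r
  set A := S.meanZ₁ (density h t) r
  have h2 : ∀ p, trace3 ((ContinuousLinearMap.id ℝ R3 + A) ∘L derivOuP h t r p) • p =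
      ε • ε • (dt T h t r p • p) - (ε • (inner ℝ b (gradP h t r p) • p
        - inner ℝ p (gradR h t r p) • p) + inner ℝ c (gradP h t r p) • p) := fun p => by
    have h3 : trace3 ((ContinuousLinearMap.id ℝ R3 + A) ∘L derivOuP h t r p) =
      ε • ε • dt T h t r p - (ε • (inner ℝ b (gradP h t r p) - inner ℝ p (gradR h t r p))
        + inner ℝ c (gradP h t r p)) := by
      rw [ContinuousLinearMap.add_comp, map_add, ContinuousLinearMap.id_comp, h1]; ring
    rw [h3]
    simp only [smul_eq_mul]
    module
  have i1 : Integrable fun p => dt T h t r p • p :=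
    isLocalOp_dt.integrable_clm (M := fun p => (ContinuousLinearMap.id ℝ ℝ).smulRight p)
      ((ContinuousLinearMap.smulRightL ℝ ℝ R3 (ContinuousLinearMap.id ℝ ℝ)).continuous) (fun p => by
        rw [ContinuousLinearMap.norm_smulRight_apply]
        exact (mul_le_of_le_one_left (norm_nonneg p) ContinuousLinearMap.norm_id_le).trans
          (norm_pow_le_sq p).2.1) hh ht r
  have i2 : ∀ v : R3, Integrable fun p => (inner ℝ v (gradP h t r p) : ℝ) • p := fun v => by
    refine ((isLocalOp_gradP.integrable_clm continuous_tensorP norm_tensorP_le hh ht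
      r).apply_continuousLinearMap v).congr (ae_of_all _ fun p => ?_)
    simp only [tensorP_apply, ContinuousLinearMap.smulRight_apply, innerSL_apply_apply,
      real_inner_comm]
  have i3 : Integrable fun p => (inner ℝ p (gradR h t r p) : ℝ) • p :=
    hh.integrable_gradR_clm (M := fun p => (innerSL ℝ p).smulRight p) (by
      have h1 : Continuous fun p : R3 => ContinuousLinearMap.smulRightL ℝ R3 R3 (innerSL ℝ p) :=
        (ContinuousLinearMap.smulRightL ℝ R3 R3).continuous.comp (innerSL ℝ).continuous
      exact h1.clm_apply continuous_id) (fun p => by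
        rw [ContinuousLinearMap.norm_smulRight_apply, innerSL_apply_norm]
        exact (norm_pow_le_sq p).2.2) ht r
  have h3 := (hh.integral_trace_derivOuP ht r (ContinuousLinearMap.id ℝ R3 + A)).2
  simp only [h2] at h3
  rw [integral_balance i1 (i2 b) i3 (i2 c), (hh.integral_inner_gradP ht r b).2,
    (hh.integral_inner_gradP ht r c).2, add_apply, ContinuousLinearMap.id_apply] at h3
  rw [sub_eq_iff_eq_add] at h3
  rw [h3]
  module

end Model

/-! ### Expansions to second order in `ε` -/

section expansions

variable {E F G : Type*} [NormedAddCommGroup E] [NormedSpace ℝ E] [NormedAddCommGroup F]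
  [NormedSpace ℝ F] [NormedAddCommGroup G] [NormedSpace ℝ G]

/-- `u ε = a + ε b + ε² c + O(ε³)` as `ε → 0+`. Second order suffices for the moments that enter the
argument. -/
def HasExp (u : ℝ → E) (a b c : E) : Prop :=
  (fun ε => u ε - (a + ε • b + ε ^ 2 • c)) =O[𝓝[>] 0] fun ε : ℝ => ε ^ 3

namespace HasExp

variable {u v : ℝ → E} {a b c a' b' c' : E}

lemma const (x : E) : HasExp (fun _ => x) x 0 0 := by
  simpa [HasExp] using isBigO_zero _ _

lemma add (hu : HasExp u a b c) (hv : HasExp v a' b' c') :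
    HasExp (fun ε => u ε + v ε) (a + a') (b + b') (c + c') := by
  refine (IsBigO.add hu hv).congr_left fun ε => ?_
  module

lemma clm (hu : HasExp u a b c) (L : E →L[ℝ] F) :
    HasExp (fun ε => L (u ε)) (L a) (L b) (L c) := by
  refine ((L.isBigO_comp _ _).trans hu).congr_left fun ε => ?_
  simp

lemma neg (hu : HasExp u a b c) : HasExp (fun ε => -u ε) (-a) (-b) (-c) := by
  refine hu.neg_left.congr_left fun ε => ?_
  module

lemma sub (hu : HasExp u a b c) (hv : HasExp v a' b' c') :
    HasExp (fun ε => u ε - v ε) (a - a') (b - b') (c - c') := by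
  simpa only [sub_eq_add_neg] using hu.add hv.neg

lemma isBigO_pow {m n : ℕ} (hmn : n ≤ m) :
    (fun ε : ℝ => ε ^ m) =O[𝓝[>] 0] fun ε : ℝ => ε ^ n := by
  refine IsBigO.of_bound 1 ?_
  filter_upwards [Ioo_mem_nhdsGT (zero_lt_one' ℝ)] with ε hε
  rw [norm_pow, norm_pow, one_mul, Real.norm_eq_abs, abs_of_pos hε.1]
  exact pow_le_pow_of_le_one hε.1.le hε.2.le hmn

lemma eps_smul (hu : HasExp u a b c) : HasExp (fun ε => ε • u ε) 0 a b := by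
  have h1 : (fun ε : ℝ => ε • (u ε - (a + ε • b + ε ^ 2 • c))) =O[𝓝[>] 0] fun ε : ℝ => ε ^ 3 := by
    have := (isBigO_refl (fun ε : ℝ => ε) (𝓝[>] 0)).smul hu
    refine this.trans ?_
    simpa [smul_eq_mul, ← pow_succ'] using isBigO_pow (show 3 ≤ 4 by norm_num)
  have h2 : (fun ε : ℝ => ε ^ 3 • c) =O[𝓝[>] 0] fun ε : ℝ => ε ^ 3 := by
    have h4 : (fun _ : ℝ => c) =O[𝓝[>] 0] fun _ : ℝ => (1 : ℝ) := tendsto_const_nhds.isBigO_one ℝ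
    simpa using (isBigO_refl (fun ε : ℝ => ε ^ 3) (𝓝[>] 0)).smul h4
  refine (h1.add h2).congr_left fun ε => ?_
  module

lemma isBigO_one (hu : HasExp u a b c) : u =O[𝓝[>] 0] fun _ : ℝ => (1 : ℝ) := by
  have h1 : (fun ε : ℝ => a + ε • b + ε ^ 2 • c) =O[𝓝[>] 0] fun _ : ℝ => (1 : ℝ) := by
    have hc : Continuous fun ε : ℝ => a + ε • b + ε ^ 2 • c := by fun_prop
    exact ((hc.tendsto 0).mono_left nhdsWithin_le_nhds).isBigO_one ℝ
  have h2 := (IsBigO.trans hu (isBigO_pow (Nat.zero_le 3))).add (h1.congr_right (by simp))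
  refine (h2.congr_right (by simp)).congr_left fun ε => ?_
  abel

lemma bilin {w : ℝ → F} {x y z : F} (hu : HasExp u a b c) (hw : HasExp w x y z)
    (L : E →L[ℝ] F →L[ℝ] G) :
    HasExp (fun ε => L (u ε) (w ε)) (L a x) (L a y + L b x) (L a z + L b y + L c x) := by
  have hbil : ∀ (p : ℝ → E) (q : ℝ → F), (fun ε => L (p ε) (q ε)) =O[𝓝[>] 0]
      fun ε => ‖p ε‖ * ‖q ε‖ := fun p q => by
    refine IsBigO.of_bound ‖L‖ (Eventually.of_forall fun ε => ?_)
    rw [norm_mul, norm_norm, norm_norm, ← mul_assoc]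
    exact L.le_opNorm₂ _ _
  set P : ℝ → E := fun ε => a + ε • b + ε ^ 2 • c
  set Q : ℝ → F := fun ε => x + ε • y + ε ^ 2 • z
  have hP : P =O[𝓝[>] 0] fun _ : ℝ => (1 : ℝ) := by
    have hc : Continuous P := by fun_prop
    exact ((hc.tendsto 0).mono_left nhdsWithin_le_nhds).isBigO_one ℝ
  have h1 : (fun ε => L (u ε - P ε) (w ε)) =O[𝓝[>] 0] fun ε : ℝ => ε ^ 3 := by
    refine (hbil _ _).trans ?_
    simpa using IsBigO.mul (IsBigO.norm_left hu) hw.isBigO_one.norm_left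
  have h2 : (fun ε => L (P ε) (w ε - Q ε)) =O[𝓝[>] 0] fun ε : ℝ => ε ^ 3 := by
    refine (hbil _ _).trans ?_
    simpa using IsBigO.mul hP.norm_left (IsBigO.norm_left hw)
  have h3 : (fun ε : ℝ => ε ^ 3 • (L b z + L c y + ε • L c z)) =O[𝓝[>] 0] fun ε : ℝ => ε ^ 3 := by
    have hc : Continuous fun ε : ℝ => L b z + L c y + ε • L c z := by fun_prop
    have h4 := ((hc.tendsto 0).mono_left (nhdsWithin_le_nhds (s := Ioi 0))).isBigO_one ℝ
    simpa using (isBigO_refl (fun ε : ℝ => ε ^ 3) (𝓝[>] 0)).smul h4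
  refine ((h1.add h2).add h3).congr_left fun ε => ?_
  simp only [P, Q, map_sub, map_add, map_smul, sub_apply, add_apply, smul_apply]
  module

lemma tendsto (hu : HasExp u a b c) : Tendsto u (𝓝[>] 0) (𝓝 a) := by
  have h1 : Tendsto (fun ε : ℝ => ε ^ 3) (𝓝[>] 0) (𝓝 0) := by
    have hc : Continuous fun ε : ℝ => ε ^ 3 := by fun_prop
    simpa using (hc.tendsto 0).mono_left (nhdsWithin_le_nhds (s := Ioi 0))
  have h2 : Tendsto (fun ε : ℝ => a + ε • b + ε ^ 2 • c) (𝓝[>] 0) (𝓝 a) := by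
    have hc : Continuous fun ε : ℝ => a + ε • b + ε ^ 2 • c := by fun_prop
    simpa using (hc.tendsto 0).mono_left (nhdsWithin_le_nhds (s := Ioi 0))
  simpa using (IsBigO.trans_tendsto hu h1).add h2

lemma coeff_eq_zero (hu : HasExp u a b c) (h0 : u =ᶠ[𝓝[>] 0] 0) : a = 0 ∧ b = 0 ∧ c = 0 := by
  have hP : (fun ε : ℝ => a + ε • b + ε ^ 2 • c) =O[𝓝[>] 0] fun ε : ℝ => ε ^ 3 := by
    refine (IsBigO.neg_left hu).congr' ?_ EventuallyEq.rfl
    filter_upwards [h0] with ε hε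
    rw [hε]; simp
  have key : ∀ (n : ℕ) (q : ℝ → E), Continuous q → n < 3 →
      (fun ε : ℝ => ε ^ n • q ε) =O[𝓝[>] 0] (fun ε : ℝ => ε ^ 3) → q 0 = 0 := by
    intro n q hq hn hO
    have h1 : (fun ε : ℝ => (ε ^ n)⁻¹ • (ε ^ n • q ε)) =O[𝓝[>] 0]
        fun ε : ℝ => (ε ^ n)⁻¹ • ε ^ 3 := (isBigO_refl _ _).smul hO
    have h2 : q =O[𝓝[>] 0] fun ε : ℝ => ε ^ (3 - n) := by
      refine h1.congr' ?_ ?_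
      · filter_upwards [self_mem_nhdsWithin] with ε hε
        have : ε ^ n ≠ 0 := pow_ne_zero _ (ne_of_gt hε)
        rw [smul_smul, inv_mul_cancel₀ this, one_smul]
      · filter_upwards [self_mem_nhdsWithin] with ε hε
        have : ε ^ n ≠ 0 := pow_ne_zero _ (ne_of_gt hε)
        rw [smul_eq_mul, inv_mul_eq_div, div_eq_iff this, ← pow_add]
        congr 1; omega
    have h3 : Tendsto (fun ε : ℝ => ε ^ (3 - n)) (𝓝[>] 0) (𝓝 0) := by
      have hc : Continuous fun ε : ℝ => ε ^ (3 - n) := by fun_prop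
      have := (hc.tendsto 0).mono_left (nhdsWithin_le_nhds (s := Ioi 0))
      rwa [zero_pow (by omega)] at this
    exact tendsto_nhds_unique ((hq.tendsto 0).mono_left nhdsWithin_le_nhds) (h2.trans_tendsto h3)
  have ha : a = 0 := by
    have := key 0 (fun ε => a + ε • b + ε ^ 2 • c) (by fun_prop) (by norm_num) (by simpa using hP)
    simpa using this
  subst ha
  have hb : b = 0 := by
    have := key 1 (fun ε => b + ε • c) (by fun_prop) (by norm_num)
      (hP.congr_left fun ε => by module)
    simpa using this
  subst hb
  refine ⟨rfl, rfl, ?_⟩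
  have := key 2 (fun _ => c) (by fun_prop) (by norm_num) (hP.congr_left fun ε => by module)
  simpa using this

lemma unique (hu : HasExp u a b c) (hv : HasExp v a' b' c') (huv : u =ᶠ[𝓝[>] 0] v) :
    a = a' ∧ b = b' ∧ c = c' := by
  have := (hu.sub hv).coeff_eq_zero (by filter_upwards [huv] with ε hε; simp [hε])
  exact ⟨sub_eq_zero.1 this.1, sub_eq_zero.1 this.2.1, sub_eq_zero.1 this.2.2⟩

end HasExp

/-- Bounded linear functionals of the distribution inherit its expansion. -/
lemma IsFunctional.hasExp {T ε₀ : ℝ} (hε₀ : 0 < ε₀) {F' : ℝ → PhaseFun} {f : ℕ → PhaseFun}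
    (hreg : ∀ ε ∈ Ioo 0 ε₀, IsRegular T (F' ε)) (hexp : HasHilbertExpansion T ε₀ F' f)
    {t : ℝ} (ht : t ∈ Ioc 0 T) {Λ : PhaseFun → E} (hΛ : IsFunctional T t Λ) :
    HasExp (fun ε => Λ (F' ε)) (Λ (f 0)) (Λ (f 1)) (Λ (f 2)) := by
  obtain ⟨B, hB⟩ := hexp.outer t ht
  obtain ⟨C, hC0, hC⟩ := hΛ.bound
  have h0 := hexp.regular 0 (by norm_num)
  have h1 := hexp.regular 1 (by norm_num)
  have h2 := hexp.regular 2 (by norm_num)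
  have h3 := hexp.regular 3 (by norm_num)
  have hev : ∀ᶠ ε in 𝓝[>] (0 : ℝ), ‖Λ (F' ε) - (Λ (f 0) + ε • Λ (f 1) + ε ^ 2 • Λ (f 2))
      - ε ^ 3 • Λ (f 3)‖ ≤ C * (B * ε ^ 4) := by
    filter_upwards [Ioo_mem_nhdsGT hε₀] with ε hε
    set R : PhaseFun := F' ε + (-1 : ℝ) • (f 0 + ε • f 1 + ε ^ 2 • f 2 + ε ^ 3 • f 3) with hR
    have hsum : IsRegular T (f 0 + ε • f 1 + ε ^ 2 • f 2 + ε ^ 3 • f 3) :=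
      ((h0.add (h1.smul ε)).add (h2.smul _)).add (h3.smul _)
    have hRr : IsRegular T R := (hreg ε hε).add (hsum.smul _)
    have hRe : (fun t r p => F' ε t r p - ∑ n ∈ Finset.range 4, ε ^ n * f n t r p) = R := by
      funext t r p
      simp [hR, Finset.sum_range_succ]
      ring
    have h4 := hB ε hε
    rw [hRe] at h4
    have h5 := hC R hRr _ h4
    have h6 : Λ R = Λ (F' ε) - (Λ (f 0) + ε • Λ (f 1) + ε ^ 2 • Λ (f 2)) - ε ^ 3 • Λ (f 3) := by
      rw [hR, hΛ.add _ _ (hreg ε hε) (hsum.smul _), hΛ.smul _ _ hsum,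
        hΛ.add _ _ ((h0.add (h1.smul ε)).add (h2.smul _)) (h3.smul _),
        hΛ.add _ _ (h0.add (h1.smul ε)) (h2.smul _), hΛ.add _ _ h0 (h1.smul ε),
        hΛ.smul _ _ h1, hΛ.smul _ _ h2, hΛ.smul _ _ h3]
      module
    rwa [h6] at h5
  refine IsBigO.of_bound (C * |B| + ‖Λ (f 3)‖) ?_
  filter_upwards [hev, Ioo_mem_nhdsGT (zero_lt_one' ℝ)] with ε h7 h8
  have h9 := norm_le_norm_add_norm_sub' (Λ (F' ε) - (Λ (f 0) + ε • Λ (f 1) + ε ^ 2 • Λ (f 2)))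
    (ε ^ 3 • Λ (f 3))
  have h10 : ‖ε ^ 3‖ = ε ^ 3 := by rw [Real.norm_eq_abs, abs_of_pos (pow_pos h8.1 3)]
  rw [norm_smul, h10] at h9
  have h11 : C * (B * ε ^ 4) ≤ C * (|B| * ε ^ 3) := by
    refine mul_le_mul_of_nonneg_left ?_ hC0
    exact mul_le_mul (le_abs_self B) (pow_le_pow_of_le_one h8.1.le h8.2.le (by norm_num))
      (pow_nonneg h8.1.le 4) (abs_nonneg B)
  rw [h10, add_mul]
  nlinarith [norm_nonneg (Λ (f 3))]

lemma IsFunctional.comp_clm {T t : ℝ} {Λ : PhaseFun → E} (hΛ : IsFunctional T t Λ)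
    (L : E →L[ℝ] F) : IsFunctional T t fun h => L (Λ h) where
  add h k hh hk := by rw [hΛ.add h k hh hk, map_add]
  smul c h hh := by rw [hΛ.smul c h hh, map_smul]
  bound := by
    obtain ⟨C, hC0, hC⟩ := hΛ.bound
    refine ⟨‖L‖ * C, by positivity, fun h hh B hB => (L.le_opNorm _).trans ?_⟩
    rw [mul_assoc]
    gcongr
    exact hC h hh B hB

lemma IsFunctional.sum {T t : ℝ} {Λ Λ' : PhaseFun → E} (hΛ : IsFunctional T t Λ)
    (hΛ' : IsFunctional T t Λ') : IsFunctional T t fun h => Λ h + Λ' h where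
  add h k hh hk := by rw [hΛ.add h k hh hk, hΛ'.add h k hh hk]; abel
  smul c h hh := by rw [hΛ.smul c h hh, hΛ'.smul c h hh, smul_add]
  bound := by
    obtain ⟨C, hC0, hC⟩ := hΛ.bound
    obtain ⟨D, hD0, hD⟩ := hΛ'.bound
    refine ⟨C + D, by positivity, fun h hh B hB => (norm_add_le _ _).trans ?_⟩
    rw [add_mul]
    exact add_le_add (hC h hh B hB) (hD h hh B hB)

lemma isFunctional_derivOuP {T t : ℝ} (ht : t ∈ Icc 0 T) (r p : R3) :
    IsFunctional T t fun h => derivOuP h t r p :=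
  (((isLocalOp_val.functional ht r p).comp_clm
    ((ContinuousLinearMap.id ℝ ℝ).smulRight (ContinuousLinearMap.id ℝ R3))).sum
    ((isLocalOp_gradP.functional ht r p).comp_clm (tensorP p))).sum
    (isLocalOp_hessP.functional ht r p)

end expansions

namespace Model

variable {S : Model} {T t : ℝ} {h : PhaseFun}

lemma meanZ₁_eq_kernel (ρ : R3 → ℝ) (r : R3) :
    S.meanZ₁ ρ r = ∫ r', ContinuousLinearMap.lsmul ℝ ℝ (ρ r') (S.g r r' • S.Z₁ r r') := by
  unfold meanZ₁; congr 1; funext r'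
  rw [ContinuousLinearMap.lsmul_apply, smul_smul, mul_comm]

lemma meanForce_eq_kernel (ρ : R3 → ℝ) (r : R3) :
    S.meanForce ρ r = ∫ r', ContinuousLinearMap.lsmul ℝ ℝ (ρ r') (S.g r r' • S.gradV₂ r r') := by
  unfold meanForce; congr 1; funext r'
  rw [ContinuousLinearMap.lsmul_apply, smul_smul]

lemma meanZ₂_eq_kernel (j : R3 → R3) (r : R3) :
    S.meanZ₂ j r = ∫ r', (ContinuousLinearMap.id ℝ (R3 →L[ℝ] R3)).flip (j r')
      (S.g r r' • S.Z₂ r r') := rfl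

lemma isFunctional_meanZ₁ (hS : S.Admissible T) (ht : t ∈ Icc 0 T) (r : R3) :
    IsFunctional T t fun h => S.meanZ₁ (density h t) r := by
  obtain ⟨K, _, hK⟩ := exists_kernel_bound hS
  simp only [meanZ₁_eq_kernel]
  exact isField_density.functional_kernel _ (measurable_kernel_Z₁ hS r) (fun r' => (hK r r').1) ht

lemma isFunctional_meanForce (hS : S.Admissible T) (ht : t ∈ Icc 0 T) (r : R3) :
    IsFunctional T t fun h => S.meanForce (density h t) r := by
  obtain ⟨K, _, hK⟩ := exists_kernel_bound hS
  simp only [meanForce_eq_kernel]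
  exact isField_density.functional_kernel _ (measurable_kernel_force hS r)
    (fun r' => (hK r r').2.2) ht

lemma isFunctional_meanZ₂ (hS : S.Admissible T) (ht : t ∈ Icc 0 T) (r : R3) :
    IsFunctional T t fun h => S.meanZ₂ (flux h t) r := by
  obtain ⟨K, _, hK⟩ := exists_kernel_bound hS
  simp only [meanZ₂_eq_kernel]
  exact isField_flux.functional_kernel _ (measurable_kernel_Z₂ hS r) (fun r' => (hK r r').2.1) ht

lemma continuousOn_meanZ₁ (hS : S.Admissible T) (hh : IsRegular T h) (r : R3) :
    ContinuousOn (fun t => S.meanZ₁ (density h t) r) (Icc 0 T) := by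
  obtain ⟨K, _, hK⟩ := exists_kernel_bound hS
  simp only [meanZ₁_eq_kernel]
  exact isField_density.continuousOn_kernel _ (measurable_kernel_Z₁ hS r) (fun r' => (hK r r').1) hh

lemma continuousOn_meanForce (hS : S.Admissible T) (hh : IsRegular T h) (r : R3) :
    ContinuousOn (fun t => S.meanForce (density h t) r) (Icc 0 T) := by
  obtain ⟨K, _, hK⟩ := exists_kernel_bound hS
  simp only [meanForce_eq_kernel]
  exact isField_density.continuousOn_kernel _ (measurable_kernel_force hS r)
    (fun r' => (hK r r').2.2) hh

lemma continuousOn_meanZ₂ (hS : S.Admissible T) (hh : IsRegular T h) (r : R3) :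
    ContinuousOn (fun t => S.meanZ₂ (flux h t) r) (Icc 0 T) := by
  obtain ⟨K, _, hK⟩ := exists_kernel_bound hS
  simp only [meanZ₂_eq_kernel]
  exact isField_flux.continuousOn_kernel _ (measurable_kernel_Z₂ hS r) (fun r' => (hK r r').2.1) hh

end Model

/-! ### The hierarchy of moment equations -/

/-- A family `F ε` of positive regular solutions of the kinetic equation, closed by the Enskog
relation, with a Hilbert expansion whose coefficients are the `f n`. -/
structure IsExpandedSolution (S : Model) (T ε₀ : ℝ) (F : ℝ → PhaseFun) (f : ℕ → PhaseFun) :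
    Prop where
  eps_pos : 0 < ε₀
  admissible : S.Admissible T
  regular : ∀ ε ∈ Ioo 0 ε₀, IsRegular T (F ε)
  pos : ∀ ε ∈ Ioo 0 ε₀, ∀ t ∈ Icc 0 T, ∀ r p, 0 < F ε t r p
  kinetic : ∀ ε ∈ Ioo 0 ε₀, S.IsKineticSolution T ε (F ε)
  enskog : ∀ ε ∈ Ioo 0 ε₀, ∀ t ∈ Icc 0 T, ∃ FN, S.IsEnskog (F ε t) FN
  expansion : HasHilbertExpansion T ε₀ F f
  initial : ∀ ε ∈ Ioo 0 ε₀, ∀ r p, F ε 0 r p = f 0 0 r p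

namespace IsExpandedSolution

variable {S : Model} {T ε₀ : ℝ} {F : ℝ → PhaseFun} {f : ℕ → PhaseFun} {t : ℝ}

lemma regular_coeff (H : IsExpandedSolution S T ε₀ F f) {n : ℕ} (hn : n ≤ 3) : IsRegular T (f n) :=
  H.expansion.regular n hn

lemma hasExp {E : Type*} [NormedAddCommGroup E] [NormedSpace ℝ E] {Λ : PhaseFun → E}
    (H : IsExpandedSolution S T ε₀ F f) (ht : t ∈ Ioc 0 T) (hΛ : IsFunctional T t Λ) :
    HasExp (fun ε => Λ (F ε)) (Λ (f 0)) (Λ (f 1)) (Λ (f 2)) :=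
  hΛ.hasExp H.eps_pos H.regular H.expansion ht

/-- The momentum balance at the orders `1, ε, ε²`. -/
lemma momentum_orders (H : IsExpandedSolution S T ε₀ F f) (ht : t ∈ Ioc 0 T) (r : R3) :
    (flux (f 0) t r + S.meanZ₁ (density (f 0) t) r (flux (f 0) t r)
      + density (f 0) t r • S.meanZ₂ (flux (f 0) t) r = 0) ∧
    ((∫ p, inner ℝ p (gradR (f 0) t r p) • p)
      + density (f 0) t r • S.totalForce t (density (f 0) t) r
      + (flux (f 1) t r + (S.meanZ₁ (density (f 0) t) r (flux (f 1) t r)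
        + S.meanZ₁ (density (f 1) t) r (flux (f 0) t r))
      + (density (f 0) t r • S.meanZ₂ (flux (f 1) t) r
        + density (f 1) t r • S.meanZ₂ (flux (f 0) t) r)) = 0) ∧
    (∫ p, dt T (f 0) t r p • p) + ((∫ p, inner ℝ p (gradR (f 1) t r p) • p)
      + (density (f 0) t r • S.meanForce (density (f 1) t) r
        + density (f 1) t r • S.totalForce t (density (f 0) t) r))
      + (flux (f 2) t r + (S.meanZ₁ (density (f 0) t) r (flux (f 2) t r)
        + S.meanZ₁ (density (f 1) t) r (flux (f 1) t r)
        + S.meanZ₁ (density (f 2) t) r (flux (f 0) t r))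
      + (density (f 0) t r • S.meanZ₂ (flux (f 2) t) r
        + density (f 1) t r • S.meanZ₂ (flux (f 1) t) r
        + density (f 2) t r • S.meanZ₂ (flux (f 0) t) r)) = 0 := by
  have ht' : t ∈ Icc 0 T := ⟨ht.1.le, ht.2⟩
  have hJt := H.hasExp ht ((isField_integral_smul (T := T) isLocalOp_dt).functional ht' r)
  have hQ := H.hasExp ht ((isField_integral_inner_smul (T := T) isLocalOp_gradR).functional ht' r)
  have hd := H.hasExp ht ((isField_density (T := T)).functional ht' r)
  have hJ := H.hasExp ht ((isField_flux (T := T)).functional ht' r)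
  have hZ1 := H.hasExp ht (Model.isFunctional_meanZ₁ H.admissible ht' r)
  have hZ2 := H.hasExp ht (Model.isFunctional_meanZ₂ H.admissible ht' r)
  have hf := (HasExp.const (gradient (S.V₁ t) r)).add
    (H.hasExp ht (Model.isFunctional_meanForce H.admissible ht' r))
  have hlhs := hJt.eps_smul.eps_smul
  have hrhs := ((hQ.add (hd.bilin hf (ContinuousLinearMap.lsmul ℝ ℝ))).eps_smul.neg).sub
    ((hJ.add (hZ1.bilin hJ (ContinuousLinearMap.id ℝ (R3 →L[ℝ] R3)))).add
      (hd.bilin hZ2 (ContinuousLinearMap.lsmul ℝ ℝ)))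
  have h := hlhs.unique hrhs (by
    filter_upwards [Ioo_mem_nhdsGT H.eps_pos] with ε hε
    exact Model.momentum_equation H.admissible hε.1 (H.regular ε hε) (H.kinetic ε hε) ht' r)
  have hsum : ∀ a b c : R3, a = -b - c → a + b + c = 0 := fun a b c h => by rw [h]; abel
  obtain ⟨h0, h1, h2⟩ := h
  refine ⟨?_, ?_, ?_⟩
  · rw [neg_zero, zero_sub] at h0
    exact neg_eq_zero.1 h0.symm
  · have h3 := hsum _ _ _ h1
    rw [zero_add] at h3
    exact h3
  · rw [zero_add] at h2
    exact hsum _ _ _ h2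

/-- The conservation of mass at the orders `ε, ε²`. -/
lemma mass_orders (H : IsExpandedSolution S T ε₀ F f) (ht : t ∈ Ioc 0 T) (r : R3) :
    ∫ p, dt T (f 0) t r p = -∫ p, inner ℝ p (gradR (f 1) t r p) ∧
    ∫ p, dt T (f 1) t r p = -∫ p, inner ℝ p (gradR (f 2) t r p) := by
  have ht' : t ∈ Icc 0 T := ⟨ht.1.le, ht.2⟩
  have h1 := H.hasExp ht ((isField_integral (T := T) isLocalOp_dt).functional ht' r)
  have h2 := H.hasExp ht ((isField_integral_inner (T := T) isLocalOp_gradR).functional ht' r)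
  exact (h1.eps_smul.unique h2.neg (by
    filter_upwards [Ioo_mem_nhdsGT H.eps_pos] with ε hε
    exact Model.mass_equation H.admissible hε.1 (H.regular ε hε) (H.kinetic ε hε) ht' r)).2

/-- The kinetic equation at the orders `1, ε`. -/
lemma kinetic_orders (H : IsExpandedSolution S T ε₀ F f) (ht : t ∈ Ioc 0 T) (r p : R3) :
    (trace3 (derivOuP (f 0) t r p)
      + trace3 (S.meanZ₁ (density (f 0) t) r ∘L derivOuP (f 0) t r p)
      + inner ℝ (S.meanZ₂ (flux (f 0) t) r) (gradP (f 0) t r p) = 0) ∧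
    (inner ℝ (S.totalForce t (density (f 0) t) r) (gradP (f 0) t r p)
      - inner ℝ p (gradR (f 0) t r p)
      + (trace3 (derivOuP (f 1) t r p)
        + (trace3 (S.meanZ₁ (density (f 0) t) r ∘L derivOuP (f 1) t r p)
          + trace3 (S.meanZ₁ (density (f 1) t) r ∘L derivOuP (f 0) t r p))
        + (inner ℝ (S.meanZ₂ (flux (f 0) t) r) (gradP (f 1) t r p)
          + inner ℝ (S.meanZ₂ (flux (f 1) t) r) (gradP (f 0) t r p))) = 0) := by
  have ht' : t ∈ Icc 0 T := ⟨ht.1.le, ht.2⟩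
  have hdt := H.hasExp ht (isLocalOp_dt.functional ht' r p)
  have hgR := H.hasExp ht (isLocalOp_gradR.functional ht' r p)
  have hgP := H.hasExp ht (isLocalOp_gradP.functional ht' r p)
  have hD := H.hasExp ht (isFunctional_derivOuP ht' r p)
  have hZ1 := H.hasExp ht (Model.isFunctional_meanZ₁ H.admissible ht' r)
  have hZ2 := H.hasExp ht (Model.isFunctional_meanZ₂ H.admissible ht' r)
  have hf := (HasExp.const (gradient (S.V₁ t) r)).add
    (H.hasExp ht (Model.isFunctional_meanForce H.admissible ht' r))
  have hlhs := hdt.eps_smul.eps_smul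
  have hrhs := (((hf.bilin hgP (innerSL ℝ)).sub (hgR.clm (innerSL ℝ p))).eps_smul).add
    (((hD.clm trace3).add (hZ1.bilin hD
      ((ContinuousLinearMap.compL ℝ (R3 →L[ℝ] R3) (R3 →L[ℝ] R3) ℝ trace3) ∘L
        ContinuousLinearMap.compL ℝ R3 R3 R3))).add (hZ2.bilin hgP (innerSL ℝ)))
  have h := hlhs.unique hrhs (by
    filter_upwards [Ioo_mem_nhdsGT H.eps_pos] with ε hε
    exact Model.kinetic_pointwise H.admissible hε.1 (H.regular ε hε) (H.kinetic ε hε) ht' r p)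
  obtain ⟨h0, h1, -⟩ := h
  refine ⟨?_, ?_⟩
  · rw [zero_add] at h0
    exact h0.symm
  · exact h1.symm

/-- At a fixed positive time, outside the initial layer, the densities decay uniformly in `ε`. -/
lemma exists_density_bound (H : IsExpandedSolution S T ε₀ F f) (ht : t ∈ Ioc 0 T) :
    ∃ B, ∀ ε ∈ Ioo 0 ε₀, ∀ r, ‖density (F ε) t r‖ ≤ B * decay4 r := by
  have ht' : t ∈ Icc 0 T := ⟨ht.1.le, ht.2⟩
  obtain ⟨B, hB⟩ := H.expansion.outer t ht
  obtain ⟨C, hC0, hC⟩ := (isField_density (T := T)).bound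
  choose! D hD0 hD using fun n (hn : n ≤ 3) =>
    (isField_density (T := T)).exists_bound (H.regular_coeff hn)
  refine ⟨C * (|B| * ε₀ ^ 4) + ∑ n ∈ Finset.range 4, ε₀ ^ n * D n, fun ε hε r => ?_⟩
  have hr := (decay4_pos r).le
  have hsum : ∀ N ≤ 4, IsRegular T (∑ n ∈ Finset.range N, ε ^ n • f n) ∧
      density (∑ n ∈ Finset.range N, ε ^ n • f n) t r =
        ∑ n ∈ Finset.range N, ε ^ n * density (f n) t r := by
    intro N
    induction N with
    | zero =>
      intro _
      have h0 := (H.regular_coeff (n := 0) (by norm_num)).smul 0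
      rw [zero_smul] at h0
      simp [h0, density]
    | succ N ih =>
      intro hN
      obtain ⟨h1, h2⟩ := ih (by omega)
      have h3 := H.regular_coeff (n := N) (by omega)
      simp only [Finset.sum_range_succ]
      refine ⟨h1.add (h3.smul _), ?_⟩
      rw [isField_density.add _ _ h1 (h3.smul _) t ht', isField_density.smul _ _ h3 t ht', h2]
      rfl
  obtain ⟨hP, hPd⟩ := hsum 4 le_rfl
  set P := ∑ n ∈ Finset.range 4, ε ^ n • f n with hPdef
  set R : PhaseFun := F ε + (-1 : ℝ) • P with hRdef
  have hR : IsRegular T R := (H.regular ε hε).add (hP.smul _)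
  have hRe : (fun t r p => F ε t r p - ∑ n ∈ Finset.range 4, ε ^ n * f n t r p) = R := by
    funext t r p
    simp [hRdef, hPdef, Finset.sum_range_succ]
    ring
  have h4 := hB ε hε
  rw [hRe] at h4
  have h5 := hC R hR t ht' _ h4 r
  rw [hRdef, isField_density.add _ _ (H.regular ε hε) (hP.smul _) t ht',
    isField_density.smul _ _ hP t ht', hPd] at h5
  have h6 : density (F ε) t r = (density (F ε) t r + (-1 : ℝ) •
      ∑ n ∈ Finset.range 4, ε ^ n * density (f n) t r)
      + ∑ n ∈ Finset.range 4, ε ^ n * density (f n) t r := by simp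
  rw [h6, add_mul]
  refine (norm_add_le _ _).trans (add_le_add (h5.trans ?_) ?_)
  · gcongr
    exacts [le_abs_self B, hε.1.le, hε.2.le]
  · rw [Finset.sum_mul]
    refine norm_sum_le_of_le _ fun n hn => ?_
    have hn3 : n ≤ 3 := by rw [Finset.mem_range] at hn; omega
    have h7 := hD n hn3 t ht' r
    rw [norm_mul, norm_pow, Real.norm_eq_abs, abs_of_pos hε.1, mul_assoc]
    have := hε.1.le
    have := hε.2.le
    have := H.eps_pos.le
    gcongr

lemma density_pos (H : IsExpandedSolution S T ε₀ F f) {ε : ℝ} (hε : ε ∈ Ioo 0 ε₀)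
    (ht : t ∈ Icc 0 T) (r : R3) : 0 < density (F ε) t r := by
  have h1 := H.pos ε hε t ht r
  refine (integral_pos_iff_support_of_nonneg (fun p => (h1 p).le)
    ((H.regular ε hε).integrable_val ht r)).2 ?_
  have : Function.support (fun p => F ε t r p) = univ := by
    ext p; simpa using (h1 p).ne'
  rw [this]; simp

lemma density_initial (H : IsExpandedSolution S T ε₀ F f) {ε : ℝ} (hε : ε ∈ Ioo 0 ε₀) :
    density (F ε) 0 = density (f 0) 0 := by
  funext r; unfold density; simp only [H.initial ε hε]

/-- The leading-order density is non-negative and inherits the positivity of the friction. -/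
lemma leading_density (H : IsExpandedSolution S T ε₀ F f) : ∃ δ > 0, ∀ t ∈ Icc 0 T,
    (∀ r, 0 ≤ density (f 0) t r) ∧ S.FrictionPositive δ (density (f 0) t) := by
  obtain ⟨δ, hδ, hpos⟩ := H.admissible.friction_pos
  refine ⟨δ, hδ, fun t ht => ?_⟩
  have hF : ∀ ε ∈ Ioo 0 ε₀, S.FrictionPositive δ (density (F ε) t) := fun ε hε => by
    obtain ⟨FN, hFN⟩ := H.enskog ε hε t ht
    exact hFN.frictionPositive H.admissible hpos ((H.regular ε hε).isDecaying ht)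
      fun r => H.density_pos hε ht r
  have hseq : ∀ n : ℕ, ε₀ / (n + 2) ∈ Ioo 0 ε₀ := fun n => by
    have := H.eps_pos
    refine ⟨by positivity, div_lt_self this (by linarith [Nat.cast_nonneg (α := ℝ) n])⟩
  rcases ht.1.eq_or_lt with h0 | h0
  · subst h0
    rw [← H.density_initial (hseq 0)]
    exact ⟨fun r => (H.density_pos (hseq 0) ht r).le, hF _ (hseq 0)⟩
  · have ht' : t ∈ Ioc 0 T := ⟨h0, ht.2⟩
    obtain ⟨B, hB⟩ := H.exists_density_bound ht'
    have hlim0 : Tendsto (fun n : ℕ => ε₀ / (n + 2)) atTop (𝓝[>] 0) := by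
      refine tendsto_nhdsWithin_iff.2 ⟨?_, Eventually.of_forall fun n => (hseq n).1⟩
      exact tendsto_const_nhds.div_atTop
        (tendsto_atTop_add_const_right _ _ tendsto_natCast_atTop_atTop)
    have hlim : ∀ r, Tendsto (fun n : ℕ => density (F (ε₀ / (n + 2))) t r) atTop
        (𝓝 (density (f 0) t r)) := fun r =>
      (H.hasExp ht' ((isField_density (T := T)).functional ht r)).tendsto.comp hlim0
    refine ⟨fun r => ge_of_tendsto' (hlim r) fun n => (H.density_pos (hseq n) ht r).le, ?_⟩
    exact Model.FrictionPositive.of_tendsto H.admissible (fun n r => hB _ (hseq n) r)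
      (fun n => (isField_density.integrable (H.regular _ (hseq n)) ht).aestronglyMeasurable)
      hlim fun n => hF _ (hseq n)

end IsExpandedSolution

/-! ### Local equilibria -/

section localEquilibrium

variable {T : ℝ} {h : PhaseFun} {t : ℝ}

lemma integrable_maxwellian_inner (a : R3) : Integrable fun p => maxwellian p * inner ℝ p a := by
  refine integrable_maxwellian_smul (u := fun p => (inner ℝ p a : ℝ)) (by fun_prop) (C := ‖a‖)
    (n := 1) fun p => ?_
  refine (norm_inner_le_norm p a).trans ?_
  nlinarith [norm_nonneg p, norm_nonneg a]

lemma integral_maxwellian_inner (a : R3) : ∫ p, maxwellian p * inner ℝ p a = 0 :=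
  integral_eq_zero_of_odd fun p => by rw [maxwellian_neg, inner_neg_left]; ring

lemma hasFDerivAt_maxwellian_inner (a p : R3) :
    HasFDerivAt (fun q => maxwellian q * inner ℝ q a)
      (innerSL ℝ (maxwellian p • a - (maxwellian p * inner ℝ p a) • p)) p := by
  have h1 : HasFDerivAt (fun q : R3 => (inner ℝ q a : ℝ)) (innerSL ℝ a) p := by
    have := (innerSL ℝ a).hasFDerivAt (x := p)
    refine this.congr_of_eventuallyEq (Eventually.of_forall fun q => ?_)
    simp [real_inner_comm]
  refine ((hasFDerivAt_maxwellian p).mul h1).congr_fderiv ?_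
  ext v
  simp
  ring

/-- A solution of `∇ₚ · (1 + B) (p + ∇ₚ) h = -M p · (1 + B) a` with a positive `1 + B` is a local
equilibrium with the flux `a`. -/
lemma IsRegular.eq_localEquilibrium (hh : IsRegular T h) (ht : t ∈ Icc 0 T) {r : R3}
    {B : R3 →L[ℝ] R3} {δ : ℝ} (hδ : 0 < δ)
    (hB : ∀ v, δ * ‖v‖ ^ 2 ≤ ‖v‖ ^ 2 + inner ℝ v (B v)) (a : R3)
    (h0 : ∀ p, trace3 (derivOuP h t r p) + trace3 (B ∘L derivOuP h t r p) =
      -(maxwellian p * inner ℝ p (a + B a))) (p : R3) :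
    h t r p = maxwellian p * (density h t r + inner ℝ p a) := by
  set k : R3 → ℝ := fun q => h t r q - maxwellian q * inner ℝ q a with hkdef
  set A : R3 →L[ℝ] R3 := ContinuousLinearMap.id ℝ R3 + B with hA
  have hkd : ∀ q, HasFDerivAt k (innerSL ℝ (gradP h t r q) -
      innerSL ℝ (maxwellian q • a - (maxwellian q * inner ℝ q a) • q)) q := fun q => by
    have h1 := (hh.diff_p t ht r q).hasFDerivAt
    rw [fderiv_eq_innerSL] at h1
    exact h1.sub (hasFDerivAt_maxwellian_inner a q)
  have hgrad : ∀ q, k q • q + gradient k q = ouP h t r q - maxwellian q • a := fun q => by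
    have h1 : gradient k q = gradP h t r q -
        (maxwellian q • a - (maxwellian q * inner ℝ q a) • q) := by
      refine ext_inner_right ℝ fun v => ?_
      rw [inner_gradient_left, (hkd q).fderiv, ← map_sub, innerSL_apply_apply]
    rw [h1, hkdef, ouP]
    module
  have hkeq : (fun q => k q • q + gradient k q) = fun q => ouP h t r q - maxwellian q • a :=
    funext hgrad
  have hc : ContDiff ℝ 1 fun q => k q • q + gradient k q := by
    rw [hkeq]
    exact (hh.contDiff_ouP ht r).sub (contDiff_maxwellian.smul contDiff_const)
  have hint : Integrable fun q => k q • q + gradient k q := by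
    rw [hkeq]
    exact (hh.integrable_ouP ht r).sub (integrable_maxwellian.smul_const a)
  have hdiv : ∀ q, divg (fun q => A (k q • q + gradient k q)) q = 0 := fun q => by
    have h1 : HasFDerivAt (fun q => A (k q • q + gradient k q))
        (A ∘L (derivOuP h t r q - (-(maxwellian q) • innerSL ℝ q).smulRight a)) q := by
      simp only [hgrad]
      exact A.hasFDerivAt.comp q ((hh.hasFDerivAt_ouP ht r q).sub
        ((hasFDerivAt_maxwellian q).smul_const a))
    have h2 : trace3 (A ∘L derivOuP h t r q) = -(maxwellian q * inner ℝ q (a + B a)) := by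
      rw [← h0, hA, ContinuousLinearMap.add_comp, map_add, ContinuousLinearMap.id_comp]
    rw [divg_eq_trace3, h1.fderiv, ContinuousLinearMap.comp_sub, map_sub, h2,
      trace3_comp_smulRight]
    simp [hA]
  have hmain := eq_maxwellian_mul (fun q => (hkd q).differentiableAt) hc hδ
    (A := A) (fun v => by
      rw [hA, add_apply, ContinuousLinearMap.id_apply, inner_add_right,
        real_inner_self_eq_norm_sq]
      exact hB v) hint hdiv p
  have hI : ∫ q, k q = density h t r := by
    rw [hkdef, integral_sub (hh.integrable_val ht r) (integrable_maxwellian_inner a),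
      integral_maxwellian_inner, sub_zero, density]
  rw [hI] at hmain
  simp only [hkdef] at hmain
  linarith

variable {ρ : R3 → ℝ} {a : R3 → R3}

lemma gradP_of_equilibrium (he : ∀ r p, h t r p = maxwellian p * ρ r) (r p : R3) :
    gradP h t r p = -(maxwellian p * ρ r) • p := by
  refine ext_inner_right ℝ fun v => ?_
  have h1 : (fun q => h t r q) = fun q => maxwellian q * ρ r := funext fun q => he r q
  rw [gradP, inner_gradient_left, h1, ((hasFDerivAt_maxwellian p).mul_const (ρ r)).fderiv]
  simp [real_inner_smul_left]
  ring

lemma gradR_of_equilibrium (he : ∀ r p, h t r p = maxwellian p * ρ r) (hρ : Differentiable ℝ ρ)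
    (r p : R3) : gradR h t r p = maxwellian p • gradient ρ r := by
  refine ext_inner_right ℝ fun v => ?_
  have h1 : (fun x => h t x p) = fun x => maxwellian p * ρ x := funext fun x => he x p
  rw [gradR, inner_gradient_left, h1, fderiv_const_mul (hρ r), real_inner_smul_left,
    inner_gradient_left]
  rfl

lemma derivOuP_of_equilibrium (hh : IsRegular T h) (ht : t ∈ Icc 0 T)
    (he : ∀ r p, h t r p = maxwellian p * ρ r) (r p : R3) : derivOuP h t r p = 0 := by
  have h1 : (fun q => ouP h t r q) = fun _ => 0 := by
    funext q
    rw [ouP, gradP_of_equilibrium he, he]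
    module
  have h2 := (hh.hasFDerivAt_ouP ht r p).fderiv
  rw [h1] at h2
  simpa using h2.symm

lemma integral_inner_gradR_of_equilibrium (he : ∀ r p, h t r p = maxwellian p * ρ r)
    (hρ : Differentiable ℝ ρ) (r : R3) :
    ∫ p, inner ℝ p (gradR h t r p) • p = gradient ρ r := by
  simp only [gradR_of_equilibrium he hρ, real_inner_smul_right]
  exact integral_maxwellian_inner_smul _

/-- The flux term of a local equilibrium does not contribute to the divergence of the stress, by
parity. -/
lemma integral_inner_gradR_of_localEquilibrium
    (he : ∀ r p, h t r p = maxwellian p * (ρ r + inner ℝ p (a r)))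
    (hρ : Differentiable ℝ ρ) (ha : Differentiable ℝ a) (r : R3) :
    ∫ p, inner ℝ p (gradR h t r p) • p = gradient ρ r := by
  have h1 : ∀ p, inner ℝ p (gradR h t r p) • p = (maxwellian p * inner ℝ p (gradient ρ r)) • p
      + maxwellian p • ((inner ℝ p (fderiv ℝ a r p) : ℝ) • p) := fun p => by
    have h2 : (fun x => h t x p) = fun x => maxwellian p * (ρ x + inner ℝ p (a x)) :=
      funext fun x => he x p
    have h3 : HasFDerivAt (fun x => maxwellian p * (ρ x + inner ℝ p (a x)))
        (maxwellian p • (fderiv ℝ ρ r + (innerSL ℝ p) ∘L fderiv ℝ a r)) r :=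
      ((hρ r).hasFDerivAt.add ((innerSL ℝ p).hasFDerivAt.comp r (ha r).hasFDerivAt)).const_mul _
    rw [gradR, real_inner_comm, inner_gradient_left, h2, h3.fderiv]
    simp only [smul_apply, add_apply, ContinuousLinearMap.comp_apply, innerSL_apply_apply,
      fderiv_eq_inner_gradient ρ r p, real_inner_comm p (gradient ρ r), smul_eq_mul]
    module
  have i1 : Integrable fun p => (maxwellian p * inner ℝ p (gradient ρ r)) • p := by
    simp only [mul_smul]
    refine integrable_maxwellian_smul (by fun_prop) (C := ‖gradient ρ r‖) (n := 2) fun p => ?_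
    rw [norm_smul]
    have h4 := norm_inner_le_norm (𝕜 := ℝ) p (gradient ρ r)
    have h5 := norm_nonneg p
    have h6 := norm_nonneg (gradient ρ r)
    calc _ ≤ (‖p‖ * ‖gradient ρ r‖) * ‖p‖ := by gcongr
      _ ≤ _ := by nlinarith [mul_nonneg h5 h6]
  have i2 : Integrable fun p => maxwellian p • ((inner ℝ p (fderiv ℝ a r p) : ℝ) • p) := by
    refine integrable_maxwellian_smul (by fun_prop) (C := ‖fderiv ℝ a r‖) (n := 3) fun p => ?_
    rw [norm_smul]
    have h4 := norm_inner_le_norm (𝕜 := ℝ) p (fderiv ℝ a r p)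
    have h5 := norm_nonneg p
    have h6 := norm_nonneg (fderiv ℝ a r)
    calc _ ≤ (‖p‖ * (‖fderiv ℝ a r‖ * ‖p‖)) * ‖p‖ := by
          gcongr
          exact h4.trans (by gcongr; exact ContinuousLinearMap.le_opNorm _ _)
      _ = ‖fderiv ℝ a r‖ * ‖p‖ ^ 3 := by ring
      _ ≤ _ := by gcongr; linarith
  simp only [h1]
  rw [integral_add i1 i2, integral_maxwellian_inner_smul,
    integral_eq_zero_of_odd (u := fun p => maxwellian p • ((inner ℝ p (fderiv ℝ a r p) : ℝ) • p))
      fun p => by simp [maxwellian_neg], add_zero]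

end localEquilibrium

/-- The expansion holds at positive times only; identities that are continuous in time extend to the
initial time. -/
lemma eqOn_Icc_of_eqOn_Ioc {E : Type*} [TopologicalSpace E] [T2Space E] {T : ℝ} (hT : 0 < T)
    {u v : ℝ → E} (hu : ContinuousOn u (Icc 0 T)) (hv : ContinuousOn v (Icc 0 T))
    (huv : ∀ t ∈ Ioc 0 T, u t = v t) : ∀ t ∈ Icc 0 T, u t = v t :=
  EqOn.of_subset_closure (s := Ioc 0 T) huv hu hv Ioc_subset_Icc_self (by rw [closure_Ioc hT.ne])

/-! ### The coefficients of the expansion -/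

namespace IsExpandedSolution

variable {S : Model} {T ε₀ : ℝ} {F : ℝ → PhaseFun} {f : ℕ → PhaseFun} {t : ℝ}

lemma fredholm_eq (H : IsExpandedSolution S T ε₀ F f) (ht : t ∈ Icc 0 T) (a : R3 → R3) (r : R3) :
    S.fredholm (density (f 0) t) a r =
      a r + S.meanZ₁ (density (f 0) t) r (a r) + density (f 0) t r • S.meanZ₂ a r :=
  Model.fredholm_eq H.admissible
    (isField_density.integrable (H.regular_coeff (n := 0) (by norm_num)) ht) a r

/-- The integral equation for the flux has at most one solution. -/
lemma eq_zero_of_fredholm (H : IsExpandedSolution S T ε₀ F f) (ht : t ∈ Icc 0 T) {c : R3 → R3}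
    (hc : Continuous c) (hci : Integrable c)
    (h0 : ∀ r, S.fredholm (density (f 0) t) c r = 0) : c = 0 := by
  obtain ⟨δ, hδ, hpos⟩ := H.leading_density
  have h := H.regular_coeff (n := 0) (by norm_num)
  exact (hpos t ht).2.eq_zero_of_fredholm H.admissible hδ (isField_density.integrable h ht)
    (isField_density.continuous h ht).measurable (hpos t ht).1 hc hci h0

/-- The leading order carries no flux. -/
lemma flux_zero (H : IsExpandedSolution S T ε₀ F f) (hT : 0 < T) (ht : t ∈ Icc 0 T) :
    flux (f 0) t = 0 := by
  have h := H.regular_coeff (n := 0) (by norm_num)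
  funext r
  refine eqOn_Icc_of_eqOn_Ioc hT (isField_flux.continuousOn_time h r) continuousOn_const
    (fun t ht => ?_) t ht
  have ht' : t ∈ Icc 0 T := ⟨ht.1.le, ht.2⟩
  refine congrFun (H.eq_zero_of_fredholm ht' (isField_flux.continuous h ht')
    (isField_flux.integrable h ht') fun r => ?_) r
  rw [H.fredholm_eq ht']
  exact (H.momentum_orders ht r).1

lemma meanZ₂_flux_zero (H : IsExpandedSolution S T ε₀ F f) (hT : 0 < T) (ht : t ∈ Icc 0 T)
    (r : R3) : S.meanZ₂ (flux (f 0) t) r = 0 := by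
  simp [H.flux_zero hT ht, Model.meanZ₂]

/-- The leading order is in thermal equilibrium. -/
lemma equilibrium (H : IsExpandedSolution S T ε₀ F f) (hT : 0 < T) (ht : t ∈ Icc 0 T) (r p : R3) :
    f 0 t r p = maxwellian p * density (f 0) t r := by
  have h := H.regular_coeff (n := 0) (by norm_num)
  refine eqOn_Icc_of_eqOn_Ioc hT
    (h.cont.comp (f := fun t : ℝ => (t, r, p)) (by fun_prop) fun _ ht => ⟨ht, trivial⟩)
    (continuousOn_const.mul (isField_density.continuousOn_time h r)) (fun t ht => ?_) t ht
  have ht' : t ∈ Icc 0 T := ⟨ht.1.le, ht.2⟩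
  obtain ⟨δ, hδ, hpos⟩ := H.leading_density
  have hae : (fun r => f 0 t r p) =ᵐ[volume] fun r => maxwellian p * density (f 0) t r := by
    filter_upwards [(hpos t ht').2.diag] with r hr
    have h1 := h.eq_localEquilibrium ht' hδ hr 0 (fun q => by
      have h2 := (H.kinetic_orders ht r q).1
      rw [H.meanZ₂_flux_zero hT ht', inner_zero_left, add_zero] at h2
      simpa using h2) p
    simpa using h1
  refine congrFun ((Continuous.ae_eq_iff_eq volume ?_ ?_).1 hae) r
  · exact (continuous_slice h.cont ht').comp (by fun_prop : Continuous fun r : R3 => (r, p))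
  · exact (isField_density.continuous h ht').const_mul _

lemma continuousOn_totalForce (H : IsExpandedSolution S T ε₀ F f) (r : R3) :
    ContinuousOn (fun t => S.totalForce t (density (f 0) t) r) (Icc 0 T) := by
  refine ContinuousOn.add ?_
    (Model.continuousOn_meanForce H.admissible (H.regular_coeff (n := 0) (by norm_num)) r)
  exact ((H.admissible.cont_gradU₁ r).const_smul S.kT⁻¹).congr fun t ht =>
    Model.gradient_V₁ H.admissible ht r

lemma continuousOn_gradient_density {h : PhaseFun} (hh : IsRegular T h) (r : R3) :
    ContinuousOn (fun t => gradient (density h t) r) (Icc 0 T) :=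
  ((isField_integral isLocalOp_gradR).continuousOn_time hh r).congr fun _ ht =>
    hh.gradient_density ht r

/-- The first-order flux balances the diffusive and the driving forces. -/
lemma flux_one (H : IsExpandedSolution S T ε₀ F f) (hT : 0 < T) (ht : t ∈ Icc 0 T) (r : R3) :
    flux (f 1) t r + S.meanZ₁ (density (f 0) t) r (flux (f 1) t r)
      + density (f 0) t r • S.meanZ₂ (flux (f 1) t) r =
    -(gradient (density (f 0) t) r
      + density (f 0) t r • S.totalForce t (density (f 0) t) r) := by
  have h := H.regular_coeff (n := 0) (by norm_num)
  have h1 := H.regular_coeff (n := 1) (by norm_num)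
  have hρ := isField_density.continuousOn_time h r
  have hJ := isField_flux.continuousOn_time h1 r
  refine eqOn_Icc_of_eqOn_Ioc hT
    ((hJ.add ((Model.continuousOn_meanZ₁ H.admissible h r).clm_apply hJ)).add
      (hρ.smul (Model.continuousOn_meanZ₂ H.admissible h1 r)))
    ((continuousOn_gradient_density h r).add (hρ.smul (H.continuousOn_totalForce r))).neg
    (fun t ht => ?_) t ht
  have ht' : t ∈ Icc 0 T := ⟨ht.1.le, ht.2⟩
  have h2 := (H.momentum_orders ht r).2.1
  rw [H.meanZ₂_flux_zero hT ht', H.flux_zero hT ht', Pi.zero_apply, map_zero, smul_zero, add_zero,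
    add_zero, integral_inner_gradR_of_equilibrium (H.equilibrium hT ht')
      (h.differentiable_density ht')] at h2
  exact eq_neg_of_add_eq_zero_right h2

/-- The first order is a local equilibrium. -/
lemma localEquilibrium (H : IsExpandedSolution S T ε₀ F f) (hT : 0 < T) (ht : t ∈ Ioc 0 T)
    (r p : R3) :
    f 1 t r p = maxwellian p * (density (f 1) t r + inner ℝ p (flux (f 1) t r)) := by
  have h := H.regular_coeff (n := 0) (by norm_num)
  have h1 := H.regular_coeff (n := 1) (by norm_num)
  have ht' : t ∈ Icc 0 T := ⟨ht.1.le, ht.2⟩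
  obtain ⟨δ, hδ, hpos⟩ := H.leading_density
  have hae : (fun r => f 1 t r p) =ᵐ[volume] fun r =>
      maxwellian p * (density (f 1) t r + inner ℝ p (flux (f 1) t r)) := by
    filter_upwards [(hpos t ht').2.diag] with r hr
    refine h1.eq_localEquilibrium ht' hδ hr _ (fun q => ?_) p
    have h2 := (H.kinetic_orders ht r q).2
    rw [H.meanZ₂_flux_zero hT ht', gradP_of_equilibrium (H.equilibrium hT ht'),
      gradR_of_equilibrium (H.equilibrium hT ht') (h.differentiable_density ht'),
      derivOuP_of_equilibrium h ht' (H.equilibrium hT ht'), ContinuousLinearMap.comp_zero,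
      map_zero, inner_zero_left, add_zero, zero_add] at h2
    have h3 := congrArg (fun v => inner ℝ q v) (H.flux_one hT ht' r)
    simp only [inner_add_right, inner_neg_right, real_inner_smul_right] at h2 h3 ⊢
    rw [real_inner_comm q, real_inner_comm q] at h2
    linear_combination h2 + maxwellian q * h3
  refine congrFun ((Continuous.ae_eq_iff_eq volume ?_ ?_).1 hae) r
  · exact (continuous_slice h1.cont ht').comp (by fun_prop : Continuous fun r : R3 => (r, p))
  · have c1 := isField_density.continuous h1 ht'
    have c2 := isField_flux.continuous h1 ht'
    fun_prop

lemma psiSource_eq (H : IsExpandedSolution S T ε₀ F f) (ht : t ∈ Icc 0 T) (r : R3) :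
    S.psiSource t (density (f 0) t) (flux (f 1) t) (density (f 1) t) r =
      gradient (density (f 1) t) r + density (f 1) t r • S.totalForce t (density (f 0) t) r
      + density (f 0) t r • S.meanForce (density (f 1) t) r
      + S.meanZ₁ (density (f 1) t) r (flux (f 1) t r)
      + density (f 1) t r • S.meanZ₂ (flux (f 1) t) r := by
  rw [Model.meanZ₁_apply H.admissible
    (isField_density.integrable (H.regular_coeff (n := 1) (by norm_num)) ht), Model.totalForce,
    smul_add, ← add_assoc]
  rfl

/-- The second-order flux solves the linearised flux equation. -/
lemma flux_two (H : IsExpandedSolution S T ε₀ F f) (hT : 0 < T) (ht : t ∈ Icc 0 T) (r : R3) :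
    S.fredholm (density (f 0) t) (flux (f 2) t) r =
      -S.psiSource t (density (f 0) t) (flux (f 1) t) (density (f 1) t) r := by
  have h := H.regular_coeff (n := 0) (by norm_num)
  have h1 := H.regular_coeff (n := 1) (by norm_num)
  have h2 := H.regular_coeff (n := 2) (by norm_num)
  have hρ := isField_density.continuousOn_time h r
  have hψ := isField_density.continuousOn_time h1 r
  have ha := isField_flux.continuousOn_time h1 r
  have hJ := isField_flux.continuousOn_time h2 r
  have hS := H.admissible
  rw [H.fredholm_eq ht, H.psiSource_eq ht]
  refine eqOn_Icc_of_eqOn_Ioc hT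
    ((hJ.add ((Model.continuousOn_meanZ₁ hS h r).clm_apply hJ)).add
      (hρ.smul (Model.continuousOn_meanZ₂ hS h2 r)))
    (((((continuousOn_gradient_density h1 r).add (hψ.smul (H.continuousOn_totalForce r))).add
      (hρ.smul (Model.continuousOn_meanForce hS h1 r))).add
      ((Model.continuousOn_meanZ₁ hS h1 r).clm_apply ha)).add
      (hψ.smul (Model.continuousOn_meanZ₂ hS h1 r))).neg
    (fun t ht => ?_) t ht
  have ht' : t ∈ Icc 0 T := ⟨ht.1.le, ht.2⟩
  have hJt : ∫ p, dt T (f 0) t r p • p = 0 := by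
    have h3 := h.hasDerivWithinAt_flux ht' r
    have h4 : HasDerivWithinAt (fun s => flux (f 0) s r) 0 (Icc 0 T) t :=
      (hasDerivWithinAt_const t _ (0 : R3)).congr (fun s hs => by rw [H.flux_zero hT hs]; rfl)
        (by rw [H.flux_zero hT ht']; rfl)
    exact (uniqueDiffOn_Icc hT t ht').eq_deriv _ h3 h4
  have h3 := (H.momentum_orders ht r).2.2
  rw [hJt, integral_inner_gradR_of_localEquilibrium (H.localEquilibrium hT ht)
    (h1.differentiable_density ht') (h1.differentiable_flux ht'), H.meanZ₂_flux_zero hT ht',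
    H.flux_zero hT ht', Pi.zero_apply, map_zero, smul_zero] at h3
  rw [← sub_eq_zero, ← h3]
  simp only [Pi.add_apply, Pi.neg_apply, Pi.smul_apply']
  abel

/-- Conservation of mass: the flux of each order drives the density of the preceding one. -/
lemma evolution (H : IsExpandedSolution S T ε₀ F f) (hT : 0 < T) {n : ℕ} (hn : n < 2)
    (ht : t ∈ Icc 0 T) (r : R3) :
    HasDerivWithinAt (fun s => density (f n) s r) (-divg (flux (f (n + 1)) t) r) (Icc 0 T) t := by
  have h := H.regular_coeff (n := n) (by omega)
  have h' := H.regular_coeff (n := n + 1) (by omega)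
  refine (h.hasDerivWithinAt_density ht r).congr_deriv ?_
  rw [h'.divg_flux ht]
  refine eqOn_Icc_of_eqOn_Ioc hT ((isField_integral isLocalOp_dt).continuousOn_time h r)
    ((isField_integral_inner isLocalOp_gradR).continuousOn_time h' r).neg (fun t ht => ?_) t ht
  have h1 := H.mass_orders ht r
  interval_cases n
  exacts [h1.1, h1.2]

/-- The first correction to the density solves the equation for `ψ`. -/
lemma isPsiSolution (H : IsExpandedSolution S T ε₀ F f) (hT : 0 < T) :
    S.IsPsiSolution T (density (f 0)) (flux (f 1)) (density (f 1)) (flux (f 2)) := by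
  have h1 := H.regular_coeff (n := 1) (by norm_num)
  have h2 := H.regular_coeff (n := 2) (by norm_num)
  have hg := isField_integral (T := T) isLocalOp_gradR
  have hD := isField_fderiv_flux (T := T)
  refine ⟨fun t ht => h1.differentiable_density ht, fun t ht => h2.differentiable_flux ht,
    isField_density.cont _ h1, ?_, isField_flux.cont _ h2, ?_, ?_,
    fun t ht r => H.evolution hT (n := 1) (by norm_num) ht r, fun t ht r => H.flux_two hT ht r⟩
  · exact (hg.cont _ h1).congr fun z hz => h1.gradient_density hz.1 z.2
  · exact (hD.cont _ h2).congr fun z hz => (h2.hasFDerivAt_flux hz.1 z.2).fderiv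
  · obtain ⟨B1, _, hB1⟩ := (isField_density (T := T)).exists_bound h1
    obtain ⟨B2, _, hB2⟩ := hg.exists_bound h1
    obtain ⟨B3, _, hB3⟩ := (isField_flux (T := T)).exists_bound h2
    obtain ⟨B4, _, hB4⟩ := hD.exists_bound h2
    refine ⟨B1 + B2 + B3 + B4, fun t ht r => ?_⟩
    rw [h1.gradient_density ht, (h2.hasFDerivAt_flux ht r).fderiv]
    have e : decay4 r * (1 + ‖r‖) ^ 4 = 1 := inv_mul_cancel₀ (by positivity)
    calc _ ≤ ((B1 + B2 + B3 + B4) * decay4 r) * (1 + ‖r‖) ^ 4 := by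
          gcongr
          linarith [hB1 t ht r, hB2 t ht r, hB3 t ht r, hB4 t ht r,
            Real.norm_eq_abs (density (f 1) t r)]
      _ = _ := by rw [mul_assoc, e, mul_one]

end IsExpandedSolution

namespace Model

variable {S : Model} {T : ℝ}

lemma gradient_fun_neg (u : R3 → ℝ) (r : R3) : gradient (fun x => -u x) r = -gradient u r := by
  unfold gradient; rw [fderiv_fun_neg, map_neg]

/-- The equation for `ψ` is linear. -/
lemma IsPsiSolution.neg {ρ ψ : ℝ → R3 → ℝ} {a a₂ : ℝ → R3 → R3}
    (h : S.IsPsiSolution T ρ a ψ a₂) :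
    S.IsPsiSolution T ρ a (fun t r => -ψ t r) (fun t r => -a₂ t r) where
  diff_psi t ht := (h.diff_psi t ht).neg
  diff_flux t ht := (h.diff_flux t ht).neg
  cont_psi := h.cont_psi.neg
  cont_grad := h.cont_grad.neg.congr fun z _ => gradient_fun_neg (ψ z.1) z.2
  cont_flux := h.cont_flux.neg
  cont_dflux := h.cont_dflux.neg.congr fun _ _ => fderiv_fun_neg
  decay := by
    obtain ⟨B, hB⟩ := h.decay
    refine ⟨B, fun t ht r => ?_⟩
    rw [gradient_fun_neg, fderiv_fun_neg, abs_neg, norm_neg, norm_neg, norm_neg]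
    exact hB t ht r
  evolution t ht r := by
    refine (h.evolution t ht r).neg.congr_deriv ?_
    rw [divg_eq_trace3, divg_eq_trace3, fderiv_fun_neg, map_neg]
  flux_eq t ht r := by
    have h1 := h.flux_eq t ht r
    have h2 : S.fredholm (ρ t) (fun r => -a₂ t r) r = -S.fredholm (ρ t) (a₂ t) r := by
      simp only [fredholm, map_neg, smul_neg, integral_neg, neg_add]
    have h3 : S.psiSource t (ρ t) (a t) (fun r => -ψ t r) r =
        -S.psiSource t (ρ t) (a t) (ψ t) r := by
      simp only [psiSource, gradient_fun_neg, neg_smul, neg_mul, mul_neg, integral_neg, smul_neg,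
        neg_add]
    rw [h2, h3, h1]

end Model

namespace IsExpandedSolution

variable {S : Model} {T ε₀ : ℝ} {F : ℝ → PhaseFun} {f : ℕ → PhaseFun}

/-- The first correction to the density vanishes: it vanishes initially, and together with its
negative it solves an equation that preserves non-negativity. -/
lemma density_one (H : IsExpandedSolution S T ε₀ F f) (hT : 0 < T)
    (hpsi : S.PsiPreservesNonneg T (density (f 0)) (flux (f 1))) {t : ℝ} (ht : t ∈ Icc 0 T)
    (r : R3) : density (f 1) t r = 0 := by
  have h0 : ∀ r, density (f 1) 0 r = 0 := fun r => by
    obtain ⟨B, hB⟩ := H.expansion.marginal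
    have h1 : ∀ᶠ ε in 𝓝[>] (0 : ℝ), |density (f 1) 0 r| ≤ B * ε := by
      filter_upwards [Ioo_mem_nhdsGT H.eps_pos] with ε hε
      have h2 := hB ε hε 0 ⟨le_rfl, hT.le⟩ r
      rw [H.density_initial hε, sub_add_cancel_left, abs_neg, abs_mul, abs_of_pos hε.1] at h2
      have h3 : ε * |density (f 1) 0 r| ≤ ε * (B * ε) := by linarith
      exact le_of_mul_le_mul_left h3 hε.1
    have h2 : Tendsto (fun ε : ℝ => B * ε) (𝓝[>] 0) (𝓝 0) := by
      have hc : Continuous fun ε : ℝ => B * ε := by fun_prop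
      simpa using (hc.tendsto 0).mono_left (nhdsWithin_le_nhds (s := Ioi 0))
    exact abs_nonpos_iff.1 (ge_of_tendsto h2 h1)
  have hsol := H.isPsiSolution hT
  have h1 := hpsi _ _ hsol (fun r => (h0 r).ge) t ht r
  have h2 := hpsi _ _ hsol.neg (fun r => by rw [h0, neg_zero]) t ht r
  linarith

lemma exists_error_bound (H : IsExpandedSolution S T ε₀ F f) (hT : 0 < T)
    (hpsi : S.PsiPreservesNonneg T (density (f 0)) (flux (f 1))) :
    ∃ C, ∀ ε ∈ Ioo 0 ε₀, ∀ t ∈ Icc 0 T, ∀ r,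
      |density (F ε) t r - density (f 0) t r| ≤ C * ε ^ 2 := by
  obtain ⟨B, hB⟩ := H.expansion.marginal
  refine ⟨B, fun ε hε t ht r => ?_⟩
  have h1 := hB ε hε t ht r
  rwa [H.density_one hT hpsi ht, mul_zero, add_zero] at h1

lemma totalForce_eq (H : IsExpandedSolution S T ε₀ F f) {t : ℝ} (ht : t ∈ Icc 0 T) (ρ : R3 → ℝ)
    (r : R3) : S.totalForce t ρ r = (1 / S.kT) •
      (gradient (S.U₁ t) r + ∫ r' : R3, (ρ r' * S.g r r') • S.gradU₂ r r') := by
  rw [Model.totalForce, Model.gradient_V₁ H.admissible ht, one_div, smul_add, Model.meanForce,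
    ← integral_smul]
  simp only [Model.gradV₂_eq, smul_comm S.kT⁻¹]

lemma isFluxSolution (H : IsExpandedSolution S T ε₀ F f) (hT : 0 < T) {t : ℝ} (ht : t ∈ Icc 0 T) :
    S.IsFluxSolution (S.U₁ t) (density (f 0) t) (flux (f 1) t) := fun r => by
  rw [H.fredholm_eq ht, H.flux_one hT ht, H.totalForce_eq ht, smul_comm (1 / S.kT)]

lemma eq_of_isFluxSolution (H : IsExpandedSolution S T ε₀ F f) (hT : 0 < T) {t : ℝ}
    (ht : t ∈ Icc 0 T) {b : R3 → R3} (hb : Continuous b) (hbi : Integrable b)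
    (h : S.IsFluxSolution (S.U₁ t) (density (f 0) t) b) : b = flux (f 1) t := by
  have h1 := H.regular_coeff (n := 1) (by norm_num)
  have ha := isField_flux.continuous h1 ht
  have hai := isField_flux.integrable h1 ht
  refine sub_eq_zero.1 (H.eq_zero_of_fredholm ht (hb.sub ha) (hbi.sub hai) fun r => ?_)
  have h2 : S.meanZ₂ (b - flux (f 1) t) r = S.meanZ₂ b r - S.meanZ₂ (flux (f 1) t) r := by
    rw [Model.meanZ₂, Model.meanZ₂, Model.meanZ₂, ← integral_sub
      (Model.integrable_meanZ₂ H.admissible hbi r) (Model.integrable_meanZ₂ H.admissible hai r)]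
    simp only [Pi.sub_apply, map_sub, smul_sub]
  have h3 := (h r).trans (H.isFluxSolution hT ht r).symm
  rw [H.fredholm_eq ht, H.fredholm_eq ht] at h3
  rw [H.fredholm_eq ht, h2, Pi.sub_apply, map_sub, smul_sub, ← sub_eq_zero.2 h3]
  abel

end IsExpandedSolution

end Colloid

end

theorem theorem4p1
    (S : Colloid.Model) (t₀ ε₀ : ℝ) (ht₀ : 0 < t₀) (hε₀ : 0 < ε₀)
    (hS : S.Admissible t₀)
    -- the one-body distributions, the coefficients of their expansion, the initial density
    (F : ℝ → Colloid.PhaseFun) (f : ℕ → Colloid.PhaseFun) (ρinit : Colloid.R3 → ℝ)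
    (hreg : ∀ ε ∈ Set.Ioo 0 ε₀, Colloid.IsRegular t₀ (F ε))
    (hpos : ∀ ε ∈ Set.Ioo 0 ε₀, ∀ t ∈ Set.Icc 0 t₀, ∀ r p, 0 < F ε t r p)
    (hkin : ∀ ε ∈ Set.Ioo 0 ε₀, S.IsKineticSolution t₀ ε (F ε))
    (hEnskog : ∀ ε ∈ Set.Ioo 0 ε₀, ∀ t ∈ Set.Icc 0 t₀, ∃ FN, S.IsEnskog (F ε t) FN)
    (hexp : Colloid.HasHilbertExpansion t₀ ε₀ F f)
    (hinit : ∀ ε ∈ Set.Ioo 0 ε₀, ∀ r p, F ε 0 r p = f 0 0 r p ∧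
      f 0 0 r p = Colloid.maxwellian p * ρinit r)
    (hpsi : S.PsiPreservesNonneg t₀ (Colloid.density (f 0)) (Colloid.flux (f 1))) :
    ∃ (ρ₀ : ℝ → Colloid.R3 → ℝ) (a₀ : ℝ → Colloid.R3 → Colloid.R3) (C : ℝ),
      (∀ t ∈ Set.Icc 0 t₀, ∀ r p, f 0 t r p = Colloid.maxwellian p * ρ₀ t r) ∧
      ∀ γ : ℝ, 0 < γ → √(S.kT / S.m) / γ < ε₀ →
        ∃ (ρ : ℝ → Colloid.R3 → ℝ) (a : ℝ → Colloid.R3 → Colloid.R3),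
          (∀ τ, ρ τ = ρ₀ (S.kT / (S.m * γ) * τ)) ∧ (∀ τ, a τ = a₀ (S.kT / (S.m * γ) * τ)) ∧
          (∀ r, ρ 0 r = ρinit r) ∧
          ∀ τ ∈ Set.Icc 0 (S.m * γ / S.kT * t₀),
            Differentiable ℝ (ρ τ) ∧ MeasureTheory.Integrable (ρ τ) ∧
            Differentiable ℝ (a τ) ∧ MeasureTheory.Integrable (a τ) ∧
            -- the evolution equation in the original time scale
            (∀ r, HasDerivWithinAt (fun s => ρ s r)
              (-(S.kT / (S.m * γ)) * Colloid.divg (a τ) r)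
              (Set.Icc 0 (S.m * γ / S.kT * t₀)) τ) ∧
            -- `a τ` is the solution of the Fredholm integral equation
            S.IsFluxSolution (S.U₁ (S.kT / (S.m * γ) * τ)) (ρ τ) (a τ) ∧
            (∀ b : Colloid.R3 → Colloid.R3, Continuous b → MeasureTheory.Integrable b →
              S.IsFluxSolution (S.U₁ (S.kT / (S.m * γ) * τ)) (ρ τ) b → b = a τ) ∧
            -- the position distribution agrees with `ρ` up to an error of order `ε ^ 2`
            (∀ r, |Colloid.density (F (√(S.kT / S.m) / γ)) (S.kT / (S.m * γ) * τ) r - ρ τ r|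
              ≤ C * (√(S.kT / S.m) / γ) ^ 2) := by
  have H : Colloid.IsExpandedSolution S t₀ ε₀ F f :=
    ⟨hε₀, hS, hreg, hpos, hkin, hEnskog, hexp, fun ε hε r p => (hinit ε hε r p).1⟩
  have h0 := H.regular_coeff (n := 0) (by norm_num)
  have h1 := H.regular_coeff (n := 1) (by norm_num)
  obtain ⟨C, hC⟩ := H.exists_error_bound ht₀ hpsi
  refine ⟨Colloid.density (f 0), Colloid.flux (f 1), C, fun t ht r p => H.equilibrium ht₀ ht r p,
    fun γ hγ hε => ?_⟩
  have hk := hS.kT_pos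
  have hm := hS.m_pos
  set c : ℝ := S.kT / (S.m * γ) with hc
  have hc0 : 0 < c := by positivity
  have hL : S.m * γ / S.kT * t₀ = t₀ / c := by rw [hc]; field_simp
  have hmem : ∀ τ ∈ Set.Icc 0 (S.m * γ / S.kT * t₀), c * τ ∈ Set.Icc 0 t₀ := fun τ hτ => by
    rw [hL] at hτ
    exact ⟨mul_nonneg hc0.le hτ.1, (le_div_iff₀' hc0).1 hτ.2⟩
  have hεmem : √(S.kT / S.m) / γ ∈ Set.Ioo 0 ε₀ := ⟨by positivity, hε⟩
  refine ⟨fun τ => Colloid.density (f 0) (c * τ), fun τ => Colloid.flux (f 1) (c * τ),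
    fun τ => rfl, fun τ => rfl, fun r => ?_, fun τ hτ => ?_⟩
  · have h2 : ∀ p, f 0 0 r p = Colloid.maxwellian p * ρinit r := fun p => (hinit _ hεmem r p).2
    simp only [mul_zero, Colloid.density, h2]
    rw [MeasureTheory.integral_mul_const, Colloid.integral_maxwellian, one_mul]
  · have ht := hmem τ hτ
    refine ⟨h0.differentiable_density ht, Colloid.isField_density.integrable h0 ht,
      h1.differentiable_flux ht, Colloid.isField_flux.integrable h1 ht, fun r => ?_,
      H.isFluxSolution ht₀ ht, fun b hb hbi h => H.eq_of_isFluxSolution ht₀ ht hb hbi h,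
      fun r => hC _ hεmem _ ht r⟩
    have h2 : HasDerivWithinAt (fun τ => c * τ) c (Set.Icc 0 (S.m * γ / S.kT * t₀)) τ := by
      simpa using (hasDerivWithinAt_id τ _).const_mul c
    refine ((H.evolution ht₀ (n := 0) (by norm_num) ht r).scomp τ h2 hmem).congr_deriv ?_
    simp
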